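/- **Fast-growing functions.** Let $F_0(n)=n+1$ and $F_{d+1}(n)=F_d^{\,n+1}(n)$ (the $(n+1)$-fold iterate of $F_d$ applied to $n$) for $d,n\in\mathbb N$, and let $F_\omega(n)=F_{n+1}(n)$. **The class $\mathbb F_\omega$.** A language $L\subseteq\{0,1\}^*$ belongs to $\mathbb F_\omega$ if there is a primitive recursive $p:\mathbb N\to\mathbb N$ such that $L$ is decided by a deterministic (multi-tape) Turing machine in time $O(F_\omega(p(n)))$ on inputs of length $n$. A language $L'\subseteq\{0,1\}^*$ is $\mathbb F_\omega$-hard if for every $L\in\mathbb F_\omega$ there is a primitive recursive $f:\{0,1\}^*\to\{0,1\}^*$ with $w\in L\iff f(w)\in L'$ for all $w$. **Checking programs.** Fix a countably infinite set of counters. A configuration is a finitely supported map from counters to $\mathbb N$; $0$ is the zero configuration. Programs are built from the commands $\mathtt{inc}(c)$, $\mathtt{dec}(c)$, $\mathtt{test}(c)$ ($c$ a counter) by $\mathbf{loop}\ M$, $M_1;M_2$ and $M_1\ \mathbf{or}\ M_2$. Each program $M$ defines a relation $\xrightarrow{M}$ on configurations: $\mathtt{inc}(c)$ adds $1$ to $c$;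 $\mathtt{dec}(c)$ subtracts $1$ from $c$ and is possible only if $c>0$; $\mathtt{test}(c)$ changes nothing and is possible only if $c=0$; $\mathbf{loop}\ M$ is the reflexive transitive closure of $\xrightarrow{M}$; $M_1;M_2$ is the composition and $M_1\ \mathbf{or}\ M_2$ the union of the two relations. A checking program is a program of the form $M;\mathtt{test}(c_1);\dots;\mathtt{test}(c_k)$, where no test command occurs in $M$. The reachability problem for checking programs asks, given a checking program $P$ (under a standard injective binary encoding), whether $0\xrightarrow{P}\beta$ for some configuration $\beta$. **Theorem.** The reachability problem for checking programs is $\mathbb F_\omega$-hard (Ackermann-hard). -/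

import Mathlib

/-! ### Fast-growing functions -/

/-- The fast-growing functions `F_d`: `F_0 n = n + 1` and `F_{d+1} n = F_d^{n+1} n`. -/
def fastGrowing : ℕ → ℕ → ℕ
  | 0 => fun n => n + 1
  | d + 1 => fun n => (fastGrowing d)^[n + 1] n

/-- The Ackermann function `F_ω n = F_{n+1} n`. -/
def fastGrowingOmega (n : ℕ) : ℕ := fastGrowing (n + 1) n

/-! ### The complexity class `𝔽_ω` and hardness for it -/

/-- `DTIME(t)`: the binary languages decided by a deterministic multi-stack Turing machine
in time `O(t(n))`, where `n` is the length of the input. -/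
def InDTime (L : Language Bool) (t : ℕ → ℕ) : Prop :=
  ∃ f : List Bool → Bool, (∀ w, f w = true ↔ w ∈ L) ∧
    ∃ T : Turing.TM2ComputableInTime (id : List Bool → List Bool) Computability.encodeBool f,
      ∃ c : ℕ, ∀ n, T.time n ≤ c * (t n + 1)

/-- The class `𝔽_ω`, the union of `DTIME(F_ω(p(n)))` over all primitive recursive `p`. -/
def FOmega : Set (Language Bool) :=
  {L | ∃ p : ℕ → ℕ, Nat.Primrec p ∧ InDTime L (fun n => fastGrowingOmega (p n))}

/-- Primitive recursive many-one reducibility. -/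
def PrimrecManyOneReducible (L L' : Language Bool) : Prop :=
  ∃ f : List Bool → List Bool, Primrec f ∧ ∀ w, w ∈ L ↔ f w ∈ L'

/-- `𝔽_ω`-hardness: every problem of `𝔽_ω` has a primitive recursive many-one reduction
to `L'`. -/
def FOmegaHard (L' : Language Bool) : Prop :=
  ∀ L ∈ FOmega, PrimrecManyOneReducible L L'

/-! ### Counter programs -/

/-- General programs; counters are named by natural numbers. -/
inductive CounterProgram : Type
  | inc (c : ℕ)
  | dec (c : ℕ)
  | test (c : ℕ)
  | loop (M : CounterProgram)
  | seq (M₁ M₂ : CounterProgram)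
  | choice (M₁ M₂ : CounterProgram)

namespace CounterProgram

/-- Configurations: maps from counters to natural numbers with finite support. -/
abbrev Config : Type := ℕ →₀ ℕ

/-- The relation `α →^M β`. A decrement is possible only from a positive value. -/
def Step : CounterProgram → Config → Config → Prop
  | inc c => fun α β => (∀ x, x ≠ c → α x = β x) ∧ β c = α c + 1
  | dec c => fun α β => (∀ x, x ≠ c → α x = β x) ∧ β c + 1 = α c
  | test c => fun α β => (∀ x, x ≠ c → α x = β x) ∧ β c = 0 ∧ α c = 0
  | loop M => Relation.ReflTransGen (Step M)
  | seq M₁ M₂ => Relation.Comp (Step M₁) (Step M₂)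
  | choice M₁ M₂ => fun α β => Step M₁ α β ∨ Step M₂ α β

/-- No test command occurs in the program. -/
def TestFree : CounterProgram → Prop
  | inc _ => True
  | dec _ => True
  | test _ => False
  | loop M => TestFree M
  | seq M₁ M₂ => TestFree M₁ ∧ TestFree M₂
  | choice M₁ M₂ => TestFree M₁ ∧ TestFree M₂

/-- The program `M; test c₁; …; test cₙ`. -/
def thenTests (M : CounterProgram) (cs : List ℕ) : CounterProgram :=
  cs.foldl (fun N c => seq N (test c)) M

/-- Checking programs: a test-free program followed by test commands. -/
def IsChecking (P : CounterProgram) : Prop :=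
  ∃ (M : CounterProgram) (cs : List ℕ), M.TestFree ∧ P = M.thenTests cs

/-- Some configuration is reachable by the program from the zero configuration. -/
def Reaches (P : CounterProgram) : Prop :=
  ∃ β : Config, P.Step 0 β

/-- Binary encoding of programs: prefix notation, a three-bit tag for each constructor, counter
names in unary. -/
def encode : CounterProgram → List Bool
  | inc c => [false, false, false] ++ (List.replicate c true ++ [false])
  | dec c => [false, false, true] ++ (List.replicate c true ++ [false])
  | test c => [false, true, false] ++ (List.replicate c true ++ [false])
  | loop M => [false, true, true] ++ encode M
  | seq M₁ M₂ => [true, false, false] ++ (encode M₁ ++ encode M₂)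
  | choice M₁ M₂ => [true, false, true] ++ (encode M₁ ++ encode M₂)

theorem unary_append_inj {c d : ℕ} {u v : List Bool}
    (h : List.replicate c true ++ false :: u = List.replicate d true ++ false :: v) :
    c = d ∧ u = v := by
  induction c generalizing d with
  | zero => cases d <;> simp_all [List.replicate_succ]
  | succ c ih =>
    cases d with
    | zero => simp [List.replicate_succ] at h
    | succ d =>
      simp only [List.replicate_succ, List.cons_append, List.cons.injEq, true_and] at h
      obtain ⟨rfl, rfl⟩ := ih h
      exact ⟨rfl, rfl⟩

theorem encode_append_inj (M : CounterProgram) : ∀ (N : CounterProgram) (u v : List Bool),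
    M.encode ++ u = N.encode ++ v → M = N ∧ u = v := by
  induction M with
  | inc c | dec c | test c =>
    intro N u v h
    cases N <;> simp [encode] at h
    obtain ⟨rfl, rfl⟩ := unary_append_inj h
    exact ⟨rfl, rfl⟩
  | loop M ih =>
    intro N u v h
    cases N <;> simp [encode] at h
    obtain ⟨rfl, rfl⟩ := ih _ _ _ h
    exact ⟨rfl, rfl⟩
  | seq M₁ M₂ ih₁ ih₂ | choice M₁ M₂ ih₁ ih₂ =>
    intro N u v h
    cases N <;> simp [encode] at h
    obtain ⟨rfl, h₂⟩ := ih₁ _ _ _ h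
    obtain ⟨rfl, rfl⟩ := ih₂ _ _ _ h₂
    exact ⟨rfl, rfl⟩

/-- Distinct programs have distinct encodings. -/
theorem encode_injective : Function.Injective encode := fun M N h =>
  (encode_append_inj M N [] [] (by simpa using h)).1

/-- The reachability problem for checking programs, as the binary language of the encodings of
its positive instances. -/
def checkingReachability : Language Bool :=
  {w | ∃ P : CounterProgram, P.IsChecking ∧ P.Reaches ∧ P.encode = w}

end CounterProgram

set_option linter.unusedSimpArgs false

/-! A machine running in time `t` can be simulated by counters bounded by about `W ^ (n + s * t)`,
provided that these counters can be tested for zero. Test commands are available only at the very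
end, so two devices make the final tests certify many earlier ones.

Budgeted tests. Let `c` hold `C` and `d` hold `2 * B * C`, and let `x` have a partner `y` with `x +
y ≤ B`. To test `x`, move units from `y` to `x`, then from `x` to `y`, paying one unit of `d` for
each, and decrement `c`. At most `2 * B` units of `d` are paid, and exactly `2 * B` only if `x = 0`
and `y = B`. Hence the slack `d - 2 * B * c` never decreases. It starts at zero, so if `c` and `d`
are both zero at the end, then every test was accurate. A triple `(B, C, 2 * B * C)` thus provides
`C` reliable tests on counters bounded by `B`; the number `C` is guessed. The core is
`Budget.Paired.step_zeroTest`, and `Budget.Sound`, `Budget.Mono` and `Budget.Reach` turn it into a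
calculus.

Amplifiers. An amplifier turns a triple for `B` into one for `F B`, correctly if all its other
counters end at zero. `isAmplifier_doubling` does this for doubling. `IsAmplifier.iterate` runs an
amplifier `B` times in a loop, and this requires its leftovers to vanish after each round. A single
counter takes care of all rounds: with `i` rounds to go, every change of a working counter is
accompanied by a change of this counter by `i` times as much (`sound_weigh`). Carrying the three
outputs back to the inputs removes one unit of weight per unit carried while `i` drops by one, so
anything left behind becomes a permanent surplus (`sound_carryBack`). If the weight counter ends at
zero, then every round was clean. Starting from doubling, the iterates `amplify k` grow like the
Ackermann function (`amplify_add_three`).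

Reduction. Stacks are numbers in base `W`, with push, pop and emptiness implemented by budgeted
tests, and a machine state is a single unit on its own counter. The amplifier level is primitive
recursive in the input and supplies a bound that dominates all stack codes
(`exists_pow_le_amplify`). Accurate runs follow the machine, and determinism makes acceptance
equivalent to reachability (`reaches_reduction_iff`). Finally the program, presented as a list of
tokens, is a primitive recursive function of the input. -/

namespace CounterProgram

open Relation

/-! ### Basic properties of runs -/

/-- The counter `x` occurs in the program. -/
def Occurs (x : ℕ) : CounterProgram → Prop
  | inc c => x = c
  | dec c => x = c
  | test c => x = c
  | loop M => Occurs x M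
  | seq M N => Occurs x M ∨ Occurs x N
  | choice M N => Occurs x M ∨ Occurs x N

theorem Step.apply_eq {x : ℕ} {M : CounterProgram} :
    ∀ {α β : Config}, ¬ Occurs x M → M.Step α β → α x = β x := by
  induction M with
  | inc c => intro α β h hs; exact hs.1 x h
  | dec c => intro α β h hs; exact hs.1 x h
  | test c => intro α β h hs; exact hs.1 x h
  | loop M ih =>
    intro α β h hs
    change ReflTransGen M.Step α β at hs
    induction hs with
    | refl => rfl
    | tail _ hs ih' => exact ih'.trans (ih h hs)
  | seq M N ihM ihN =>
    rintro α β h ⟨γ, h₁, h₂⟩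
    simp only [Occurs, not_or] at h
    exact (ihM h.1 h₁).trans (ihN h.2 h₂)
  | choice M N ihM ihN =>
    rintro α β h hs
    simp only [Occurs, not_or] at h
    exact hs.elim (ihM h.1) (ihN h.2)

/-- Runs of test-free programs are monotone. -/
theorem Step.add {M : CounterProgram} (γ : Config) :
    ∀ {α β : Config}, M.TestFree → M.Step α β → M.Step (α + γ) (β + γ) := by
  induction M with
  | inc c =>
    rintro α β - ⟨h₁, h₂⟩
    exact ⟨fun x hx => by simp [h₁ x hx], by simp [h₂]; omega⟩
  | dec c =>
    rintro α β - ⟨h₁, h₂⟩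
    exact ⟨fun x hx => by simp [h₁ x hx], by simp [← h₂]; omega⟩
  | test c => intro α β h; exact h.elim
  | loop M ih =>
    intro α β h hs
    change ReflTransGen M.Step α β at hs
    exact ReflTransGen.lift (p := M.Step) (· + γ) (fun _ _ => ih h) _ _ hs
  | seq M N ihM ihN =>
    rintro α β h ⟨δ, h₁, h₂⟩
    exact ⟨δ + γ, ihM h.1 h₁, ihN h.2 h₂⟩
  | choice M N ihM ihN =>
    rintro α β h hs
    exact hs.imp (ihM h.1) (ihN h.2)

/-! ### Straight-line blocks and transfer loops -/

/-- The program `M` followed by increments. -/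
def thenIncs (M : CounterProgram) (l : List ℕ) : CounterProgram :=
  l.foldl (fun N c => seq N (inc c)) M

/-- The program `M` followed by decrements. -/
def thenDecs (M : CounterProgram) (l : List ℕ) : CounterProgram :=
  l.foldl (fun N c => seq N (dec c)) M

/-- Decrement the counters in `neg`, then increment those in `pos` (with multiplicities). -/
def block : List ℕ → List ℕ → CounterProgram
  -- The pair `inc 0`, `dec 0` is a neutral command, since there is no skip command. It makes
  -- counter `0` occur syntactically in such blocks.
  | [], pos => thenIncs (seq (inc 0) (dec 0)) pos
  | n :: neg, pos => thenIncs (thenDecs (dec n) neg) pos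

theorem exists_config_count (l : List ℕ) : ∃ δ : Config, ∀ x, δ x = l.count x :=
  ⟨Multiset.toFinsupp (l : Multiset ℕ), fun x => by simp⟩

theorem exists_config_of_le {α : Config} {n : ℕ} {neg pos : List ℕ}
    (h : ∀ x, n * neg.count x ≤ α x) :
    ∃ β : Config, ∀ x, β x + n * neg.count x = α x + n * pos.count x := by
  obtain ⟨δ, hδ⟩ := exists_config_count neg
  obtain ⟨ε, hε⟩ := exists_config_count pos
  refine ⟨α - n • δ + n • ε, fun x => ?_⟩
  have := h x
  simp only [Finsupp.add_apply, Finsupp.tsub_apply, Finsupp.smul_apply, hδ, hε, smul_eq_mul]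
  omega

theorem step_thenIncs {l : List ℕ} : ∀ {M : CounterProgram} {α β : Config},
    (M.thenIncs l).Step α β ↔ ∃ γ, M.Step α γ ∧ ∀ x, β x = γ x + l.count x := by
  induction l with
  | nil =>
    intro M α β
    refine ⟨fun h => ⟨β, h, by simp⟩, ?_⟩
    rintro ⟨γ, h, h'⟩
    rwa [show β = γ from Finsupp.ext (by simpa using h')]
  | cons c l ih =>
    intro M α β
    change ((seq M (inc c)).thenIncs l).Step α β ↔ _
    rw [ih]
    constructor
    · rintro ⟨γ, ⟨δ, h₁, h₂, h₃⟩, h₄⟩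
      refine ⟨δ, h₁, fun x => ?_⟩
      rw [h₄ x, List.count_cons]
      by_cases hx : x = c
      · subst hx; simp; omega
      · rw [h₂ x hx]; simp [Ne.symm hx]
    · rintro ⟨δ, h₁, h₂⟩
      refine ⟨δ + Finsupp.single c 1, ⟨δ, h₁, fun x hx => by simp [hx], by simp⟩, fun x => ?_⟩
      rw [h₂ x, List.count_cons]
      by_cases hx : x = c
      · subst hx; simp; omega
      · simp [hx, Ne.symm hx]

theorem step_thenDecs {l : List ℕ} : ∀ {M : CounterProgram} {α β : Config},
    (M.thenDecs l).Step α β ↔ ∃ γ, M.Step α γ ∧ ∀ x, γ x = β x + l.count x := by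
  induction l with
  | nil =>
    intro M α β
    refine ⟨fun h => ⟨β, h, by simp⟩, ?_⟩
    rintro ⟨γ, h, h'⟩
    rwa [show β = γ from Finsupp.ext (by simpa using fun x => (h' x).symm)]
  | cons c l ih =>
    intro M α β
    change ((seq M (dec c)).thenDecs l).Step α β ↔ _
    rw [ih]
    constructor
    · rintro ⟨γ, ⟨δ, h₁, h₂, h₃⟩, h₄⟩
      refine ⟨δ, h₁, fun x => ?_⟩
      rw [List.count_cons]
      by_cases hx : x = c
      · subst hx; rw [← h₃, h₄]; simp; omega
      · rw [h₂ x hx, h₄]; simp [Ne.symm hx]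
    · rintro ⟨δ, h₁, h₂⟩
      obtain ⟨ε, hε⟩ := exists_config_count l
      refine ⟨β + ε, ⟨δ, h₁, fun x hx => ?_, ?_⟩, fun x => by simp [hε]⟩
      · rw [h₂ x, List.count_cons]; simp [Ne.symm hx, hε]
      · rw [h₂ c]; simp [hε]; omega

theorem step_dec_iff {c : ℕ} {α β : Config} :
    (dec c).Step α β ↔ ∀ x, α x = β x + [c].count x := by
  constructor
  · rintro ⟨h₁, h₂⟩ x
    by_cases hx : x = c
    · subst hx; simp [← h₂]
    · simp [h₁ x hx, Ne.symm hx]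
  · intro h
    exact ⟨fun x hx => by rw [h x]; simp [Ne.symm hx], by rw [h c]; simp⟩

theorem step_inc_iff {c : ℕ} {α β : Config} :
    (inc c).Step α β ↔ β = α + Finsupp.single c 1 := by
  constructor
  · rintro ⟨h₁, h₂⟩
    ext x
    by_cases hx : x = c
    · subst hx; simp [← h₂]
    · simp [h₁ x hx, hx]
  · rintro rfl
    exact ⟨fun x hx => by simp [hx], by simp⟩

theorem step_dec_iff' {c : ℕ} {α β : Config} :
    (dec c).Step α β ↔ α = β + Finsupp.single c 1 := by
  rw [← step_inc_iff]
  exact ⟨fun h => ⟨fun x hx => (h.1 x hx).symm, h.2.symm⟩,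
    fun h => ⟨fun x hx => (h.1 x hx).symm, h.2.symm⟩⟩

theorem step_block {neg pos : List ℕ} {α β : Config} :
    (block neg pos).Step α β ↔
      ∀ x, neg.count x ≤ α x ∧ β x + neg.count x = α x + pos.count x := by
  cases neg with
  | nil =>
    rw [block, step_thenIncs]
    constructor
    · rintro ⟨γ, ⟨δ, h₁, h₂⟩, h₃⟩
      rw [step_inc_iff] at h₁
      rw [step_dec_iff', h₁] at h₂
      obtain rfl := add_right_cancel h₂
      simpa using h₃
    · intro h
      exact ⟨α, ⟨_, step_inc_iff.2 rfl, step_dec_iff'.2 rfl⟩, by simpa using h⟩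
  | cons n neg =>
    rw [block, step_thenIncs]
    simp only [step_thenDecs, step_dec_iff]
    constructor
    · rintro ⟨γ, ⟨δ, h₁, h₂⟩, h₃⟩ x
      have h₁ := h₁ x
      have h₂ := h₂ x
      have h₃ := h₃ x
      rw [List.count_cons] at *
      simp only [List.count_nil] at *
      omega
    · intro h
      obtain ⟨ε, hε⟩ := exists_config_count neg
      obtain ⟨ε', hε'⟩ := exists_config_count [n]
      refine ⟨α - ε' - ε, ⟨α - ε', fun x => ?_, fun x => ?_⟩, fun x => ?_⟩
      all_goals
        have h := h x
        have h' := hε x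
        have h'' := hε' x
        simp only [Finsupp.tsub_apply]
        rw [List.count_cons] at *
        simp only [List.count_nil] at *
        omega

/-- Repeat `block neg pos` any number of times. -/
def xfer (neg pos : List ℕ) : CounterProgram := loop (block neg pos)

/-- The effect of `n` rounds of `block neg pos`. -/
def Xfer (neg pos : List ℕ) (n : ℕ) (α β : Config) : Prop :=
  ∀ x, n * neg.count x ≤ α x ∧ β x + n * neg.count x = α x + n * pos.count x

/-- Disjointness ensures that no decremented counter is ever replenished, so the guards of the `n`
successive rounds amount to one inequality on the initial values. -/
theorem step_xfer {neg pos : List ℕ} (hd : neg.Disjoint pos) {α β : Config} :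
    (xfer neg pos).Step α β ↔ ∃ n, Xfer neg pos n α β := by
  constructor
  · intro h
    change ReflTransGen (block neg pos).Step α β at h
    induction h with
    | refl => exact ⟨0, by simp [Xfer]⟩
    | tail _ hs ih =>
      obtain ⟨n, hn⟩ := ih
      refine ⟨n + 1, fun x => ?_⟩
      have h₁ := step_block.1 hs x
      have h₂ := hn x
      rw [add_one_mul, add_one_mul]
      rcases Nat.eq_zero_or_pos (neg.count x) with h | h
      · simp only [h, mul_zero] at h₁ h₂ ⊢; omega
      · have : pos.count x = 0 := List.count_eq_zero.2 (hd (List.count_pos_iff.1 h))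
        simp only [this, mul_zero] at h₁ h₂ ⊢; omega
  · rintro ⟨n, hn⟩
    induction n generalizing β with
    | zero =>
      rw [show β = α from Finsupp.ext fun x => by simpa using (hn x).2]
      exact ReflTransGen.refl
    | succ n ih =>
      have hle : ∀ x, n * neg.count x ≤ α x := fun x =>
        (Nat.mul_le_mul_right _ (Nat.le_succ n)).trans (hn x).1
      obtain ⟨γ, hγ⟩ := exists_config_of_le (pos := pos) hle
      refine ReflTransGen.tail (ih fun x => ⟨hle x, hγ x⟩) (step_block.2 fun x => ?_)
      have h₁ := hn x
      have h₂ := hγ x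
      rw [add_one_mul, add_one_mul] at h₁
      omega

theorem Xfer.exists {neg pos : List ℕ} {n : ℕ} {α : Config} (h : ∀ x ∈ neg, n * neg.count x ≤ α x) :
    ∃ β, Xfer neg pos n α β := by
  have h' : ∀ x, n * neg.count x ≤ α x := fun x => by
    by_cases hx : x ∈ neg
    · exact h x hx
    · simp [List.count_eq_zero.2 hx]
  obtain ⟨β, hβ⟩ := exists_config_of_le (pos := pos) h'
  exact ⟨β, fun x => ⟨h' x, hβ x⟩⟩

theorem TestFree.thenIncs {l : List ℕ} : ∀ {M : CounterProgram}, M.TestFree →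
    (M.thenIncs l).TestFree := by
  induction l with
  | nil => exact id
  | cons c l ih => exact fun h => ih (M := seq _ (inc c)) ⟨h, trivial⟩

theorem TestFree.thenDecs {l : List ℕ} : ∀ {M : CounterProgram}, M.TestFree →
    (M.thenDecs l).TestFree := by
  induction l with
  | nil => exact id
  | cons c l ih => exact fun h => ih (M := seq _ (dec c)) ⟨h, trivial⟩

theorem testFree_block (neg pos : List ℕ) : (block neg pos).TestFree := by
  cases neg with
  | nil => exact TestFree.thenIncs ⟨trivial, trivial⟩
  | cons n neg => exact TestFree.thenIncs (TestFree.thenDecs trivial)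

theorem testFree_xfer (neg pos : List ℕ) : (xfer neg pos).TestFree := testFree_block neg pos

/-! ### Budgeted zero tests -/

/-- A budget for zero tests: `c` holds the number of remaining tests, `d` holds `2 * B` units for
each of them, and the values of the two counters of each pair add up to at most `B`. -/
structure Budget where
  c : ℕ
  d : ℕ
  B : ℕ
  pairs : Set (ℕ × ℕ)
  c_ne_d : c ≠ d
  fst_ne_snd : ∀ p ∈ pairs, ∀ q ∈ pairs, p.1 ≠ q.2
  fst_inj : ∀ p ∈ pairs, ∀ q ∈ pairs, p.1 = q.1 → p = q
  snd_inj : ∀ p ∈ pairs, ∀ q ∈ pairs, p.2 = q.2 → p = q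
  fst_ne : ∀ p ∈ pairs, p.1 ≠ c ∧ p.1 ≠ d
  snd_ne : ∀ p ∈ pairs, p.2 ≠ c ∧ p.2 ≠ d

/-! ### Calculus of budgeted runs: slack, soundness, reachability. -/

namespace Budget

variable (K : Budget)

/-- The pair invariant. -/
def Inv (α : Config) : Prop := ∀ p ∈ K.pairs, α p.1 + α p.2 ≤ K.B

/-- The budget of one test. -/
noncomputable def unit : Config := Finsupp.single K.c 1 + Finsupp.single K.d (2 * K.B)

/-- The surplus of `d`. It never decreases, and only accurate tests leave it unchanged. -/
def slack (α : Config) : ℤ := α K.d - 2 * K.B * α K.c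

/-- The budget counters are zero. -/
def Clean (α : Config) : Prop := α K.c = 0 ∧ α K.d = 0

/-- The program preserves the pair invariant and does not decrease the slack. -/
def Mono (M : CounterProgram) : Prop :=
  ∀ α β, K.Inv α → M.Step α β → K.Inv β ∧ K.slack α ≤ K.slack β

/-- Up to the budget counters, all runs of `M` from `α` without slack end in `S`. -/
def Sound (M : CounterProgram) (α : Config) (S : Config → Prop) : Prop :=
  ∀ (C : ℕ) (β : Config), M.Step (α + C • K.unit) β → K.Inv β ∧ 0 ≤ K.slack β ∧
    (K.slack β = 0 → ∃ (γ : Config) (C' : ℕ), β = γ + C' • K.unit ∧ K.Clean γ ∧ S γ)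

/-- With a suitable budget, `M` has a run from `α` to `β`. -/
def Reach (M : CounterProgram) (α β : Config) : Prop :=
  ∃ t : ℕ, M.Step (α + t • K.unit) β

variable {K}

theorem unit_c : K.unit K.c = 1 := by simp [unit, K.c_ne_d.symm]

theorem unit_d : K.unit K.d = 2 * K.B := by simp [unit, K.c_ne_d]

theorem unit_ne {x : ℕ} (hc : x ≠ K.c) (hd : x ≠ K.d) : K.unit x = 0 := by
  simp [unit, hc, hd]

theorem slack_add_unit {α : Config} {C : ℕ} : K.slack (α + C • K.unit) = K.slack α := by
  simp only [slack, Finsupp.add_apply, Finsupp.smul_apply, unit_c, unit_d, smul_eq_mul]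
  push_cast
  ring

theorem Clean.slack {α : Config} (h : K.Clean α) : K.slack α = 0 := by
  simp [Budget.slack, h.1, h.2]

theorem Inv.congr {α β : Config} (h : K.Inv α) (h' : ∀ x, x ≠ K.c → x ≠ K.d → β x = α x) :
    K.Inv β := fun p hp => by
  rw [h' _ (K.fst_ne p hp).1 (K.fst_ne p hp).2, h' _ (K.snd_ne p hp).1 (K.snd_ne p hp).2]
  exact h p hp

theorem inv_add_unit {α : Config} {C : ℕ} : K.Inv (α + C • K.unit) ↔ K.Inv α :=
  ⟨fun h => h.congr fun x hc hd => by simp [unit_ne hc hd],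
    fun h => h.congr fun x hc hd => by simp [unit_ne hc hd]⟩

theorem Mono.seq {M N : CounterProgram} (hM : K.Mono M) (hN : K.Mono N) : K.Mono (M.seq N) := by
  rintro α β hα ⟨γ, h₁, h₂⟩
  have h := hM _ _ hα h₁
  have h' := hN _ _ h.1 h₂
  exact ⟨h'.1, h.2.trans h'.2⟩

theorem Mono.choice {M N : CounterProgram} (hM : K.Mono M) (hN : K.Mono N) :
    K.Mono (M.choice N) := fun _ _ hα hs => hs.elim (hM _ _ hα) (hN _ _ hα)

theorem Mono.loop {M : CounterProgram} (hM : K.Mono M) : K.Mono M.loop := by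
  intro α β hα hs
  change ReflTransGen M.Step α β at hs
  induction hs with
  | refl => exact ⟨hα, le_rfl⟩
  | tail _ hs ih =>
    have h := hM _ _ ih.1 hs
    exact ⟨h.1, ih.2.trans h.2⟩

/-- The slack after `M` is nonnegative, and `N` cannot lower it. If it is zero at the end, then it
was already zero in between, so the conclusion for `M` applies and returns a clean configuration
plus whole units of budget, from which `N` can be analysed. -/
theorem Sound.seq {M N : CounterProgram} {α : Config} {S : Config → Prop}
    {T : Config → Config → Prop} (hM : K.Sound M α S) (hN : K.Mono N)
    (h : ∀ γ, K.Inv γ → K.Clean γ → S γ → K.Sound N γ (T γ)) :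
    K.Sound (M.seq N) α fun β => ∃ γ, S γ ∧ T γ β := by
  rintro C β ⟨γ, h₁, h₂⟩
  obtain ⟨hI, hs, hγ⟩ := hM C γ h₁
  obtain ⟨hI', hs'⟩ := hN _ _ hI h₂
  refine ⟨hI', hs.trans hs', fun h0 => ?_⟩
  obtain ⟨γ', C', rfl, hc, hS⟩ := hγ (le_antisymm (hs'.trans h0.le) hs)
  obtain ⟨β', C'', rfl, hc', hT⟩ := (h γ' (inv_add_unit.1 hI) hc hS C' β h₂).2.2 h0
  exact ⟨β', C'', rfl, hc', γ', hS, hT⟩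

theorem Sound.mono {M : CounterProgram} {α : Config} {S T : Config → Prop}
    (hM : K.Sound M α S) (h : ∀ β, K.Inv β → K.Clean β → S β → T β) : K.Sound M α T := by
  intro C β hs
  obtain ⟨h₁, h₂, h₃⟩ := hM C β hs
  refine ⟨h₁, h₂, fun h0 => ?_⟩
  obtain ⟨β', C', rfl, hc, hS⟩ := h₃ h0
  exact ⟨β', C', rfl, hc, h _ (inv_add_unit.1 h₁) hc hS⟩

theorem Sound.choice {M N : CounterProgram} {α : Config} {S : Config → Prop}
    (hM : K.Sound M α S) (hN : K.Sound N α S) : K.Sound (M.choice N) α S :=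
  fun C β hs => hs.elim (hM C β) (hN C β)

/-- As for sequences, zero slack at the end propagates back to every intermediate configuration. The
body therefore only has to be sound at configurations reached by accurate rounds. -/
theorem Sound.loop {M : CounterProgram} {α : Config} {R : Config → Config → Prop}
    (hM : K.Mono M) (hα : K.Inv α) (hc : K.Clean α)
    (h : ∀ γ, K.Inv γ → K.Clean γ → ReflTransGen R α γ → K.Sound M γ (R γ)) :
    K.Sound M.loop α (ReflTransGen R α) := by
  intro C β hs
  change ReflTransGen M.Step (α + C • K.unit) β at hs
  induction hs with
  | refl =>
    exact ⟨inv_add_unit.2 hα, by rw [slack_add_unit, hc.slack],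
      fun _ => ⟨α, C, rfl, hc, ReflTransGen.refl⟩⟩
  | tail _ hs ih =>
    obtain ⟨h₁, h₂, h₃⟩ := ih
    obtain ⟨h₁', h₂'⟩ := hM _ _ h₁ hs
    refine ⟨h₁', h₂.trans h₂', fun h0 => ?_⟩
    obtain ⟨γ, C', rfl, hγ, hR⟩ := h₃ (le_antisymm (h₂'.trans h0.le) h₂)
    obtain ⟨β', C'', rfl, hc', hT⟩ := (h γ (inv_add_unit.1 h₁) hγ hR C' _ hs).2.2 h0
    exact ⟨β', C'', rfl, hc', hR.tail hT⟩

/-- Budgets add up: by monotonicity, the units meant for `N` are carried unused through `M`. -/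
theorem Reach.seq {M N : CounterProgram} {α β γ : Config} (hf : M.TestFree) (h₁ : K.Reach M α γ)
    (h₂ : K.Reach N γ β) : K.Reach (M.seq N) α β := by
  obtain ⟨t₁, h₁⟩ := h₁
  obtain ⟨t₂, h₂⟩ := h₂
  refine ⟨t₁ + t₂, γ + t₂ • K.unit, ?_, h₂⟩
  rw [add_smul, ← add_assoc]
  exact h₁.add _ hf

theorem Reach.choice_left {M N : CounterProgram} {α β : Config} (h : K.Reach M α β) :
    K.Reach (M.choice N) α β := h.imp fun _ h => Or.inl h

theorem Reach.choice_right {M N : CounterProgram} {α β : Config} (h : K.Reach N α β) :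
    K.Reach (M.choice N) α β := h.imp fun _ h => Or.inr h

theorem Reach.loop {M : CounterProgram} {α β : Config} (hf : M.TestFree)
    (h : ReflTransGen (K.Reach M) α β) : K.Reach M.loop α β := by
  induction h using ReflTransGen.head_induction_on with
  | refl => exact ⟨0, by rw [zero_smul, add_zero]; exact ReflTransGen.refl⟩
  | head h _ ih =>
    obtain ⟨t₁, h₁⟩ := h
    obtain ⟨t₂, h₂⟩ := ih
    refine ⟨t₁ + t₂, ReflTransGen.head ?_ h₂⟩
    rw [add_smul, ← add_assoc]
    exact h₁.add _ hf

theorem Reach.of_step {M : CounterProgram} {α β : Config} (h : M.Step α β) : K.Reach M α β :=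
  ⟨0, by rwa [zero_smul, add_zero]⟩

end Budget

/-- Budgeted zero test of `x`, whose partner is `y`. -/
def zeroTest (c d x y : ℕ) : CounterProgram :=
  seq (xfer [y, d] [x]) (seq (xfer [x, d] [y]) (dec c))

theorem testFree_zeroTest (c d x y : ℕ) : (zeroTest c d x y).TestFree :=
  ⟨testFree_xfer _ _, testFree_xfer _ _, trivial⟩

/-- A transfer loop followed by a zero test of `x`. -/
def drain (c d : ℕ) (neg pos : List ℕ) (x y : ℕ) : CounterProgram :=
  seq (xfer neg pos) (zeroTest c d x y)

theorem testFree_drain (c d : ℕ) (neg pos : List ℕ) (x y : ℕ) :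
    (drain c d neg pos x y).TestFree :=
  ⟨testFree_xfer _ _, testFree_zeroTest _ _ _ _⟩

/-- The numbers `n` and `m` are the rounds of the loops from `y` to `x` and from `x` back to `y`. No
bound on the counters is needed for this description. -/
theorem step_zeroTest {c d x y : ℕ} (hxy : x ≠ y) (hcd : c ≠ d) (hx : x ≠ c ∧ x ≠ d)
    (hy : y ≠ c ∧ y ≠ d) {α β : Config} :
    (zeroTest c d x y).Step α β ↔ ∃ n m, n ≤ α y ∧ m ≤ α x + n ∧ n + m + β d = α d ∧
      β c + 1 = α c ∧ β x + m = α x + n ∧ β y + n = α y + m ∧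
      ∀ w, w ≠ x → w ≠ y → w ≠ c → w ≠ d → β w = α w := by
  have d₁ : [y, d].Disjoint [x] := by simp [hxy, hx.2]
  have d₂ : [x, d].Disjoint [y] := by simp [hxy.symm, hy.2]
  obtain ⟨hxc, hxd⟩ := hx
  obtain ⟨hyc, hyd⟩ := hy
  constructor
  · rintro ⟨γ, h₁, δ, h₂, h₃⟩
    obtain ⟨n, h₁⟩ := (step_xfer d₁).1 h₁
    obtain ⟨m, h₂⟩ := (step_xfer d₂).1 h₂
    rw [step_dec_iff] at h₃
    refine ⟨n, m, ?_⟩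
    have hx := And.intro (h₁ x) (And.intro (h₂ x) (h₃ x))
    have hy := And.intro (h₁ y) (And.intro (h₂ y) (h₃ y))
    have hc := And.intro (h₁ c) (And.intro (h₂ c) (h₃ c))
    have hd := And.intro (h₁ d) (And.intro (h₂ d) (h₃ d))
    simp [List.count_cons, hxy, hxy.symm, hcd, hcd.symm, hxc, hxc.symm, hxd, hxd.symm, hyc,
      hyc.symm, hyd, hyd.symm] at hx hy hc hd
    refine ⟨by omega, by omega, by omega, by omega, by omega, by omega, fun w hwx hwy hwc hwd => ?_⟩
    have := And.intro (h₁ w) (And.intro (h₂ w) (h₃ w))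
    simp [List.count_cons, hwx.symm, hwy.symm, hwc.symm, hwd.symm] at this
    omega
  · rintro ⟨n, m, h₁, h₂, h₃, h₄, h₅, h₆, h₇⟩
    have hle : ∀ w ∈ [y, d], n * [y, d].count w ≤ α w := by
      simp [List.count_cons, hyd, hyd.symm]; omega
    obtain ⟨γ, hγ⟩ := Xfer.exists (pos := [x]) hle
    have gx := hγ x
    have gy := hγ y
    have gc := hγ c
    have gd := hγ d
    simp [List.count_cons, hxy, hxy.symm, hcd, hcd.symm, hxc, hxc.symm, hxd, hxd.symm, hyc,
      hyc.symm, hyd, hyd.symm] at gx gy gc gd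
    have hle' : ∀ w ∈ [x, d], m * [x, d].count w ≤ γ w := by
      simp [List.count_cons, hxd, hxd.symm]; omega
    obtain ⟨δ, hδ⟩ := Xfer.exists (pos := [y]) hle'
    refine ⟨γ, (step_xfer d₁).2 ⟨n, hγ⟩, δ, (step_xfer d₂).2 ⟨m, hδ⟩, step_dec_iff.2 fun w => ?_⟩
    have hw := hδ w
    have hw' := hγ w
    by_cases ex : w = x
    · subst ex
      simp [List.count_cons, hxy, hxy.symm, hxc.symm, hxd.symm] at hw hw' ⊢
      omega
    by_cases ey : w = y
    · subst ey
      simp [List.count_cons, hxy, hxy.symm, hyc.symm, hyd.symm] at hw hw' ⊢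
      omega
    by_cases ec : w = c
    · subst ec
      simp [List.count_cons, hcd.symm, hxc, hyc] at hw hw' ⊢
      omega
    by_cases ed : w = d
    · subst ed
      simp [List.count_cons, hcd, hxd, hyd] at hw hw' ⊢
      omega
    have := h₇ w ex ey ec ed
    simp [List.count_cons, Ne.symm ex, Ne.symm ey, Ne.symm ec, Ne.symm ed] at hw hw' ⊢
    omega

/-! ### Soundness and completeness of zero tests and transfers. -/

namespace Budget

variable {K : Budget}

/-- `x` and `y` form a pair, in some order. -/
def Paired (K : Budget) (x y : ℕ) : Prop := (x, y) ∈ K.pairs ∨ (y, x) ∈ K.pairs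

theorem Paired.ne {x y : ℕ} (h : K.Paired x y) : x ≠ y :=
  h.elim (fun h => K.fst_ne_snd _ h _ h) fun h => (K.fst_ne_snd _ h _ h).symm

theorem Paired.ne_left {x y : ℕ} (h : K.Paired x y) : x ≠ K.c ∧ x ≠ K.d :=
  h.elim (fun h => K.fst_ne _ h) fun h => K.snd_ne _ h

theorem Paired.ne_right {x y : ℕ} (h : K.Paired x y) : y ≠ K.c ∧ y ≠ K.d :=
  h.elim (fun h => K.snd_ne _ h) fun h => K.fst_ne _ h

theorem Paired.le {x y : ℕ} (h : K.Paired x y) {α : Config} (hα : K.Inv α) : α x + α y ≤ K.B :=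
  h.elim (fun h => hα _ h) fun h => (add_comm _ _).trans_le (hα _ h)

theorem Paired.inv {x y : ℕ} (h : K.Paired x y) {α β : Config} (hα : K.Inv α)
    (hs : β x + β y = α x + α y)
    (hw : ∀ w, w ≠ x → w ≠ y → w ≠ K.c → w ≠ K.d → β w = α w) : K.Inv β := by
  wlog hxy : (x, y) ∈ K.pairs generalizing x y
  · exact this h.symm (by omega) (fun w h₁ h₂ => hw w h₂ h₁) (h.resolve_left hxy)
  intro p hp
  by_cases hpx : p = (x, y)
  · subst hpx; exact hs.trans_le (hα _ hxy)
  · rw [hw p.1 (fun h => hpx (K.fst_inj _ hp _ hxy h)) (K.fst_ne_snd _ hp _ hxy)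
      (K.fst_ne _ hp).1 (K.fst_ne _ hp).2, hw p.2 (K.fst_ne_snd _ hxy _ hp).symm
      (fun h => hpx (K.snd_inj _ hp _ hxy h)) (K.snd_ne _ hp).1 (K.snd_ne _ hp).2]
    exact hα p hp

/-- The reason why budgeted tests work. From `n ≤ y ≤ B` and `m ≤ x + n ≤ x + y ≤ B` the slack grows
by `2 * B - n - m ≥ 0`. Equality forces `n = m = B`, hence `y = B` and `x = 0`, and then the two
loops cancel, so that only one unit of budget disappears. -/
theorem Paired.step_zeroTest {x y : ℕ} (h : K.Paired x y) {α β : Config} (hα : K.Inv α)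
    (hs : (zeroTest K.c K.d x y).Step α β) :
    K.Inv β ∧ K.slack α ≤ K.slack β ∧ (K.slack β = K.slack α →
      α = β + K.unit ∧ α x = 0 ∧ α y = K.B) := by
  rw [CounterProgram.step_zeroTest h.ne K.c_ne_d h.ne_left h.ne_right] at hs
  obtain ⟨n, m, h₁, h₂, h₃, h₄, h₅, h₆, h₇⟩ := hs
  have hle := h.le hα
  have hc : (α K.c : ℤ) = β K.c + 1 := by omega
  have hd : (α K.d : ℤ) = β K.d + n + m := by omega
  have key : K.slack β = K.slack α + (2 * K.B - n - m) := by
    simp only [slack, hc, hd]; ring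
  refine ⟨h.inv hα (by omega) h₇, by omega, fun heq => ?_⟩
  have hx0 : α x = 0 := by omega
  refine ⟨?_, hx0, by omega⟩
  ext w
  rw [Finsupp.add_apply]
  by_cases ec : w = K.c
  · subst ec; rw [unit_c]; omega
  by_cases ed : w = K.d
  · subst ed; rw [unit_d]; omega
  rw [unit_ne ec ed]
  by_cases ex : w = x
  · subst ex; omega
  by_cases ey : w = y
  · subst ey; omega
  exact (h₇ w ex ey ec ed).symm

theorem Paired.mono_zeroTest {x y : ℕ} (h : K.Paired x y) : K.Mono (zeroTest K.c K.d x y) :=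
  fun _ _ hα hs => ⟨(h.step_zeroTest hα hs).1, (h.step_zeroTest hα hs).2.1⟩

theorem Paired.sound_zeroTest {x y : ℕ} (h : K.Paired x y) {α : Config} (hα : K.Inv α)
    (hc : K.Clean α) : K.Sound (zeroTest K.c K.d x y) α
      fun β => β = α ∧ α x = 0 ∧ α y = K.B := by
  intro C β hs
  obtain ⟨h₁, h₂, h₃⟩ := h.step_zeroTest (inv_add_unit.2 hα) hs
  rw [slack_add_unit, hc.slack] at h₂ h₃
  refine ⟨h₁, h₂, fun h0 => ?_⟩
  obtain ⟨h₄, h₅, h₆⟩ := h₃ h0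
  -- As `α` is clean, the counter `c` shows exactly the number of units left, and one has been used.
  have hC : C = β K.c + 1 := by
    have := DFunLike.congr_fun h₄ K.c
    simpa [unit_c, hc.1] using this
  refine ⟨α, β K.c, ?_, hc, rfl, ?_, ?_⟩
  · rw [hC, add_smul, one_smul, ← add_assoc] at h₄
    exact (add_right_cancel h₄).symm
  · simpa [unit_ne h.ne_left.1 h.ne_left.2] using h₅
  · simpa [unit_ne h.ne_right.1 h.ne_right.2] using h₆

theorem Paired.reach_zeroTest {x y : ℕ} (h : K.Paired x y) {α : Config} (hx : α x = 0)
    (hy : α y = K.B) : K.Reach (zeroTest K.c K.d x y) α α := by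
  -- Both loops have to run `B` times, consuming the full `2 * B` units of one test.
  refine ⟨1, (CounterProgram.step_zeroTest h.ne K.c_ne_d h.ne_left h.ne_right).2
    ⟨K.B, K.B, ?_⟩⟩
  simp only [one_smul, Finsupp.add_apply, unit_c, unit_d, unit_ne h.ne_left.1 h.ne_left.2,
    unit_ne h.ne_right.1 h.ne_right.2, hx, hy]
  refine ⟨by omega, by omega, by omega, ?_, ?_, by omega, fun w _ _ hc hd => ?_⟩
  · trivial
  · trivial
  rw [unit_ne hc hd, add_zero]

/-- The budget counters are not used by a transfer. -/
def Avoids (K : Budget) (neg pos : List ℕ) : Prop :=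
  (K.c ∉ neg ∧ K.d ∉ neg) ∧ K.c ∉ pos ∧ K.d ∉ pos

theorem Avoids.count {neg pos : List ℕ} (h : K.Avoids neg pos) :
    neg.count K.c = 0 ∧ neg.count K.d = 0 ∧ pos.count K.c = 0 ∧ pos.count K.d = 0 :=
  ⟨List.count_eq_zero.2 h.1.1, List.count_eq_zero.2 h.1.2, List.count_eq_zero.2 h.2.1,
    List.count_eq_zero.2 h.2.2⟩

/-- A transfer does not increase the sum of the two counters of a pair. -/
def Balanced (K : Budget) (neg pos : List ℕ) : Prop :=
  ∀ p ∈ K.pairs, pos.count p.1 + pos.count p.2 ≤ neg.count p.1 + neg.count p.2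

theorem Balanced.inv {neg pos : List ℕ} (h : K.Balanced neg pos) {n : ℕ} {α β : Config}
    (hα : K.Inv α) (hx : Xfer neg pos n α β) : K.Inv β := fun p hp => by
  have h₁ := hx p.1
  have h₂ := hx p.2
  have h₃ := Nat.mul_le_mul_left n (h p hp)
  have h₄ := hα p hp
  rw [mul_add, mul_add] at h₃
  omega

theorem Avoids.slack {neg pos : List ℕ} (h : K.Avoids neg pos) {n : ℕ} {α β : Config}
    (hx : Xfer neg pos n α β) : K.slack β = K.slack α := by
  obtain ⟨h₁, h₂, h₃, h₄⟩ := h.count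
  have hc := (hx K.c).2
  have hd := (hx K.d).2
  simp only [h₁, h₂, h₃, h₄, mul_zero, add_zero] at hc hd
  rw [Budget.slack, hc, hd, Budget.slack]

theorem Avoids.mono_xfer {neg pos : List ℕ} (h : K.Avoids neg pos) (hb : K.Balanced neg pos)
    (hd : neg.Disjoint pos) : K.Mono (xfer neg pos) := by
  intro α β hα hs
  obtain ⟨n, hn⟩ := (step_xfer hd).1 hs
  exact ⟨hb.inv hα hn, (h.slack hn).ge⟩

theorem Avoids.mono_block {neg pos : List ℕ} (h : K.Avoids neg pos) (hb : K.Balanced neg pos) :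
    K.Mono (block neg pos) := by
  intro α β hα hs
  have hn : Xfer neg pos 1 α β := by simpa [Xfer] using step_block.1 hs
  exact ⟨hb.inv hα hn, (h.slack hn).ge⟩

/-- The units lie on `c` and `d`, which the transfer does not touch, so they can be taken away
before the transfer and put back afterwards. -/
theorem Avoids.xfer_strip {neg pos : List ℕ} (h : K.Avoids neg pos) {n C : ℕ} {α β : Config}
    (hc : K.Clean α) (hx : Xfer neg pos n (α + C • K.unit) β) :
    ∃ β', β = β' + C • K.unit ∧ K.Clean β' ∧ Xfer neg pos n α β' := by
  obtain ⟨h₁, h₂, h₃, h₄⟩ := h.count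
  have hle : ∀ x ∈ neg, n * neg.count x ≤ α x := fun x hxn => by
    have := (hx x).1
    rwa [Finsupp.add_apply, Finsupp.smul_apply, unit_ne (fun h' => h.1.1 (h' ▸ hxn))
      (fun h' => h.1.2 (h' ▸ hxn)), smul_zero, add_zero] at this
  obtain ⟨β', hβ'⟩ := Xfer.exists (pos := pos) hle
  refine ⟨β', ?_, ⟨?_, ?_⟩, hβ'⟩
  · ext x
    have := (hx x).2
    have := (hβ' x).2
    simp only [Finsupp.add_apply] at *
    omega
  · simpa [h₁, h₃, hc.1] using (hβ' K.c).2
  · simpa [h₂, h₄, hc.2] using (hβ' K.d).2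

/-- Meant for set-up loops, which raise one counter of a pair without lowering its partner. They are
not balanced, but they preserve the pair invariant from their particular initial configuration. -/
theorem Avoids.sound_xfer' {neg pos : List ℕ} (h : K.Avoids neg pos) (hd : neg.Disjoint pos)
    {α : Config} (hc : K.Clean α) (hI : ∀ n β, Xfer neg pos n α β → K.Inv β) :
    K.Sound (xfer neg pos) α fun β => ∃ n, Xfer neg pos n α β := by
  intro C β hs
  obtain ⟨n, hn⟩ := (step_xfer hd).1 hs
  obtain ⟨β', rfl, hc', hn'⟩ := h.xfer_strip hc hn
  refine ⟨inv_add_unit.2 (hI n β' hn'), ?_, fun _ => ⟨β', C, rfl, hc', n, hn'⟩⟩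
  rw [slack_add_unit, hc'.slack]

theorem Avoids.sound_xfer {neg pos : List ℕ} (h : K.Avoids neg pos) (hd : neg.Disjoint pos)
    (hb : K.Balanced neg pos) {α : Config} (hα : K.Inv α) (hc : K.Clean α) :
    K.Sound (xfer neg pos) α fun β => ∃ n, Xfer neg pos n α β :=
  h.sound_xfer' hd hc fun _ _ => hb.inv hα

theorem Avoids.sound_block {neg pos : List ℕ} (h : K.Avoids neg pos)
    (hb : K.Balanced neg pos) {α : Config} (hα : K.Inv α) (hc : K.Clean α) :
    K.Sound (block neg pos) α fun β => Xfer neg pos 1 α β := by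
  intro C β hs
  have hn : Xfer neg pos 1 (α + C • K.unit) β := by simpa [Xfer] using step_block.1 hs
  obtain ⟨β', rfl, hc', hn'⟩ := h.xfer_strip hc hn
  refine ⟨inv_add_unit.2 (hb.inv hα hn'), ?_, fun _ => ⟨β', C, rfl, hc', hn'⟩⟩
  rw [slack_add_unit, hc'.slack]

theorem reach_xfer {neg pos : List ℕ} (hd : neg.Disjoint pos) {n : ℕ} {α β : Config}
    (h : Xfer neg pos n α β) : K.Reach (xfer neg pos) α β :=
  Reach.of_step ((step_xfer hd).2 ⟨n, h⟩)

theorem reach_block {neg pos : List ℕ} {α β : Config}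
    (h : Xfer neg pos 1 α β) : K.Reach (block neg pos) α β :=
  Reach.of_step (step_block.2 (by simpa [Xfer] using h))

theorem Avoids.mono_drain {neg pos : List ℕ} (h : K.Avoids neg pos) (hb : K.Balanced neg pos)
    (hd : neg.Disjoint pos) {x y : ℕ} (hp : K.Paired x y) :
    K.Mono (drain K.c K.d neg pos x y) :=
  (h.mono_xfer hb hd).seq hp.mono_zeroTest

theorem Avoids.sound_drain' {neg pos : List ℕ} (h : K.Avoids neg pos) (hd : neg.Disjoint pos)
    {x y : ℕ} (hp : K.Paired x y) {α : Config} (hc : K.Clean α)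
    (hI : ∀ n β, Xfer neg pos n α β → K.Inv β) :
    K.Sound (drain K.c K.d neg pos x y) α
      fun β => ∃ n, Xfer neg pos n α β ∧ β x = 0 ∧ β y = K.B := by
  refine ((h.sound_xfer' hd hc hI).seq hp.mono_zeroTest
    (fun γ hI hc _ => hp.sound_zeroTest hI hc)).mono ?_
  rintro β - - ⟨γ, ⟨n, hn⟩, rfl, h₁, h₂⟩
  exact ⟨n, hn, h₁, h₂⟩

theorem Avoids.sound_drain {neg pos : List ℕ} (h : K.Avoids neg pos) (hd : neg.Disjoint pos)
    (hb : K.Balanced neg pos) {x y : ℕ} (hp : K.Paired x y) {α : Config} (hα : K.Inv α)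
    (hc : K.Clean α) : K.Sound (drain K.c K.d neg pos x y) α
      fun β => ∃ n, Xfer neg pos n α β ∧ β x = 0 ∧ β y = K.B :=
  h.sound_drain' hd hp hc fun _ _ => hb.inv hα

theorem Paired.reach_drain {neg pos : List ℕ} (hd : neg.Disjoint pos) {x y : ℕ}
    (hp : K.Paired x y) {n : ℕ} {α β : Config} (h : Xfer neg pos n α β) (hx : β x = 0)
    (hy : β y = K.B) : K.Reach (drain K.c K.d neg pos x y) α β :=
  (reach_xfer hd h).seq (testFree_xfer _ _) (hp.reach_zeroTest hx hy)

end Budget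

/-! ### Amplifiers -/

theorem Xfer.unique {neg pos : List ℕ} {n : ℕ} {α β β' : Config} (h : Xfer neg pos n α β)
    (h' : Xfer neg pos n α β') : β = β' := by
  ext x
  have := h x
  have := h' x
  omega

/-- It is enough to check a transfer on a list of counters that contains the moving ones. -/
theorem Xfer.of_list (l : List ℕ) {neg pos : List ℕ} {n : ℕ} {α β : Config}
    (h : ∀ x ∈ l, n * neg.count x ≤ α x ∧ β x + n * neg.count x = α x + n * pos.count x)
    (hout : ∀ x, x ∉ l → β x = α x) (hn : neg ⊆ l) (hp : pos ⊆ l) : Xfer neg pos n α β := by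
  intro x
  by_cases hx : x ∈ l
  · exact h x hx
  · simp [List.count_eq_zero.2 fun h => hx (hn h), List.count_eq_zero.2 fun h => hx (hp h),
      hout x hx]

/-- The configuration `(B, C, 2 * B * C)` on the three counters from `n` on. -/
noncomputable def triple (n B C : ℕ) : Config :=
  Finsupp.single n B + Finsupp.single (n + 1) C + Finsupp.single (n + 2) (2 * B * C)

/-- The program turns triples `(B, C, 2 * B * C)` on the counters from `n + 8` on into triples
`(F B, C', 2 * F B * C')` on the counters from `n` on, provided that all other counters are zero at
the end. -/
structure IsAmplifier (n : ℕ) (F : ℕ → ℕ) (P : CounterProgram) : Prop where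
  testFree : P.TestFree
  occurs : ∀ x, Occurs x P → x < n + 16
  sound : ∀ B C β, P.Step (triple (n + 8) B C) β →
    (∀ x, x ≠ n → x ≠ n + 1 → x ≠ n + 2 → β x = 0) → ∃ C', β = triple n (F B) C'
  complete : ∀ B C', ∃ C, P.Step (triple (n + 8) B C) (triple n (F B) C')

/-! ### Increments, decrements and exact programs. -/

namespace Budget

variable {K : Budget}

theorem smul_unit {C : ℕ} :
    C • K.unit = Finsupp.single K.c C + Finsupp.single K.d (2 * K.B * C) := by
  rw [unit, smul_add, Finsupp.smul_single, Finsupp.smul_single, smul_eq_mul, smul_eq_mul, mul_one,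
    mul_comm C]

theorem mono_dec {x : ℕ} (h : x ≠ K.c ∧ x ≠ K.d) : K.Mono (dec x) := by
  intro α β hα hs
  rw [step_dec_iff'] at hs
  subst hs
  constructor
  · intro p hp
    have := hα p hp
    simp only [Finsupp.add_apply] at this
    omega
  · simp [slack, h.1.symm, h.2.symm]

theorem mono_inc {x : ℕ} (h : x ≠ K.c ∧ x ≠ K.d) (hp : ∀ p ∈ K.pairs, p.1 ≠ x ∧ p.2 ≠ x) :
    K.Mono (inc x) := by
  intro α β hα hs
  rw [step_inc_iff] at hs
  subst hs
  constructor
  · intro p hpp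
    have := hα p hpp
    simpa [(hp p hpp).1, (hp p hpp).2] using this
  · simp [slack, h.1.symm, h.2.symm]

theorem sound_inc {x : ℕ} (h : x ≠ K.c ∧ x ≠ K.d) (hp : ∀ p ∈ K.pairs, p.1 ≠ x ∧ p.2 ≠ x)
    {α : Config} (hα : K.Inv α) (hc : K.Clean α) :
    K.Sound (inc x) α (· = α + Finsupp.single x 1) := by
  intro C β hs
  obtain ⟨h₁, h₂⟩ := mono_inc h hp _ _ (inv_add_unit.2 hα) hs
  rw [slack_add_unit, hc.slack] at h₂
  refine ⟨h₁, h₂, fun _ => ⟨_, C, ?_, ?_, rfl⟩⟩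
  · rw [step_inc_iff.1 hs, add_right_comm]
  · simp [Clean, h.1.symm, h.2.symm, hc.1, hc.2]

theorem sound_dec {x : ℕ} (h : x ≠ K.c ∧ x ≠ K.d)
    {α : Config} (hα : K.Inv α) (hc : K.Clean α) :
    K.Sound (dec x) α (fun β => α = β + Finsupp.single x 1) := by
  intro C β hs
  obtain ⟨h₁, h₂⟩ := mono_dec h _ _ (inv_add_unit.2 hα) hs
  rw [slack_add_unit, hc.slack] at h₂
  have hs := step_dec_iff'.1 hs
  have hle : Finsupp.single x 1 ≤ α := by
    rw [Finsupp.single_le_iff]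
    have := DFunLike.congr_fun hs x
    simp [unit_ne h.1 h.2] at this
    omega
  refine ⟨h₁, h₂, fun _ => ⟨α - Finsupp.single x 1, C, ?_, ?_, ?_⟩⟩
  · apply add_right_cancel (b := Finsupp.single x 1)
    rw [← hs, add_right_comm, tsub_add_cancel_of_le hle]
  · simp [Clean, h.1.symm, h.2.symm, hc.1, hc.2]
  · exact (tsub_add_cancel_of_le hle).symm

theorem Sound.loop_inv {M : CounterProgram} {α : Config} {S : Config → Prop}
    (hM : K.Mono M) (hα : K.Inv α) (hc : K.Clean α) (hS : S α)
    (h : ∀ γ, K.Inv γ → K.Clean γ → S γ → K.Sound M γ S) : K.Sound M.loop α S := by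
  have key : ∀ {γ}, ReflTransGen (fun _ β => S β) α γ → S γ := fun hr => by
    cases hr with
    | refl => exact hS
    | tail _ h => exact h
  exact (Sound.loop hM hα hc fun γ h₁ h₂ h₃ => h γ h₁ h₂ (key h₃)).mono
    fun β _ _ hr => key hr

/-- Sequential composition, with the postcondition given directly. -/
theorem Sound.seq' {M N : CounterProgram} {α : Config} {S T : Config → Prop}
    (hM : K.Sound M α S) (hN : K.Mono N)
    (h : ∀ γ, K.Inv γ → K.Clean γ → S γ → K.Sound N γ T) : K.Sound (M.seq N) α T :=
  (hM.seq hN h).mono fun _ _ _ ⟨_, _, hT⟩ => hT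

/-- Up to the budget counters, `M` leads from `α` exactly to `β`. -/
structure Exact (K : Budget) (M : CounterProgram) (α β : Config) : Prop where
  testFree : M.TestFree
  sound : K.Sound M α (· = β)
  reach : K.Reach M α β

theorem Exact.seq {M N : CounterProgram} {α β γ : Config} (hM : K.Exact M α γ)
    (hN : K.Exact N γ β) (h : K.Mono N) : K.Exact (M.seq N) α β where
  testFree := ⟨hM.testFree, hN.testFree⟩
  sound := hM.sound.seq' h fun δ _ _ hδ => by subst hδ; exact hN.sound
  reach := hM.reach.seq hM.testFree hN.reach

/-- The final test makes a nondeterministic loop deterministic: as `x` loses one unit per round and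
ends at zero, the number of rounds is `α x`. -/
theorem Avoids.exact_drain' {neg pos : List ℕ} (h : K.Avoids neg pos) (hd : neg.Disjoint pos)
    {x y : ℕ} (hp : K.Paired x y) {α β : Config} (hc : K.Clean α)
    (hI : ∀ n β, Xfer neg pos n α β → K.Inv β) (hx : neg.count x = 1) (hx' : x ∉ pos)
    (hβ : Xfer neg pos (α x) α β) (hy : β y = K.B) :
    K.Exact (drain K.c K.d neg pos x y) α β where
  testFree := testFree_drain _ _ _ _ _ _
  sound := by
    refine (h.sound_drain' hd hp hc hI).mono ?_
    rintro β' - - ⟨n, hn, h0, -⟩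
    have := (hn x).2
    rw [hx, h0, List.count_eq_zero.2 hx', mul_zero, mul_one, zero_add, add_zero] at this
    exact (this ▸ hn).unique hβ
  reach := by
    refine hp.reach_drain hd hβ ?_ hy
    have := (hβ x).2
    rw [hx, List.count_eq_zero.2 hx'] at this
    omega

theorem Avoids.exact_drain {neg pos : List ℕ} (h : K.Avoids neg pos) (hd : neg.Disjoint pos)
    (hb : K.Balanced neg pos) {x y : ℕ} (hp : K.Paired x y) {α β : Config} (hα : K.Inv α)
    (hc : K.Clean α) (hx : neg.count x = 1) (hx' : x ∉ pos)
    (hβ : Xfer neg pos (α x) α β) (hy : β y = K.B) :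
    K.Exact (drain K.c K.d neg pos x y) α β :=
  h.exact_drain' hd hp hc (fun _ _ => hb.inv hα) hx hx' hβ hy

theorem Avoids.exact_block {neg pos : List ℕ} (h : K.Avoids neg pos)
    (hb : K.Balanced neg pos) {α β : Config} (hα : K.Inv α) (hc : K.Clean α)
    (hβ : Xfer neg pos 1 α β) : K.Exact (block neg pos) α β where
  testFree := testFree_block _ _
  sound := (h.sound_block hb hα hc).mono fun _ _ _ h => h.unique hβ
  reach := reach_block hβ

end Budget

/-! #### Doubling -/

/-- The budget of the doubling amplifier. -/
def doublingBudget (B : ℕ) : Budget where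
  c := 9
  d := 10
  B := B
  pairs := {(8, 11)}
  c_ne_d := by simp
  fst_ne_snd := by simp
  fst_inj := by simp
  snd_inj := by simp
  fst_ne := by simp
  snd_ne := by simp

/-- Add `4` times the value of the counter `8` to the counter `2`. -/
def doublingRound : CounterProgram :=
  seq (block [] [1]) (seq (drain 9 10 [8] [11, 2, 2] 8 11) (drain 9 10 [11] [8, 2, 2] 11 8))

/-- An amplifier for `n ↦ 2 * n`. -/
def doubling : CounterProgram :=
  seq (drain 9 10 [8] [11, 0, 0] 8 11) (seq (drain 9 10 [11] [8] 11 8)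
    (seq (loop doublingRound) (xfer [8] [])))

/-- A configuration of the doubling amplifier. -/
noncomputable def doublingState (a f u v w : ℕ) : Config :=
  Finsupp.single 8 a + Finsupp.single 11 f + Finsupp.single 0 u + Finsupp.single 1 v +
    Finsupp.single 2 w

theorem xfer_doublingState {neg pos : List ℕ} {n a f u v w a' f' u' v' w' : ℕ}
    (hn : neg ⊆ [8, 11, 0, 1, 2]) (hp : pos ⊆ [8, 11, 0, 1, 2])
    (h8 : n * neg.count 8 ≤ a ∧ a' + n * neg.count 8 = a + n * pos.count 8)
    (h11 : n * neg.count 11 ≤ f ∧ f' + n * neg.count 11 = f + n * pos.count 11)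
    (h0 : n * neg.count 0 ≤ u ∧ u' + n * neg.count 0 = u + n * pos.count 0)
    (h1 : n * neg.count 1 ≤ v ∧ v' + n * neg.count 1 = v + n * pos.count 1)
    (h2 : n * neg.count 2 ≤ w ∧ w' + n * neg.count 2 = w + n * pos.count 2) :
    Xfer neg pos n (doublingState a f u v w) (doublingState a' f' u' v' w') := by
  refine Xfer.of_list [8, 11, 0, 1, 2] ?_ ?_ hn hp
  · simp only [List.mem_cons, List.not_mem_nil, or_false, forall_eq_or_imp, forall_eq]
    simpa [doublingState] using ⟨h8, h11, h0, h1, h2⟩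
  · intro x hx
    simp only [List.mem_cons, List.not_mem_nil, or_false, not_or] at hx
    simp [doublingState, hx]

theorem testFree_doubling : doubling.TestFree := by
  simp [doubling, doublingRound, TestFree, testFree_xfer, testFree_drain, testFree_block]

theorem mono_doublingRound (B : ℕ) : (doublingBudget B).Mono doublingRound := by
  refine (Budget.Avoids.mono_block ?_ ?_).seq ((Budget.Avoids.mono_drain (K := doublingBudget B) ?_
    ?_ ?_ ?_).seq (Budget.Avoids.mono_drain (K := doublingBudget B) ?_ ?_ ?_ ?_)) <;>
    simp [Budget.Avoids, Budget.Balanced, Budget.Paired, doublingBudget]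

theorem inv_doublingState {B a f u v w : ℕ} (h : a + f ≤ B) :
    (doublingBudget B).Inv (doublingState a f u v w) := by
  simpa [Budget.Inv, doublingBudget, doublingState] using h

theorem clean_doublingState {B a f u v w : ℕ} :
    (doublingBudget B).Clean (doublingState a f u v w) := by
  simp [Budget.Clean, doublingBudget, doublingState]

/-- Emptying `8` into `11` and returning each contribute `2 * B` to counter `2`. The sum `4 * B = 2
* (2 * B)` is the price of one test for the doubled bound, matching the increment of counter `1`. -/
theorem exact_doublingRound (B v w : ℕ) :
    (doublingBudget B).Exact doublingRound (doublingState B 0 (2 * B) v w)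
      (doublingState B 0 (2 * B) (v + 1) (w + 4 * B)) := by
  refine Budget.Exact.seq (γ := doublingState B 0 (2 * B) (v + 1) w)
    (Budget.Avoids.exact_block ?_ ?_ (inv_doublingState ?_) clean_doublingState
      (xfer_doublingState ?_ ?_ ?_ ?_ ?_ ?_ ?_))
    (Budget.Exact.seq (γ := doublingState 0 B (2 * B) (v + 1) (w + 2 * B))
      (Budget.Avoids.exact_drain (K := doublingBudget B) ?_ ?_ ?_ ?_
        (inv_doublingState ?_) clean_doublingState ?_ ?_ (xfer_doublingState ?_ ?_ ?_ ?_ ?_ ?_ ?_)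
        ?_)
      (Budget.Avoids.exact_drain (K := doublingBudget B) ?_ ?_ ?_ ?_
        (inv_doublingState ?_) clean_doublingState ?_ ?_ (xfer_doublingState ?_ ?_ ?_ ?_ ?_ ?_ ?_)
        ?_)
      (Budget.Avoids.mono_drain (K := doublingBudget B) ?_ ?_ ?_ ?_))
    ((Budget.Avoids.mono_drain (K := doublingBudget B) ?_ ?_ ?_ ?_).seq
      (Budget.Avoids.mono_drain (K := doublingBudget B) ?_ ?_ ?_ ?_))
  all_goals simp [Budget.Avoids, Budget.Balanced, Budget.Paired, doublingBudget, doublingState]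
  all_goals ring

theorem exact_doubling_setup (B : ℕ) :
    (doublingBudget B).Exact (seq (drain 9 10 [8] [11, 0, 0] 8 11) (drain 9 10 [11] [8] 11 8))
      (doublingState B 0 0 0 0) (doublingState B 0 (2 * B) 0 0) := by
  refine Budget.Exact.seq (γ := doublingState 0 B (2 * B) 0 0)
      (Budget.Avoids.exact_drain (K := doublingBudget B) ?_ ?_ ?_ ?_
        (inv_doublingState ?_) clean_doublingState ?_ ?_ (xfer_doublingState ?_ ?_ ?_ ?_ ?_ ?_ ?_)
        ?_)
      (Budget.Avoids.exact_drain (K := doublingBudget B) ?_ ?_ ?_ ?_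
        (inv_doublingState ?_) clean_doublingState ?_ ?_ (xfer_doublingState ?_ ?_ ?_ ?_ ?_ ?_ ?_)
        ?_)
      (Budget.Avoids.mono_drain (K := doublingBudget B) ?_ ?_ ?_ ?_)
  all_goals simp [Budget.Avoids, Budget.Balanced, Budget.Paired, doublingBudget, doublingState]
  all_goals ring

theorem mono_doubling_clear (B : ℕ) : (doublingBudget B).Mono (xfer [8] []) := by
  apply Budget.Avoids.mono_xfer <;>
    simp [Budget.Avoids, Budget.Balanced, doublingBudget]

theorem triple_eq_doublingState (B C : ℕ) :
    triple 8 B C = doublingState B 0 0 0 0 + C • (doublingBudget B).unit := by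
  rw [Budget.smul_unit]
  simp [triple, doublingState, doublingBudget, add_assoc, -Finsupp.single_mul]

theorem triple_zero_eq_doublingState (B C : ℕ) :
    triple 0 B C = doublingState 0 0 B C (2 * B * C) := by
  simp [triple, doublingState]

theorem isAmplifier_doubling : IsAmplifier 0 (2 * ·) doubling where
  testFree := testFree_doubling
  occurs := by
    intro x hx
    simp [doubling, doublingRound, drain, zeroTest, xfer, block, thenIncs, thenDecs, Occurs] at hx
    omega
  sound := by
    intro B C β hs h0
    -- Reassociated so that the two set-up drains form one exact program.
    have hs' : (seq (seq (drain 9 10 [8] [11, 0, 0] 8 11) (drain 9 10 [11] [8] 11 8))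
        (seq (loop doublingRound) (xfer [8] []))).Step (triple (0 + 8) B C) β := by
      obtain ⟨γ, h₁, δ, h₂, h₃⟩ := hs
      exact ⟨δ, ⟨γ, h₁, h₂⟩, h₃⟩
    have key : (doublingBudget B).Sound _ _ fun β => ∃ a v,
        β = doublingState a 0 (2 * B) v (4 * B * v) :=
      (exact_doubling_setup B).sound.seq' ((mono_doublingRound B).loop.seq (mono_doubling_clear B))
        fun γ hI hc hγ => (Budget.Sound.loop_inv (S := fun β => ∃ v,
          β = doublingState B 0 (2 * B) v (4 * B * v)) (mono_doublingRound B) hI hc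
          ⟨0, by simpa using hγ⟩ fun δ _ _ ⟨v, hv⟩ => by
            subst hv
            refine (exact_doublingRound B v _).sound.mono fun _ _ _ h => ⟨v + 1, ?_⟩
            rw [h]; ring_nf).seq' (mono_doubling_clear B) fun δ hI hc ⟨v, hv⟩ => by
              refine (Budget.Avoids.sound_xfer ?_ ?_ ?_ hI hc).mono ?_
              any_goals simp [Budget.Avoids, Budget.Balanced, doublingBudget]; done
              rintro β - - ⟨n, hn⟩
              -- The clearing loop may stop early, so an unknown rest `B - n` stays on counter `8`;
              -- the final zero condition rules it out below.
              refine ⟨B - n, v, hn.unique ?_⟩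
              have := (hn 8).1
              subst hv
              simp [doublingState] at this
              apply xfer_doublingState <;> simp; omega
    rw [show triple (0 + 8) B C = triple 8 B C from rfl, triple_eq_doublingState] at hs'
    obtain ⟨-, -, h⟩ := key C β hs'
    -- Counters `9` and `10` end at zero, so the slack is zero and all tests were accurate.
    obtain ⟨β', C', rfl, hc, a, v, rfl⟩ := h (by
      simp [Budget.slack, doublingBudget, h0])
    have hC : C' = 0 := by
      have := h0 9 (by simp) (by simp) (by simp)
      simpa [doublingState, Budget.unit, doublingBudget] using this
    have ha : a = 0 := by
      have := h0 8 (by simp) (by simp) (by simp)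
      simpa [doublingState, Budget.unit, doublingBudget] using this
    subst hC ha
    refine ⟨v, ?_⟩
    rw [triple_zero_eq_doublingState, zero_smul, add_zero]
    ring_nf
  complete := by
    intro B C'
    have key : (doublingBudget B).Reach doubling (doublingState B 0 0 0 0)
        (doublingState 0 0 (2 * B) C' (4 * B * C')) := by
      have hl : (doublingBudget B).Reach (loop doublingRound) (doublingState B 0 (2 * B) 0 0)
          (doublingState B 0 (2 * B) C' (4 * B * C')) := by
        refine Budget.Reach.loop (exact_doublingRound B 0 0).testFree ?_
        induction C' with
        | zero => exact ReflTransGen.refl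
        | succ v ih => exact ih.tail (by simpa [mul_add] using (exact_doublingRound B v _).reach)
      have hc : (doublingBudget B).Reach (xfer [8] [])
          (doublingState B 0 (2 * B) C' (4 * B * C'))
          (doublingState 0 0 (2 * B) C' (4 * B * C')) := by
        refine Budget.reach_xfer (n := B) (by simp) ?_
        apply xfer_doublingState <;> simp
      obtain ⟨t, δ, ⟨γ, h₁, h₂⟩, h₃⟩ := (exact_doubling_setup B).reach.seq
        (exact_doubling_setup B).testFree
        (hl.seq (M := loop doublingRound) (exact_doublingRound B 0 0).testFree hc)
      exact ⟨t, γ, h₁, δ, h₂, h₃⟩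
    obtain ⟨t, ht⟩ := key
    refine ⟨t, ?_⟩
    rw [triple_zero_eq_doublingState, show triple (0 + 8) B t = triple 8 B t from rfl,
      triple_eq_doublingState]
    convert ht using 2
    ring

/-! #### Iterating an amplifier -/

/-- The budget at the level above `n + 8`. -/
def levelBudget (n B : ℕ) : Budget where
  c := n + 17
  d := n + 18
  B := B
  pairs := {(n + 16, n + 19), (n + 20, n + 21)}
  c_ne_d := by simp
  fst_ne_snd := by simp
  fst_inj := by simp
  snd_inj := by simp
  fst_ne := by simp
  snd_ne := by simp

/-- Add the value of the counter `n + 20` to the counter `n + 22`. -/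
def addWeight (n : ℕ) : CounterProgram :=
  seq (drain (n + 17) (n + 18) [n + 20, n + 16] [n + 21, n + 19, n + 22] (n + 20) (n + 21))
    (drain (n + 17) (n + 18) [n + 21, n + 19] [n + 20, n + 16] (n + 19) (n + 16))

/-- Subtract the value of the counter `n + 20` from the counter `n + 22`. -/
def subWeight (n : ℕ) : CounterProgram :=
  seq (drain (n + 17) (n + 18) [n + 20, n + 16, n + 22] [n + 21, n + 19] (n + 20) (n + 21))
    (drain (n + 17) (n + 18) [n + 21, n + 19] [n + 20, n + 16] (n + 19) (n + 16))

/-- Accompany each increment or decrement by the same change of the counter `n + 22`, with the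
weight given by the counter `n + 20`. -/
def weigh (n : ℕ) : CounterProgram → CounterProgram
  | inc x => seq (inc x) (addWeight n)
  | dec x => seq (dec x) (subWeight n)
  | test x => test x
  | loop M => loop (weigh n M)
  | seq M N => seq (weigh n M) (weigh n N)
  | choice M N => choice (weigh n M) (weigh n N)

/-- The part of an iteration after the run of the amplifier. -/
def carryBack (n : ℕ) : CounterProgram :=
  seq (block [n + 20] [n + 21]) (seq (xfer [n, n + 22] [n + 8])
    (seq (xfer [n + 1, n + 22] [n + 9]) (xfer [n + 2, n + 22] [n + 10])))

/-- Fill the triple at `n + 8` with `(1, C, 2 * C)`. -/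
def fillTriple (n : ℕ) : CounterProgram :=
  seq (inc (n + 8)) (loop (seq (inc (n + 9)) (seq (inc (n + 10)) (inc (n + 10)))))

/-- The start of the iteration. -/
def iterSetup (n : ℕ) : CounterProgram :=
  seq (drain (n + 17) (n + 18) [n + 16] [n + 19, n + 20] (n + 16) (n + 19))
    (drain (n + 17) (n + 18) [n + 19] [n + 16] (n + 19) (n + 16))

/-- The end of the iteration. -/
def iterClear (n : ℕ) : CounterProgram :=
  seq (zeroTest (n + 17) (n + 18) (n + 20) (n + 21)) (seq (xfer [n + 16] []) (xfer [n + 21] []))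

/-- The amplifier that iterates the amplifier `P`. -/
def iterate (n : ℕ) (P : CounterProgram) : CounterProgram :=
  seq (iterSetup n) (seq (weigh n (fillTriple n))
    (seq (loop (seq (weigh n P) (carryBack n))) (iterClear n)))

/-- A configuration of the iteration. -/
noncomputable def levelState (n : ℕ) (l : Config) (b e i j z : ℕ) : Config :=
  l + Finsupp.single (n + 16) b + Finsupp.single (n + 19) e + Finsupp.single (n + 20) i +
    Finsupp.single (n + 21) j + Finsupp.single (n + 22) z

/-- The configuration vanishes from the counter `n + 16` on. -/
def Low (n : ℕ) (l : Config) : Prop := ∀ x, n + 16 ≤ x → l x = 0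

/-! ### Weighing the low counters by the number of remaining rounds. -/

section

variable {n : ℕ} {l : Config} {b e i j z : ℕ}

theorem Low.add {m : Config} (h : Low n l) (h' : Low n m) : Low n (l + m) := fun x hx => by
  simp [h x hx, h' x hx]

theorem Low.of_add {m : Config} (h : Low n (l + m)) : Low n l := fun x hx => by
  have := h x hx
  simp at this
  exact this.1

theorem low_single {x v : ℕ} (h : x < n + 16) : Low n (Finsupp.single x v) := fun y hy => by
  rw [Finsupp.single_eq_of_ne]
  omega

theorem Low.levels (h : Low n l) : l (n + 16) = 0 ∧ l (n + 17) = 0 ∧ l (n + 18) = 0 ∧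
    l (n + 19) = 0 ∧ l (n + 20) = 0 ∧ l (n + 21) = 0 ∧ l (n + 22) = 0 := by
  refine ⟨?_, ?_, ?_, ?_, ?_, ?_, ?_⟩ <;> exact h _ (by omega)

theorem levelState_of_lt {x : ℕ} (hx : x < n + 16) : levelState n l b e i j z x = l x := by
  simp [levelState, hx.ne, show x ≠ n + 19 by omega, show x ≠ n + 20 by omega,
    show x ≠ n + 21 by omega, show x ≠ n + 22 by omega]

theorem xfer_levelState {neg pos : List ℕ} (h : Low n l) {k b' e' i' j' z' : ℕ}
    (hn : neg ⊆ [n + 16, n + 19, n + 20, n + 21, n + 22])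
    (hp : pos ⊆ [n + 16, n + 19, n + 20, n + 21, n + 22])
    (hb : k * neg.count (n + 16) ≤ b ∧
      b' + k * neg.count (n + 16) = b + k * pos.count (n + 16))
    (he : k * neg.count (n + 19) ≤ e ∧
      e' + k * neg.count (n + 19) = e + k * pos.count (n + 19))
    (hi : k * neg.count (n + 20) ≤ i ∧
      i' + k * neg.count (n + 20) = i + k * pos.count (n + 20))
    (hj : k * neg.count (n + 21) ≤ j ∧
      j' + k * neg.count (n + 21) = j + k * pos.count (n + 21))
    (hz : k * neg.count (n + 22) ≤ z ∧
      z' + k * neg.count (n + 22) = z + k * pos.count (n + 22)) :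
    Xfer neg pos k (levelState n l b e i j z) (levelState n l b' e' i' j' z') := by
  refine Xfer.of_list [n + 16, n + 19, n + 20, n + 21, n + 22] ?_ ?_ hn hp
  · simp only [List.mem_cons, List.not_mem_nil, or_false, forall_eq_or_imp, forall_eq]
    simpa [levelState, h.levels] using ⟨hb, he, hi, hj, hz⟩
  · intro x hx
    simp only [List.mem_cons, List.not_mem_nil, or_false, not_or] at hx
    simp [levelState, hx]

theorem inv_levelState {B : ℕ} (h : Low n l) (hb : b + e ≤ B) (hi : i + j ≤ B) :
    (levelBudget n B).Inv (levelState n l b e i j z) := by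
  simpa [Budget.Inv, levelBudget, levelState, h.levels] using ⟨hb, hi⟩

theorem clean_levelState {B : ℕ} (h : Low n l) :
    (levelBudget n B).Clean (levelState n l b e i j z) := by
  simp [Budget.Clean, levelBudget, levelState, h.levels]

theorem mono_addWeight (B : ℕ) : (levelBudget n B).Mono (addWeight n) := by
  refine (Budget.Avoids.mono_drain (K := levelBudget n B) ?_ ?_ ?_ ?_).seq
    (Budget.Avoids.mono_drain (K := levelBudget n B) ?_ ?_ ?_ ?_) <;>
    simp [Budget.Avoids, Budget.Balanced, Budget.Paired, levelBudget]

theorem mono_subWeight (B : ℕ) : (levelBudget n B).Mono (subWeight n) := by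
  refine (Budget.Avoids.mono_drain (K := levelBudget n B) ?_ ?_ ?_ ?_).seq
    (Budget.Avoids.mono_drain (K := levelBudget n B) ?_ ?_ ?_ ?_) <;>
    simp [Budget.Avoids, Budget.Balanced, Budget.Paired, levelBudget]

/-- The value `i` must be added without being lost. The first drain empties `n + 20` and at the same
time records `i` on `n + 19`; the second one drains `n + 19`, hence returns exactly `i` units. Since
`n + 16` starts full, both tests find the partner of the tested counter at `B`. -/
theorem exact_addWeight {B : ℕ} (h : Low n l) (hij : i + j = B) :
    (levelBudget n B).Exact (addWeight n) (levelState n l B 0 i j z)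
      (levelState n l B 0 i j (z + i)) := by
  -- Intermediate state: `n + 16` has dropped from `B` to `B - i = j`.
  refine Budget.Exact.seq (γ := levelState n l j i 0 B (z + i))
      (Budget.Avoids.exact_drain (K := levelBudget n B) ?_ ?_ ?_ ?_
        (inv_levelState h ?_ ?_) (clean_levelState h) ?_ ?_
        (xfer_levelState h ?_ ?_ ?_ ?_ ?_ ?_ ?_) ?_)
      (Budget.Avoids.exact_drain (K := levelBudget n B) ?_ ?_ ?_ ?_
        (inv_levelState h ?_ ?_) (clean_levelState h) ?_ ?_
        (xfer_levelState h ?_ ?_ ?_ ?_ ?_ ?_ ?_) ?_)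
      (Budget.Avoids.mono_drain (K := levelBudget n B) ?_ ?_ ?_ ?_)
  all_goals try simp [Budget.Avoids, Budget.Balanced, Budget.Paired, levelBudget, levelState, h.levels]
  all_goals omega

theorem exact_subWeight {B : ℕ} (h : Low n l) (hij : i + j = B) :
    (levelBudget n B).Exact (subWeight n) (levelState n l B 0 i j (z + i))
      (levelState n l B 0 i j z) := by
  refine Budget.Exact.seq (γ := levelState n l j i 0 B z)
      (Budget.Avoids.exact_drain (K := levelBudget n B) ?_ ?_ ?_ ?_
        (inv_levelState h ?_ ?_) (clean_levelState h) ?_ ?_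
        (xfer_levelState h ?_ ?_ ?_ ?_ ?_ ?_ ?_) ?_)
      (Budget.Avoids.exact_drain (K := levelBudget n B) ?_ ?_ ?_ ?_
        (inv_levelState h ?_ ?_) (clean_levelState h) ?_ ?_
        (xfer_levelState h ?_ ?_ ?_ ?_ ?_ ?_ ?_) ?_)
      (Budget.Avoids.mono_drain (K := levelBudget n B) ?_ ?_ ?_ ?_)
  all_goals try simp [Budget.Avoids, Budget.Balanced, Budget.Paired, levelBudget, levelState, h.levels]
  all_goals omega

/-- The low configuration `l`, weighed by `i`, with a surplus `w`. -/
noncomputable def weighed (n B i j w : ℕ) (l : Config) : Config :=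
  levelState n l B 0 i j (w + i * l.degree)

theorem testFree_addWeight : (addWeight n).TestFree :=
  ⟨testFree_drain _ _ _ _ _ _, testFree_drain _ _ _ _ _ _⟩

theorem testFree_subWeight : (subWeight n).TestFree :=
  ⟨testFree_drain _ _ _ _ _ _, testFree_drain _ _ _ _ _ _⟩

theorem TestFree.weigh {P : CounterProgram} (h : P.TestFree) : (weigh n P).TestFree := by
  induction P with
  | inc x => exact ⟨trivial, testFree_addWeight⟩
  | dec x => exact ⟨trivial, testFree_subWeight⟩
  | test x => exact h.elim
  | loop M ih => exact ih h
  | seq M N ihM ihN => exact ⟨ihM h.1, ihN h.2⟩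
  | choice M N ihM ihN => exact ⟨ihM h.1, ihN h.2⟩

theorem levelBudget_ne {x B : ℕ} (hx : x < n + 16) :
    x ≠ (levelBudget n B).c ∧ x ≠ (levelBudget n B).d := by
  simp only [levelBudget]; omega

theorem levelBudget_pairs_ne {x B : ℕ} (hx : x < n + 16) :
    ∀ p ∈ (levelBudget n B).pairs, p.1 ≠ x ∧ p.2 ≠ x := by
  simp only [levelBudget, Set.mem_insert_iff, Set.mem_singleton_iff, forall_eq_or_imp, forall_eq]
  omega

theorem mono_weigh (B : ℕ) {P : CounterProgram} (hf : P.TestFree)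
    (ho : ∀ x, Occurs x P → x < n + 16) : (levelBudget n B).Mono (weigh n P) := by
  induction P with
  | inc x =>
    exact (Budget.mono_inc (levelBudget_ne (ho x rfl)) (levelBudget_pairs_ne (ho x rfl))).seq
      (mono_addWeight B)
  | dec x => exact (Budget.mono_dec (levelBudget_ne (ho x rfl))).seq (mono_subWeight B)
  | test x => exact hf.elim
  | loop M ih => exact (ih hf ho).loop
  | seq M N ihM ihN =>
    exact (ihM hf.1 fun x h => ho x (Or.inl h)).seq (ihN hf.2 fun x h => ho x (Or.inr h))
  | choice M N ihM ihN =>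
    exact (ihM hf.1 fun x h => ho x (Or.inl h)).choice (ihN hf.2 fun x h => ho x (Or.inr h))

theorem levelState_add {m : Config} :
    levelState n (l + m) b e i j z = levelState n l b e i j z + m := by
  simp only [levelState]; abel

theorem Low.step {P : CounterProgram} (ho : ∀ x, Occurs x P → x < n + 16) {m : Config}
    (h : Low n l) (hs : P.Step l m) : Low n m := fun x hx => by
  rw [← hs.apply_eq fun h' => by have := ho x h'; omega]
  exact h x hx

/-- Each increment or decrement of a low counter changes the degree of the low configuration by one
and the weight counter by `i`. The surplus `w` is therefore constant, and accurate runs project to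
runs of `P`. Only tests of budgeted counters occur, because `P` is test-free. -/
theorem sound_weigh {B w : ℕ} (hij : i + j = B) {P : CounterProgram} (hf : P.TestFree)
    (ho : ∀ x, Occurs x P → x < n + 16) : ∀ {l : Config}, Low n l →
    (levelBudget n B).Sound (weigh n P) (weighed n B i j w l)
      fun β => ∃ m, Low n m ∧ P.Step l m ∧ β = weighed n B i j w m := by
  induction P with
  | inc x =>
    intro l hl
    have hx := ho x rfl
    refine (Budget.sound_inc (levelBudget_ne hx) (levelBudget_pairs_ne hx)
      (inv_levelState hl (by simp) hij.le) (clean_levelState hl)).seq' (mono_addWeight B) ?_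
    rintro γ - - rfl
    have hl' := hl.add (low_single (v := 1) hx)
    refine Budget.Sound.mono (S := (· = levelState n (l + Finsupp.single x 1) B 0 i j
      (w + i * l.degree + i))) ?_ ?_
    · rw [← levelState_add]
      exact (exact_addWeight hl' hij).sound
    · rintro β - - rfl
      refine ⟨_, hl', step_inc_iff.2 rfl, ?_⟩
      rw [weighed, map_add, Finsupp.degree_single, mul_add, mul_one, add_assoc]
  | dec x =>
    intro l hl
    have hx := ho x rfl
    refine (Budget.sound_dec (levelBudget_ne hx)
      (inv_levelState hl (by simp) hij.le) (clean_levelState hl)).seq' (mono_subWeight B) ?_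
    intro γ hI hc hγ
    -- The decremented counter is low, so the unit was taken from `l` itself and not from the level
    -- counters.
    obtain ⟨m, rfl⟩ : ∃ m, l = m + Finsupp.single x 1 := by
      have := DFunLike.congr_fun hγ x
      rw [levelState_of_lt hx] at this
      refine ⟨l - Finsupp.single x 1, (tsub_add_cancel_of_le ?_).symm⟩
      rw [Finsupp.single_le_iff]
      simp at this
      omega
    rw [levelState_add] at hγ
    obtain rfl := add_right_cancel hγ
    have hm := hl.of_add
    refine Budget.Sound.mono (S := (· = weighed n B i j w m)) ?_ ?_
    · rw [map_add, Finsupp.degree_single, mul_add, mul_one, ← add_assoc]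
      exact (exact_subWeight hm hij).sound
    · rintro β - - rfl
      exact ⟨m, hm, step_dec_iff'.2 rfl, rfl⟩
  | test x => exact hf.elim
  | loop M ih =>
    intro l hl
    refine Budget.Sound.loop_inv (mono_weigh B hf ho)
      (inv_levelState hl (by simp) hij.le) (clean_levelState hl) ⟨l, hl, ReflTransGen.refl, rfl⟩ ?_
    rintro γ - - ⟨m, hm, hs, rfl⟩
    refine (ih hf ho hm).mono ?_
    rintro β - - ⟨m', hm', hs', rfl⟩
    exact ⟨m', hm', ReflTransGen.tail hs hs', rfl⟩
  | seq M N ihM ihN =>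
    intro l hl
    refine (ihM hf.1 (fun x h => ho x (Or.inl h)) hl).seq'
      (mono_weigh B hf.2 fun x h => ho x (Or.inr h)) ?_
    rintro γ - - ⟨m, hm, hs, rfl⟩
    refine (ihN hf.2 (fun x h => ho x (Or.inr h)) hm).mono ?_
    rintro β - - ⟨m', hm', hs', rfl⟩
    exact ⟨m', hm', ⟨m, hs, hs'⟩, rfl⟩
  | choice M N ihM ihN =>
    intro l hl
    refine Budget.Sound.choice ((ihM hf.1 (fun x h => ho x (Or.inl h)) hl).mono ?_)
      ((ihN hf.2 (fun x h => ho x (Or.inr h)) hl).mono ?_)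
    · rintro β - - ⟨m, hm, hs, rfl⟩
      exact ⟨m, hm, Or.inl hs, rfl⟩
    · rintro β - - ⟨m, hm, hs, rfl⟩
      exact ⟨m, hm, Or.inr hs, rfl⟩

theorem reach_weigh {B w : ℕ} (hij : i + j = B) {P : CounterProgram} (hf : P.TestFree)
    (ho : ∀ x, Occurs x P → x < n + 16) : ∀ {l m : Config}, Low n l → P.Step l m →
    (levelBudget n B).Reach (weigh n P) (weighed n B i j w l) (weighed n B i j w m) := by
  induction P with
  | inc x =>
    intro l m hl hs
    have hx := ho x rfl
    rw [step_inc_iff] at hs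
    subst hs
    refine Budget.Reach.seq (γ := levelState n (l + Finsupp.single x 1) B 0 i j
      (w + i * l.degree)) trivial (.of_step (step_inc_iff.2 levelState_add)) ?_
    rw [weighed, map_add, Finsupp.degree_single, mul_add, mul_one, ← add_assoc]
    exact (exact_addWeight (hl.add (low_single hx)) hij).reach
  | dec x =>
    intro l m hl hs
    have hx := ho x rfl
    rw [step_dec_iff'] at hs
    subst hs
    refine Budget.Reach.seq (γ := levelState n m B 0 i j
      (w + i * m.degree + i)) trivial (.of_step (step_dec_iff'.2 ?_)) ?_
    · rw [weighed, levelState_add, map_add, Finsupp.degree_single, mul_add, mul_one, ← add_assoc]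
    · exact (exact_subWeight hl.of_add hij).reach
  | test x => exact hf.elim
  | loop M ih =>
    intro l m hl hs
    refine Budget.Reach.loop (TestFree.weigh hf) ?_
    change ReflTransGen M.Step l m at hs
    induction hs using ReflTransGen.head_induction_on with
    | refl => exact ReflTransGen.refl
    | head h _ ih' => exact ReflTransGen.head (ih hf ho hl h) (ih' (hl.step (P := M) ho h))
  | seq M N ihM ihN =>
    rintro l m hl ⟨k, h₁, h₂⟩
    exact (ihM hf.1 (fun x h => ho x (Or.inl h)) hl h₁).seq (TestFree.weigh hf.1)
      (ihN hf.2 (fun x h => ho x (Or.inr h)) (hl.step (fun x h => ho x (Or.inl h)) h₁) h₂)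
  | choice M N ihM ihN =>
    rintro l m hl (h | h)
    · exact (ihM hf.1 (fun x h => ho x (Or.inl h)) hl h).choice_left
    · exact (ihN hf.2 (fun x h => ho x (Or.inr h)) hl h).choice_right

end

/-! ### Carrying the output of a round back to the input. -/

section

variable {n : ℕ} {l : Config} {b e i j z : ℕ}

theorem exists_add_single_of_le {x k : ℕ} (h : k ≤ l x) : ∃ m, l = m + Finsupp.single x k :=
  ⟨l - Finsupp.single x k, (tsub_add_cancel_of_le (Finsupp.single_le_iff.2 h)).symm⟩

theorem add_single_eq_add_single {x y k k' : ℕ} {m : Config} (hxy : x ≠ y)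
    (h : l + Finsupp.single x k = m + Finsupp.single y k') :
    ∃ p, l = p + Finsupp.single y k' ∧ m = p + Finsupp.single x k := by
  obtain ⟨p, rfl⟩ : ∃ p, l = p + Finsupp.single y k' := exists_add_single_of_le (by
    have := DFunLike.congr_fun h y
    simp [hxy.symm] at this
    omega)
  refine ⟨p, rfl, ?_⟩
  rw [add_right_comm] at h
  exact (add_right_cancel h).symm

theorem xfer_move_iff (h : Low n l) {x y k : ℕ} (hx : x < n + 16) (hy : y < n + 16) (hxy : x ≠ y)
    {β : Config} : Xfer [x, n + 22] [y] k (levelState n l b e i j z) β ↔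
      ∃ m z', l = m + Finsupp.single x k ∧ z = z' + k ∧
        β = levelState n (m + Finsupp.single y k) b e i j z' := by
  have key : ∀ m z', Low n m → Xfer [x, n + 22] [y] k
      (levelState n (m + Finsupp.single x k) b e i j (z' + k))
      (levelState n (m + Finsupp.single y k) b e i j z') := by
    intro m z' hm
    refine Xfer.of_list [x, n + 22, y] ?_ ?_ (by simp) (by simp)
    · simp only [List.mem_cons, List.not_mem_nil, or_false, forall_eq_or_imp, forall_eq]
      rw [levelState_of_lt hx, levelState_of_lt hx, levelState_of_lt hy, levelState_of_lt hy]
      simp [levelState, hm.levels, hx.ne, hy.ne, hxy, hxy.symm, show x ≠ n + 22 by omega,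
        show y ≠ n + 22 by omega, show n + 22 ≠ x by omega, show n + 22 ≠ y by omega]
    · intro w hw
      simp only [List.mem_cons, List.not_mem_nil, or_false, not_or] at hw
      simp [levelState, hw]
  constructor
  · intro hX
    obtain ⟨m, rfl⟩ : ∃ m, l = m + Finsupp.single x k := exists_add_single_of_le (by
      have := (hX x).1
      rw [levelState_of_lt hx] at this
      simpa [show n + 22 ≠ x by omega] using this)
    obtain ⟨z', rfl⟩ : ∃ z', z = z' + k := ⟨z - k, by
      have := (hX (n + 22)).1
      simp [levelState, h.levels, show x ≠ n + 22 by omega] at this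
      have hm := h.levels
      simp only [Finsupp.add_apply, Nat.add_eq_zero_iff] at hm
      omega⟩
    exact ⟨m, z', rfl, rfl, hX.unique (key m z' h.of_add)⟩
  · rintro ⟨m, z', rfl, rfl, rfl⟩
    exact key m z' h.of_add

theorem mono_move (B : ℕ) {x y : ℕ} (hx : x < n + 16) (hy : y < n + 16) (hxy : x ≠ y) :
    (levelBudget n B).Mono (xfer [x, n + 22] [y]) := by
  refine Budget.Avoids.mono_xfer ?_ ?_ ?_
  · simp [Budget.Avoids, levelBudget]; omega
  · simp [Budget.Balanced, levelBudget, show y ≠ n + 16 by omega, show y ≠ n + 19 by omega,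
      show y ≠ n + 20 by omega, show y ≠ n + 21 by omega]
  · simp; omega

theorem sound_move {B : ℕ} (h : Low n l) {x y : ℕ} (hx : x < n + 16) (hy : y < n + 16)
    (hxy : x ≠ y) (hI : (levelBudget n B).Inv (levelState n l b e i j z)) :
    (levelBudget n B).Sound (xfer [x, n + 22] [y]) (levelState n l b e i j z) fun β =>
      ∃ k m z', l = m + Finsupp.single x k ∧ z = z' + k ∧
        β = levelState n (m + Finsupp.single y k) b e i j z' := by
  refine (Budget.Avoids.sound_xfer ?_ ?_ ?_ hI (clean_levelState h)).mono ?_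
  · simp [Budget.Avoids, levelBudget]; omega
  · simp; omega
  · simp [Budget.Balanced, levelBudget, show y ≠ n + 16 by omega, show y ≠ n + 19 by omega,
      show y ≠ n + 20 by omega, show y ≠ n + 21 by omega]
  · rintro β - - ⟨k, hk⟩
    exact ⟨k, (xfer_move_iff h hx hy hxy).1 hk⟩

theorem reach_move {B : ℕ} (h : Low n l) {x y k : ℕ} (hx : x < n + 16) (hy : y < n + 16)
    (hxy : x ≠ y) : (levelBudget n B).Reach (xfer [x, n + 22] [y])
      (levelState n (l + Finsupp.single x k) b e i j (z + k))
      (levelState n (l + Finsupp.single y k) b e i j z) := by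
  refine Budget.reach_xfer (n := k) (by simp; omega) ?_
  exact (xfer_move_iff (h.add (low_single hx)) hx hy hxy).2 ⟨l, z, rfl, rfl, rfl⟩

theorem mono_carryBack (B : ℕ) : (levelBudget n B).Mono (carryBack n) := by
  refine (Budget.Avoids.mono_block ?_ ?_).seq ((mono_move B ?_ ?_ ?_).seq
    ((mono_move B ?_ ?_ ?_).seq (mono_move B ?_ ?_ ?_)))
  all_goals simp [Budget.Avoids, Budget.Balanced, levelBudget]

theorem testFree_carryBack : (carryBack n).TestFree :=
  ⟨testFree_block _ _, testFree_xfer _ _, testFree_xfer _ _, testFree_xfer _ _⟩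

/-- The configuration with the given values on the three counters from `x` on. -/
noncomputable def three (x a b c : ℕ) : Config :=
  Finsupp.single x a + Finsupp.single (x + 1) b + Finsupp.single (x + 2) c

theorem low_three {x a b c : ℕ} (h : x < n + 14) : Low n (three x a b c) :=
  ((low_single (by omega)).add (low_single (by omega))).add (low_single (by omega))

/-- Write `s = u + v + t` for the units carried and `m` for the rest. The weight becomes `w + (i' +
1) * (m.degree + s) - s = (w + m.degree) + i' * (m.degree + s)`. So whatever is left behind, whether
on auxiliary counters or on the outputs themselves, is added to the surplus, which can never be
reduced again. -/
theorem sound_carryBack {B w : ℕ} (hij : i + j = B) (h : Low n l) :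
    (levelBudget n B).Sound (carryBack n) (weighed n B i j w l) fun β => ∃ i' m u v t,
      i = i' + 1 ∧ l = m + three n u v t ∧
        β = weighed n B i' (j + 1) (w + m.degree) (m + three (n + 8) u v t) := by
  refine (Budget.Avoids.sound_block ?_ ?_ (inv_levelState h (by simp) hij.le)
    (clean_levelState h)).seq' ((mono_move B ?_ ?_ ?_).seq
    ((mono_move B ?_ ?_ ?_).seq (mono_move B ?_ ?_ ?_))) ?_
  any_goals simp [Budget.Avoids, Budget.Balanced, levelBudget]; done
  intro γ hI hc hγ
  obtain ⟨i', rfl⟩ : ∃ i', i = i' + 1 := ⟨i - 1, by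
    have := (hγ (n + 20)).1
    simp [weighed, levelState, h.levels] at this
    omega⟩
  obtain rfl : γ = levelState n l B 0 i' (j + 1) (w + (i' + 1) * l.degree) := by
    refine hγ.unique (xfer_levelState h ?_ ?_ ?_ ?_ ?_ ?_ ?_)
    all_goals simp
  refine (sound_move h (by omega) (by omega) (by omega) hI).seq' ((mono_move B ?_ ?_ ?_).seq
    (mono_move B ?_ ?_ ?_)) ?_
  any_goals omega
  rintro γ hI - ⟨u, l₁, z₁, hl₁, hz₁, rfl⟩
  have h₁ : Low n (l₁ + Finsupp.single (n + 8) u) :=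
    (Low.of_add (hl₁ ▸ h)).add (low_single (by omega))
  refine (sound_move h₁ (by omega) (by omega) (by omega) hI).seq' (mono_move B ?_ ?_ ?_) ?_
  any_goals omega
  rintro γ hI - ⟨v, l₂, z₂, hl₂, hz₂, rfl⟩
  have h₂ : Low n (l₂ + Finsupp.single (n + 9) v) :=
    (Low.of_add (hl₂ ▸ h₁)).add (low_single (by omega))
  refine (sound_move h₂ (by omega) (by omega) (by omega) hI).mono ?_
  rintro β - - ⟨t, l₃, z₃, hl₃, hz₃, rfl⟩
  -- The targets of earlier moves differ from the sources of later ones, so all moved units were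
  -- already present in `l`, which thus splits into the rest and the three carried amounts.
  obtain ⟨p, rfl, rfl⟩ := add_single_eq_add_single (by omega) hl₂
  obtain ⟨q, hq, rfl⟩ := add_single_eq_add_single (by omega) hl₃
  obtain ⟨r, rfl, rfl⟩ := add_single_eq_add_single (by omega) hq
  refine ⟨i', r, u, v, t, rfl, ?_, ?_⟩
  · rw [hl₁, three]; abel
  · rw [weighed, show r + Finsupp.single (n + 8) u + Finsupp.single (n + 9) v +
      Finsupp.single (n + 10) t = r + three (n + 8) u v t by rw [three]; abel]
    congr 1
    subst hl₁
    simp only [three, map_add, Finsupp.degree_single] at hz₁ ⊢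
    rw [add_one_mul] at hz₁
    have e₁ : r.degree + t + v + u = r.degree + (u + v + t) := by ring
    rw [e₁] at hz₁
    omega

theorem reach_carryBack {B w u v t : ℕ} :
    (levelBudget n B).Reach (carryBack n) (weighed n B (i + 1) j w (three n u v t))
      (weighed n B i (j + 1) w (three (n + 8) u v t)) := by
  refine Budget.Reach.seq (γ := levelState n (three n u v t) B 0 i (j + 1)
    (w + (i + 1) * (three n u v t).degree)) (testFree_block _ _)
    (Budget.reach_block (xfer_levelState (low_three (by omega)) ?_ ?_ ?_ ?_ ?_ ?_ ?_)) ?_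
  any_goals simp
  -- The low counters hold nothing but the triple, so lowering the weight factor by one frees
  -- exactly the units that the three moves consume.
  have hd : w + (i + 1) * (three n u v t).degree =
      w + i * (three (n + 8) u v t).degree + t + v + u := by
    simp only [three, map_add, Finsupp.degree_single]; ring
  rw [hd, weighed]
  generalize w + i * (three (n + 8) u v t).degree = z
  have s₁ : ∀ {x k : ℕ}, x < n + 16 → Low n (Finsupp.single x k) := low_single
  refine Budget.Reach.seq (γ := levelState n (Finsupp.single (n + 8) u + Finsupp.single (n + 1) v +
    Finsupp.single (n + 2) t) B 0 i (j + 1) (z + t + v)) (testFree_xfer _ _) ?_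
    (Budget.Reach.seq (γ := levelState n (Finsupp.single (n + 8) u + Finsupp.single (n + 9) v +
    Finsupp.single (n + 2) t) B 0 i (j + 1) (z + t)) (testFree_xfer _ _) ?_ ?_)
  · convert reach_move (B := B) (l := Finsupp.single (n + 1) v + Finsupp.single (n + 2) t) (k := u)
      (z := z + t + v) ((s₁ ?_).add (s₁ ?_)) (show n < n + 16 by omega)
      (show n + 8 < n + 16 by omega) (by omega) using 2
    any_goals omega
    · rw [three]; abel
    · abel
  · convert reach_move (B := B) (l := Finsupp.single (n + 8) u + Finsupp.single (n + 2) t) (k := v)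
      (z := z + t) ((s₁ ?_).add (s₁ ?_)) (show n + 1 < n + 16 by omega)
      (show n + 9 < n + 16 by omega) (by omega) using 2
    any_goals omega
    · abel
    · abel
  · exact reach_move (B := B) (l := Finsupp.single (n + 8) u + Finsupp.single (n + 9) v) (k := t)
      (z := z) ((s₁ (by omega)).add (s₁ (by omega))) (show n + 2 < n + 16 by omega)
      (show n + 10 < n + 16 by omega) (by omega)

end

/-! ### The iterated amplifier. -/

section

variable {n : ℕ}

theorem triple_eq_three (x B C : ℕ) : triple x B C = three x B C (2 * B * C) := rfl

theorem exact_iterSetup (B : ℕ) : (levelBudget n B).Exact (iterSetup n)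
    (levelState n 0 B 0 0 0 0) (weighed n B B 0 0 0) := by
  have h : Low n 0 := fun _ _ => rfl
  rw [weighed, map_zero, mul_zero]
  refine Budget.Exact.seq (γ := levelState n 0 0 B B 0 0)
      (Budget.Avoids.exact_drain' (K := levelBudget n B) ?_ ?_ ?_ (clean_levelState h)
        ?_ ?_ ?_ (xfer_levelState h ?_ ?_ ?_ ?_ ?_ ?_ ?_) ?_)
      (Budget.Avoids.exact_drain (K := levelBudget n B) ?_ ?_ ?_ ?_
        (inv_levelState h ?_ ?_) (clean_levelState h) ?_ ?_
        (xfer_levelState h ?_ ?_ ?_ ?_ ?_ ?_ ?_) ?_)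
      (Budget.Avoids.mono_drain (K := levelBudget n B) ?_ ?_ ?_ ?_)
  -- The first loop raises `n + 20` although its partner `n + 21` is not lowered. The invariant
  -- survives because the rounds are limited by the initial value `B` of `n + 16`.
  case refine_4 =>
    intro k β hk
    have h₁ := hk (n + 16)
    have h₂ := hk (n + 19)
    have h₃ := hk (n + 20)
    have h₄ := hk (n + 21)
    simp [levelState] at h₁ h₂ h₃ h₄
    simp [Budget.Inv, levelBudget]
    omega
  all_goals try simp [Budget.Avoids, Budget.Balanced, Budget.Paired, levelBudget, levelState]

theorem step_fillTriple {l : Config} :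
    (fillTriple n).Step 0 l ↔ ∃ C, l = triple (n + 8) 1 C := by
  have body : ∀ {α β : Config}, (seq (inc (n + 9)) (seq (inc (n + 10)) (inc (n + 10)))).Step α β ↔
      β = α + (Finsupp.single (n + 9) 1 + Finsupp.single (n + 10) 2) := by
    intro α β
    have e : ∀ α : Config, α + Finsupp.single (n + 9) 1 + Finsupp.single (n + 10) 1 +
        Finsupp.single (n + 10) 1 =
          α + (Finsupp.single (n + 9) 1 + Finsupp.single (n + 10) 2) := fun α => by
      rw [show (2 : ℕ) = 1 + 1 from rfl, Finsupp.single_add]; abel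
    constructor
    · rintro ⟨γ, h₁, δ, h₂, h₃⟩
      rw [step_inc_iff] at h₁ h₂ h₃
      rw [h₃, h₂, h₁, e]
    · rintro rfl
      exact ⟨_, step_inc_iff.2 rfl, _, step_inc_iff.2 rfl, step_inc_iff.2 (e α).symm⟩
  have succ : ∀ C, triple (n + 8) 1 C + (Finsupp.single (n + 9) 1 + Finsupp.single (n + 10) 2) =
      triple (n + 8) 1 (C + 1) := fun C => by
    simp only [triple, mul_add, mul_one, Finsupp.single_add]
    abel
  constructor
  · rintro ⟨γ, h₁, h₂⟩
    rw [step_inc_iff, zero_add] at h₁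
    subst h₁
    change ReflTransGen (Step _) _ _ at h₂
    induction h₂ with
    | refl => exact ⟨0, by simp [triple]⟩
    | tail _ hs ih =>
      obtain ⟨C, rfl⟩ := ih
      exact ⟨C + 1, by rw [body.1 hs, succ]⟩
  · rintro ⟨C, rfl⟩
    refine ⟨_, step_inc_iff.2 (zero_add _).symm, ?_⟩
    induction C with
    | zero =>
      rw [show triple (n + 8) 1 0 = Finsupp.single (n + 8) 1 by simp [triple]]
      exact ReflTransGen.refl
    | succ C ih => exact ReflTransGen.tail ih (body.2 (succ C).symm)

theorem testFree_fillTriple : (fillTriple n).TestFree := ⟨trivial, trivial, trivial, trivial⟩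

theorem occurs_fillTriple : ∀ x, Occurs x (fillTriple n) → x < n + 16 := by
  intro x h
  simp only [fillTriple, Occurs] at h
  omega

theorem testFree_iterClear : (iterClear n).TestFree :=
  ⟨testFree_zeroTest _ _ _ _, testFree_xfer _ _, testFree_xfer _ _⟩

theorem mono_iterClear (B : ℕ) : (levelBudget n B).Mono (iterClear n) := by
  refine (Budget.Paired.mono_zeroTest (K := levelBudget n B) ?_).seq
    ((Budget.Avoids.mono_xfer ?_ ?_ ?_).seq (Budget.Avoids.mono_xfer ?_ ?_ ?_))
  all_goals simp [Budget.Avoids, Budget.Balanced, Budget.Paired, levelBudget]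

/-- The test ensures that all `B` rounds were performed. With `i = 0` the low counters have weight
zero, so the weight counter shows the surplus `w` alone. The rests `b` and `j'` account for clearing
loops that stop early. -/
theorem sound_iterClear {B i j w : ℕ} {l : Config} (hij : i + j = B) (h : Low n l) :
    (levelBudget n B).Sound (iterClear n) (weighed n B i j w l) fun β =>
      i = 0 ∧ ∃ b j', β = levelState n l b 0 0 j' w := by
  refine (Budget.Paired.sound_zeroTest (K := levelBudget n B) ?_
    (inv_levelState h (by simp) hij.le) (clean_levelState h)).seq'
    ((Budget.Avoids.mono_xfer ?_ ?_ ?_).seq (Budget.Avoids.mono_xfer ?_ ?_ ?_)) ?_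
  any_goals simp [Budget.Avoids, Budget.Balanced, Budget.Paired, levelBudget]; done
  rintro γ hI hc ⟨rfl, hi, -⟩
  obtain rfl : i = 0 := by simpa [weighed, levelState, h.levels] using hi
  refine ((Budget.Avoids.sound_xfer ?_ ?_ ?_ hI hc).mono
    (T := fun β => ∃ b, β = levelState n l b 0 0 j w) ?_).seq'
    (Budget.Avoids.mono_xfer ?_ ?_ ?_) ?_
  any_goals simp [Budget.Avoids, Budget.Balanced, Budget.Paired, levelBudget]; done
  · rintro β - - ⟨k, hk⟩
    have := (hk (n + 16)).1
    simp [weighed, levelState, h.levels] at this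
    refine ⟨B - k, hk.unique (xfer_levelState h ?_ ?_ ?_ ?_ ?_ ?_ ?_)⟩
    all_goals simp
    omega
  · rintro γ hI hc ⟨b, rfl⟩
    refine (Budget.Avoids.sound_xfer ?_ ?_ ?_ hI hc).mono ?_
    any_goals simp [Budget.Avoids, Budget.Balanced, Budget.Paired, levelBudget]; done
    rintro β - - ⟨k, hk⟩
    have := (hk (n + 21)).1
    simp [levelState, h.levels] at this
    refine ⟨rfl, b, j - k, hk.unique (xfer_levelState h ?_ ?_ ?_ ?_ ?_ ?_ ?_)⟩
    all_goals simp
    omega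

theorem reach_iterClear {B : ℕ} {l : Config} (h : Low n l) :
    (levelBudget n B).Reach (iterClear n) (weighed n B 0 B 0 l) l := by
  refine (Budget.Paired.reach_zeroTest (K := levelBudget n B) ?_ ?_ ?_).seq
    (testFree_zeroTest _ _ _ _) (Budget.Reach.seq (γ := levelState n l 0 0 0 B 0)
    (testFree_xfer _ _) (Budget.reach_xfer (n := B) ?_ (xfer_levelState h ?_ ?_ ?_ ?_ ?_ ?_ ?_))
    (Budget.reach_xfer (n := B) ?_ ?_))
  case refine_13 =>
    have : Xfer [n + 21] [] B (levelState n l 0 0 0 B 0) (levelState n l 0 0 0 0 0) := by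
      apply xfer_levelState h <;> simp
    simpa [levelState] using this
  all_goals simp [Budget.Paired, levelBudget, weighed, levelState, h.levels]

theorem levelState_zero_add (B C : ℕ) :
    triple (n + 16) B C = levelState n 0 B 0 0 0 0 + C • (levelBudget n B).unit := by
  rw [Budget.smul_unit]
  simp [triple, levelState, levelBudget, add_assoc, -Finsupp.single_mul]

variable {F : ℕ → ℕ} {P : CounterProgram}

/-- The invariant of the iteration: if no surplus has been collected, then the low counters hold a
triple for the current iterate. -/
def IterInv (n B : ℕ) (F : ℕ → ℕ) (α : Config) : Prop :=
  ∃ i j w l, i + j = B ∧ Low n l ∧ α = weighed n B i j w l ∧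
    (w = 0 → ∃ C, l = triple (n + 8) (F^[j] 1) C)

theorem mono_iterBody (hP : IsAmplifier n F P) (B : ℕ) :
    (levelBudget n B).Mono (seq (weigh n P) (carryBack n)) :=
  (mono_weigh B hP.testFree hP.occurs).seq (mono_carryBack B)

/-- If the new surplus is zero, then so are the old one and the leftover of the round. The first
fact gives a correct input triple, the second gives the zero condition under which `hP.sound`
guarantees a correct output. -/
theorem IsAmplifier.sound_body (hP : IsAmplifier n F P) {B : ℕ} {α : Config}
    (hα : IterInv n B F α) :
    (levelBudget n B).Sound (seq (weigh n P) (carryBack n)) α (IterInv n B F) := by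
  obtain ⟨i, j, w, l, hij, hl, rfl, hw⟩ := hα
  refine (sound_weigh hij hP.testFree hP.occurs hl).seq' (mono_carryBack B) ?_
  rintro γ - - ⟨m, hm, hs, rfl⟩
  refine (sound_carryBack hij hm).mono ?_
  rintro β - - ⟨i', r, u, v, t, rfl, rfl, rfl⟩
  refine ⟨i', j + 1, _, _, by omega, hm.of_add.add (low_three (by omega)), rfl, fun h0 => ?_⟩
  obtain ⟨rfl, hr⟩ := Nat.add_eq_zero_iff.1 h0
  obtain rfl := (Finsupp.degree_eq_zero_iff r).1 hr
  obtain ⟨C, rfl⟩ := hw rfl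
  obtain ⟨C', hC'⟩ := hP.sound _ _ _ hs (fun x h₀ h₁ h₂ => by simp [three, h₀, h₁, h₂])
  refine ⟨C', ?_⟩
  have h₀ := DFunLike.congr_fun hC' n
  have h₁ := DFunLike.congr_fun hC' (n + 1)
  have h₂ := DFunLike.congr_fun hC' (n + 2)
  simp [three, triple] at h₀ h₁ h₂
  rw [Function.iterate_succ_apply', triple_eq_three, zero_add, ← h₀, ← h₁, h₂, h₁, h₀]

/-- Completeness of an amplifier determines the input budget from the desired output budget, so the
budgets are chosen from the last round backwards. -/
theorem IsAmplifier.reach_loop (hP : IsAmplifier n F P) {B : ℕ} :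
    ∀ {i j X : ℕ} (C' : ℕ), i + j = B → ∃ C,
      (levelBudget n B).Reach (loop (seq (weigh n P) (carryBack n)))
        (weighed n B i j 0 (triple (n + 8) X C))
        (weighed n B 0 B 0 (triple (n + 8) (F^[i] X) C')) := by
  have hf : (seq (weigh n P) (carryBack n)).TestFree :=
    ⟨hP.testFree.weigh, testFree_carryBack⟩
  suffices H : ∀ {i j X : ℕ} (C' : ℕ), i + j = B → ∃ C,
      ReflTransGen ((levelBudget n B).Reach (seq (weigh n P) (carryBack n)))
        (weighed n B i j 0 (triple (n + 8) X C))
        (weighed n B 0 B 0 (triple (n + 8) (F^[i] X) C')) from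
    fun {_ _ _} C' h => (H C' h).imp fun C hC => Budget.Reach.loop hf hC
  intro i
  induction i with
  | zero =>
    intro j X C' h
    obtain rfl : j = B := by omega
    exact ⟨C', ReflTransGen.refl⟩
  | succ i ih =>
    intro j X C' h
    obtain ⟨C₁, h₁⟩ := ih (j := j + 1) (X := F X) C' (by omega)
    obtain ⟨C, hC⟩ := hP.complete X C₁
    refine ⟨C, ReflTransGen.head ?_ h₁⟩
    exact (reach_weigh h hP.testFree hP.occurs (low_three (by omega)) hC).seq hP.testFree.weigh
      reach_carryBack

theorem occurs_weigh {x : ℕ} (h : Occurs x (weigh n P)) : Occurs x P ∨ x < n + 24 := by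
  induction P with
  | inc y | dec y =>
    simp [weigh, addWeight, subWeight, drain, zeroTest, xfer, block, thenIncs, thenDecs, Occurs]
      at h ⊢
    omega
  | test y => exact Or.inl h
  | loop M ih => exact ih h
  | seq M N ihM ihN =>
    rcases h with h | h
    · exact (ihM h).imp_left Or.inl
    · exact (ihN h).imp_left Or.inr
  | choice M N ihM ihN =>
    rcases h with h | h
    · exact (ihM h).imp_left Or.inl
    · exact (ihN h).imp_left Or.inr

theorem IsAmplifier.iterate (hP : IsAmplifier n F P) :
    IsAmplifier (n + 8) (fun B => F^[B] 1) (iterate n P) where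
  testFree := ⟨(exact_iterSetup 0).testFree, testFree_fillTriple.weigh,
    ⟨hP.testFree.weigh, testFree_carryBack⟩, testFree_iterClear⟩
  occurs := by
    rintro x (h | h | (h | h) | h)
    · simp [iterSetup, drain, zeroTest, xfer, block, thenIncs, thenDecs, Occurs] at h
      omega
    · have := (occurs_weigh h).imp_left (occurs_fillTriple x)
      omega
    · have := (occurs_weigh h).imp_left (hP.occurs x)
      omega
    · simp [carryBack, xfer, block, thenIncs, thenDecs, Occurs] at h
      omega
    · simp [iterClear, zeroTest, xfer, block, thenIncs, thenDecs, Occurs] at h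
      omega
  sound := by
    intro B C β hs h0
    have key : (levelBudget n B).Sound (CounterProgram.iterate n P) (levelState n 0 B 0 0 0 0)
        fun β => ∃ b j w l, β = levelState n l b 0 0 j w ∧ Low n l ∧
          (w = 0 → ∃ C, l = triple (n + 8) (F^[B] 1) C) := by
      have hz : Low n 0 := fun _ _ => rfl
      have hM := mono_iterBody hP B
      refine (exact_iterSetup B).sound.seq' ((mono_weigh B testFree_fillTriple
        occurs_fillTriple).seq (hM.loop.seq (mono_iterClear B))) ?_
      rintro γ - - rfl
      refine (sound_weigh (by omega) testFree_fillTriple occurs_fillTriple hz).seq'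
        (hM.loop.seq (mono_iterClear B)) ?_
      rintro γ hI hc ⟨l, hl, hs, rfl⟩
      refine (Budget.Sound.loop_inv (S := IterInv n B F) hM hI hc
        ⟨B, 0, 0, l, rfl, hl, rfl, fun _ => step_fillTriple.1 hs⟩
        fun γ _ _ hγ => hP.sound_body hγ).seq' (mono_iterClear B) ?_
      rintro γ hI hc ⟨i, j, w, l, hij, hl, rfl, hw⟩
      refine (sound_iterClear hij hl).mono ?_
      rintro β - - ⟨rfl, b, j', rfl⟩
      obtain rfl : j = B := by omega
      exact ⟨b, j', w, l, rfl, hl, hw⟩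
    rw [show n + 8 + 8 = n + 16 from rfl, levelState_zero_add] at hs
    obtain ⟨-, -, h⟩ := key C β hs
    -- The budget counters `n + 17` and `n + 18` end at zero, which gives zero slack.
    obtain ⟨β', C', rfl, hc, b, j, w, l, rfl, hl, hw⟩ := h (by
      rw [Budget.slack, h0, h0]
      · simp
      all_goals simp [levelBudget])
    -- These counters hold the rest of the bound, the unused tests, the rest of the round count and
    -- the surplus. All vanish, and zero surplus validates the triple at `n + 8`.
    have e₁ := h0 (n + 16) (by simp) (by simp) (by simp)
    have e₂ := h0 (n + 17) (by simp) (by simp) (by simp)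
    have e₃ := h0 (n + 21) (by simp) (by simp) (by simp)
    have e₄ := h0 (n + 22) (by simp) (by simp) (by simp)
    simp [levelState, Budget.unit, levelBudget, hl.levels] at e₁ e₂ e₃ e₄
    subst e₁ e₂ e₃ e₄
    obtain ⟨C, rfl⟩ := hw rfl
    exact ⟨C, by simp [levelState]⟩
  complete := by
    intro B C'
    obtain ⟨C₁, h₁⟩ := hP.reach_loop (B := B) (i := B) (j := 0) (X := 1) C' rfl
    have hz : Low n 0 := fun _ _ => rfl
    have h₂ := reach_weigh (n := n) (B := B) (i := B) (j := 0) (w := 0) rfl testFree_fillTriple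
      occurs_fillTriple hz (step_fillTriple.2 ⟨C₁, rfl⟩)
    obtain ⟨t, ht⟩ := (exact_iterSetup B).reach.seq (exact_iterSetup B).testFree
      (h₂.seq testFree_fillTriple.weigh (h₁.seq
        (M := loop (seq (weigh n P) (carryBack n)))
        ⟨hP.testFree.weigh, testFree_carryBack⟩ (reach_iterClear (low_three (by omega)))))
    refine ⟨t, ?_⟩
    rw [show n + 8 + 8 = n + 16 from rfl, levelState_zero_add]
    exact ht

/-- The amplifier of level `k`. -/
def amplifier : ℕ → CounterProgram
  | 0 => doubling
  | k + 1 => iterate (8 * k) (amplifier k)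

/-- The function computed by the amplifier of level `k`. -/
def amplify : ℕ → ℕ → ℕ
  | 0 => fun n => 2 * n
  | k + 1 => fun n => (amplify k)^[n] 1

theorem isAmplifier_amplifier : ∀ k, IsAmplifier (8 * k) (amplify k) (amplifier k)
  | 0 => isAmplifier_doubling
  | k + 1 => (isAmplifier_amplifier k).iterate

end

/-! ### Stacks as counters -/

/-- The counters that are not used by the amplifiers. -/
def slot (s : ℕ) : ℕ := 8 * s + 7

theorem slot_inj {s t : ℕ} : slot s = slot t ↔ s = t := by
  simp [slot]

/-- The counter that holds the code of the stack `k`. -/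
def stackCtr (k : ℕ) : ℕ := slot (2 * k + 6)

/-- The partner of `stackCtr k`. -/
def costackCtr (k : ℕ) : ℕ := slot (2 * k + 7)

/-- The budget for the simulation of `N` stacks. -/
def stackBudget (N B : ℕ) : Budget where
  c := slot 2
  d := slot 3
  B := B
  -- Index `0` is the pair of the bound, index `1` is skipped because its slots form the budget,
  -- index `2` is the scratch pair, and the indices from `3` on are the stacks.
  pairs := {p | ∃ t, t ≠ 1 ∧ t < N + 3 ∧ p = (slot (2 * t), slot (2 * t + 1))}
  c_ne_d := by simp [slot]
  fst_ne_snd := by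
    rintro - ⟨s, -, -, rfl⟩ - ⟨t, -, -, rfl⟩
    simp only [ne_eq, slot_inj]; omega
  fst_inj := by
    rintro - ⟨s, -, -, rfl⟩ - ⟨t, -, -, rfl⟩ h
    simp only [slot_inj] at h
    rw [show s = t by omega]
  snd_inj := by
    rintro - ⟨s, -, -, rfl⟩ - ⟨t, -, -, rfl⟩ h
    simp only [slot_inj] at h
    rw [show s = t by omega]
  fst_ne := by
    rintro - ⟨s, hs, -, rfl⟩
    simp only [ne_eq, slot_inj]; omega
  snd_ne := by
    rintro - ⟨s, hs, -, rfl⟩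
    simp only [ne_eq, slot_inj]; omega

/-- The codes `v` of the stacks, and their partners. -/
noncomputable def stackPart (N B : ℕ) (v : ℕ → ℕ) : Config :=
  ∑ k ∈ Finset.range N, (Finsupp.single (stackCtr k) (v k) +
    Finsupp.single (costackCtr k) (B - v k))

theorem stackPart_stackCtr {N B k : ℕ} {v : ℕ → ℕ} (h : k < N) :
    stackPart N B v (stackCtr k) = v k := by
  rw [stackPart, Finsupp.finsetSum_apply, Finset.sum_eq_single k]
  · simp [stackCtr, costackCtr, slot_inj]
  · intro j _ hj
    have h₁ : 2 * j + 6 ≠ 2 * k + 7 := by omega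
    have h₂ : 2 * j + 7 ≠ 2 * k + 6 := by omega
    have h₃ : 2 * j ≠ 2 * k + 1 := by omega
    simp only [stackCtr, costackCtr, Finsupp.add_apply, Finsupp.single_apply, slot_inj]
    simp [hj, h₁, h₂, h₃]
  · simp [h]

theorem stackPart_costackCtr {N B k : ℕ} {v : ℕ → ℕ} (h : k < N) :
    stackPart N B v (costackCtr k) = B - v k := by
  rw [stackPart, Finsupp.finsetSum_apply, Finset.sum_eq_single k]
  · simp [stackCtr, costackCtr, slot_inj]
  · intro j _ hj
    have h₁ : 2 * j + 6 ≠ 2 * k + 7 := by omega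
    have h₂ : 2 * j + 7 ≠ 2 * k + 6 := by omega
    have h₃ : 2 * j ≠ 2 * k + 1 := by omega
    simp only [stackCtr, costackCtr, Finsupp.add_apply, Finsupp.single_apply, slot_inj]
    simp [hj, h₁, h₂, h₃]
  · simp [h]

theorem stackPart_of_ne {N B x : ℕ} {v : ℕ → ℕ}
    (h : ∀ k < N, x ≠ stackCtr k ∧ x ≠ costackCtr k) : stackPart N B v x = 0 := by
  rw [stackPart, Finsupp.finsetSum_apply]
  refine Finset.sum_eq_zero fun k hk => ?_
  have := h k (Finset.mem_range.1 hk)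
  simp [this]

/-- A configuration of the simulation: the codes `v` of the stacks, the value `w` of the scratch
counter, and the other counters. -/
noncomputable def stackState (N B : ℕ) (v : ℕ → ℕ) (w : ℕ) (r : Config) : Config :=
  stackPart N B v + (Finsupp.single (slot 4) w + Finsupp.single (slot 5) (B - w)) + r

/-- The counters that are used neither for stacks nor for the budget. -/
def Rest (N B : ℕ) (r : Config) : Prop :=
  (∀ s, 2 ≤ s → s < 2 * N + 6 → r (slot s) = 0) ∧ r (slot 0) + r (slot 1) ≤ B

/-- Push the digit `a` in base `W`. -/
def pushCtr (W k a : ℕ) : CounterProgram :=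
  seq (drain (slot 2) (slot 3) (stackCtr k :: List.replicate W (slot 5))
      (costackCtr k :: List.replicate W (slot 4)) (stackCtr k) (costackCtr k))
    (seq (drain (slot 2) (slot 3) [slot 4, costackCtr k] [slot 5, stackCtr k] (slot 4) (slot 5))
      (block (List.replicate a (costackCtr k)) (List.replicate a (stackCtr k))))

/-- Pop the digit `a` in base `W`. -/
def popCtr (W k a : ℕ) : CounterProgram :=
  seq (block (List.replicate a (stackCtr k)) (List.replicate a (costackCtr k)))
    (seq (drain (slot 2) (slot 3) (slot 5 :: List.replicate W (stackCtr k))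
      (slot 4 :: List.replicate W (costackCtr k)) (stackCtr k) (costackCtr k))
      (drain (slot 2) (slot 3) [slot 4, costackCtr k] [slot 5, stackCtr k] (slot 4) (slot 5)))

/-- Test whether a stack is empty. -/
def emptyCtr (k : ℕ) : CounterProgram :=
  zeroTest (slot 2) (slot 3) (stackCtr k) (costackCtr k)

/-! ### Push, pop and emptiness on stack codes. -/

section

variable {N B k : ℕ} {v : ℕ → ℕ} {w : ℕ} {r : Config}

theorem Rest.stackCtr (h : Rest N B r) (hk : k < N) : r (stackCtr k) = 0 :=
  h.1 _ (by omega) (by omega)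

theorem Rest.costackCtr (h : Rest N B r) (hk : k < N) : r (costackCtr k) = 0 :=
  h.1 _ (by omega) (by omega)

theorem stackState_stackCtr (h : Rest N B r) (hk : k < N) :
    stackState N B v w r (stackCtr k) = v k := by
  simp only [stackState, Finsupp.add_apply, stackPart_stackCtr hk, h.stackCtr hk]
  simp [stackCtr, slot_inj]

theorem stackState_costackCtr (h : Rest N B r) (hk : k < N) :
    stackState N B v w r (costackCtr k) = B - v k := by
  simp only [stackState, Finsupp.add_apply, stackPart_costackCtr hk, h.costackCtr hk]
  simp [costackCtr, slot_inj]

theorem stackPart_slot_of_lt {s : ℕ} (h : s < 6) : stackPart N B v (slot s) = 0 := by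
  refine stackPart_of_ne fun k _ => ?_
  simp only [stackCtr, costackCtr, ne_eq, slot_inj]
  omega

theorem stackState_four (h : Rest N B r) : stackState N B v w r (slot 4) = w := by
  simp [stackState, stackPart_slot_of_lt, h.1 4, slot_inj]

theorem stackState_five (h : Rest N B r) : stackState N B v w r (slot 5) = B - w := by
  simp [stackState, stackPart_slot_of_lt, h.1 5, slot_inj]

theorem clean_stackState (h : Rest N B r) : (stackBudget N B).Clean (stackState N B v w r) := by
  simp [Budget.Clean, stackBudget, stackState, stackPart_slot_of_lt, h.1 2, h.1 3, slot_inj]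

theorem inv_stackState (h : Rest N B r) (hv : ∀ k < N, v k ≤ B) (hw : w ≤ B) :
    (stackBudget N B).Inv (stackState N B v w r) := by
  rintro - ⟨t, h₁, h₂, rfl⟩
  rcases Nat.lt_or_ge t 1 with ht | ht
  · obtain rfl : t = 0 := by omega
    have := h.2
    simpa [stackState, stackPart_slot_of_lt, slot_inj, stackBudget] using this
  rcases Nat.lt_or_ge t 3 with ht' | ht'
  · obtain rfl : t = 2 := by omega
    have e₁ := stackState_four (v := v) (w := w) h
    have e₂ := stackState_five (v := v) (w := w) h
    simp only [stackBudget, Nat.reduceMul, Nat.reduceAdd, e₁, e₂]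
    omega
  · obtain ⟨k, rfl⟩ : ∃ k, t = k + 3 := ⟨t - 3, by omega⟩
    have hk : k < N := by omega
    have e₁ := stackState_stackCtr (v := v) (w := w) h hk
    have e₂ := stackState_costackCtr (v := v) (w := w) h hk
    have := hv k hk
    change stackState N B v w r (stackCtr k) + stackState N B v w r (costackCtr k) ≤ B
    omega

theorem stackState_of_ne {x : ℕ} {v' : ℕ → ℕ} {w' : ℕ} (hv : ∀ j, j ≠ k → v' j = v j)
    (h₁ : x ≠ stackCtr k) (h₂ : x ≠ costackCtr k) (h₃ : x ≠ slot 4) (h₄ : x ≠ slot 5) :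
    stackState N B v' w' r x = stackState N B v w r x := by
  have : stackPart N B v' x = stackPart N B v x := by
    rw [stackPart, stackPart, Finsupp.finsetSum_apply, Finsupp.finsetSum_apply]
    refine Finset.sum_congr rfl fun j _ => ?_
    by_cases hj : j = k
    · subst hj; simp [h₁, h₂]
    · rw [hv j hj]
  simp [stackState, this, h₃, h₄]

theorem xfer_stackState {neg pos : List ℕ} {n a w' : ℕ} (h : Rest N B r) (hk : k < N)
    (hn : neg ⊆ [stackCtr k, costackCtr k, slot 4, slot 5])
    (hp : pos ⊆ [stackCtr k, costackCtr k, slot 4, slot 5])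
    (h₁ : n * neg.count (stackCtr k) ≤ v k ∧
      a + n * neg.count (stackCtr k) = v k + n * pos.count (stackCtr k))
    (h₂ : n * neg.count (costackCtr k) ≤ B - v k ∧
      (B - a) + n * neg.count (costackCtr k) = (B - v k) + n * pos.count (costackCtr k))
    (h₃ : n * neg.count (slot 4) ≤ w ∧
      w' + n * neg.count (slot 4) = w + n * pos.count (slot 4))
    (h₄ : n * neg.count (slot 5) ≤ B - w ∧
      (B - w') + n * neg.count (slot 5) = (B - w) + n * pos.count (slot 5)) :
    Xfer neg pos n (stackState N B v w r) (stackState N B (Function.update v k a) w' r) := by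
  refine Xfer.of_list [stackCtr k, costackCtr k, slot 4, slot 5] ?_ ?_ hn hp
  · simp only [List.mem_cons, List.not_mem_nil, or_false, forall_eq_or_imp, forall_eq,
      stackState_stackCtr h hk, stackState_costackCtr h hk, stackState_four h, stackState_five h,
      Function.update_self]
    exact ⟨h₁, h₂, h₃, h₄⟩
  · intro x hx
    simp only [List.mem_cons, List.not_mem_nil, or_false, not_or] at hx
    exact stackState_of_ne (k := k) (fun j hj => Function.update_of_ne hj _ _) hx.1 hx.2.1
      hx.2.2.1 hx.2.2.2

theorem paired_stackCtr (hk : k < N) :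
    (stackBudget N B).Paired (stackCtr k) (costackCtr k) :=
  Or.inl ⟨k + 3, by omega, by omega, rfl⟩

theorem paired_scratch : (stackBudget N B).Paired (slot 4) (slot 5) :=
  Or.inl ⟨2, by omega, by omega, rfl⟩

/-- Transfers between the counters of one stack and the scratch pair avoid the budget. -/
theorem avoids_of_subset {neg pos : List ℕ}
    (hn : neg ⊆ [stackCtr k, costackCtr k, slot 4, slot 5])
    (hp : pos ⊆ [stackCtr k, costackCtr k, slot 4, slot 5]) :
    (stackBudget N B).Avoids neg pos := by
  have h₁ : slot 2 ∉ [stackCtr k, costackCtr k, slot 4, slot 5] := by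
    simp [stackCtr, costackCtr, slot_inj]
  have h₂ : slot 3 ∉ [stackCtr k, costackCtr k, slot 4, slot 5] := by
    simp [stackCtr, costackCtr, slot_inj]
  exact ⟨⟨fun h => h₁ (hn h), fun h => h₂ (hn h)⟩, fun h => h₁ (hp h), fun h => h₂ (hp h)⟩

/-- Transfers between the counters of one stack and the scratch pair are balanced if they are so
on these two pairs. -/
theorem balanced_of_subset {neg pos : List ℕ}
    (hp : pos ⊆ [stackCtr k, costackCtr k, slot 4, slot 5])
    (h₁ : pos.count (stackCtr k) + pos.count (costackCtr k) ≤
      neg.count (stackCtr k) + neg.count (costackCtr k))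
    (h₂ : pos.count (slot 4) + pos.count (slot 5) ≤ neg.count (slot 4) + neg.count (slot 5)) :
    (stackBudget N B).Balanced neg pos := by
  rintro - ⟨t, ht, -, rfl⟩
  by_cases h2 : t = 2
  · subst h2; exact h₂
  by_cases h3 : t = k + 3
  · subst h3; exact h₁
  have e : ∀ s, s ≠ 2 * k + 6 → s ≠ 2 * k + 7 → s ≠ 4 → s ≠ 5 → pos.count (slot s) = 0 := by
    intro s s₁ s₂ s₃ s₄
    refine List.count_eq_zero.2 fun h => ?_
    have := hp h
    simp [stackCtr, costackCtr, slot_inj, s₁, s₂, s₃, s₄] at this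
  dsimp only
  rw [e (2 * t), e (2 * t + 1)] <;> omega

theorem disjoint_push (W : ℕ) : (stackCtr k :: List.replicate W (slot 5)).Disjoint
    (costackCtr k :: List.replicate W (slot 4)) := by
  intro x h₁ h₂
  simp only [List.mem_cons, List.mem_replicate, stackCtr, costackCtr] at h₁ h₂
  rcases h₁ with rfl | ⟨_, rfl⟩ <;> simp only [slot_inj] at h₂ <;> omega

theorem disjoint_pop (W : ℕ) : (slot 5 :: List.replicate W (stackCtr k)).Disjoint
    (slot 4 :: List.replicate W (costackCtr k)) := by
  intro x h₁ h₂
  simp only [List.mem_cons, List.mem_replicate, stackCtr, costackCtr] at h₁ h₂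
  rcases h₁ with rfl | ⟨_, rfl⟩ <;> simp only [slot_inj] at h₂ <;> omega

theorem disjoint_back : [slot 4, costackCtr k].Disjoint [slot 5, stackCtr k] := by
  simp [stackCtr, costackCtr, slot_inj]

theorem replicate_subset_of_mem {a x : ℕ} {l : List ℕ} (h : x ∈ l) : List.replicate a x ⊆ l :=
  fun _ hy => List.eq_of_mem_replicate hy ▸ h

theorem mono_block_push (a : ℕ) : (stackBudget N B).Mono
    (block (List.replicate a (costackCtr k)) (List.replicate a (stackCtr k))) := by
  refine Budget.Avoids.mono_block (avoids_of_subset (k := k) ?_ ?_)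
    (balanced_of_subset (k := k) ?_ ?_ ?_)
  all_goals
    first
    | exact replicate_subset_of_mem (by simp)
    | simp [List.count_replicate, stackCtr, costackCtr, slot_inj]

theorem mono_block_pop (a : ℕ) : (stackBudget N B).Mono
    (block (List.replicate a (stackCtr k)) (List.replicate a (costackCtr k))) := by
  refine Budget.Avoids.mono_block (avoids_of_subset (k := k) ?_ ?_)
    (balanced_of_subset (k := k) ?_ ?_ ?_)
  all_goals
    first
    | exact replicate_subset_of_mem (by simp)
    | simp [List.count_replicate, stackCtr, costackCtr, slot_inj]

theorem push_neg_subset (W : ℕ) : stackCtr k :: List.replicate W (slot 5) ⊆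
    [stackCtr k, costackCtr k, slot 4, slot 5] :=
  List.cons_subset.2 ⟨by simp, replicate_subset_of_mem (by simp)⟩

theorem push_pos_subset (W : ℕ) : costackCtr k :: List.replicate W (slot 4) ⊆
    [stackCtr k, costackCtr k, slot 4, slot 5] :=
  List.cons_subset.2 ⟨by simp, replicate_subset_of_mem (by simp)⟩

theorem pop_neg_subset (W : ℕ) : slot 5 :: List.replicate W (stackCtr k) ⊆
    [stackCtr k, costackCtr k, slot 4, slot 5] :=
  List.cons_subset.2 ⟨by simp, replicate_subset_of_mem (by simp)⟩

theorem pop_pos_subset (W : ℕ) : slot 4 :: List.replicate W (costackCtr k) ⊆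
    [stackCtr k, costackCtr k, slot 4, slot 5] :=
  List.cons_subset.2 ⟨by simp, replicate_subset_of_mem (by simp)⟩

theorem back_neg_subset : [slot 4, costackCtr k] ⊆ [stackCtr k, costackCtr k, slot 4, slot 5] := by
  simp

theorem back_pos_subset : [slot 5, stackCtr k] ⊆ [stackCtr k, costackCtr k, slot 4, slot 5] := by
  simp

theorem balanced_push (W : ℕ) : (stackBudget N B).Balanced
    (stackCtr k :: List.replicate W (slot 5)) (costackCtr k :: List.replicate W (slot 4)) := by
  refine balanced_of_subset (push_pos_subset W) ?_ ?_ <;>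
  simp [List.count_cons, List.count_replicate, stackCtr, costackCtr, slot_inj]

theorem balanced_pop (W : ℕ) : (stackBudget N B).Balanced
    (slot 5 :: List.replicate W (stackCtr k)) (slot 4 :: List.replicate W (costackCtr k)) := by
  refine balanced_of_subset (pop_pos_subset W) ?_ ?_ <;>
  simp [List.count_cons, List.count_replicate, stackCtr, costackCtr, slot_inj]

theorem balanced_back : (stackBudget N B).Balanced
    [slot 4, costackCtr k] [slot 5, stackCtr k] := by
  refine balanced_of_subset back_pos_subset ?_ ?_ <;>
  simp [List.count_cons, stackCtr, costackCtr, slot_inj]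

theorem mono_back (k : ℕ) : (stackBudget N B).Mono
    (drain (slot 2) (slot 3) [slot 4, costackCtr k] [slot 5, stackCtr k] (slot 4) (slot 5)) :=
  Budget.Avoids.mono_drain (K := stackBudget N B) (avoids_of_subset back_neg_subset back_pos_subset)
    balanced_back disjoint_back paired_scratch

theorem mono_push (W a : ℕ) (hk : k < N) : (stackBudget N B).Mono (pushCtr W k a) :=
  (Budget.Avoids.mono_drain (K := stackBudget N B) (avoids_of_subset (push_neg_subset W)
    (push_pos_subset W)) (balanced_push W) (disjoint_push W) (paired_stackCtr hk)).seq
    ((mono_back k).seq (mono_block_push a))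

theorem mono_pop (W a : ℕ) (hk : k < N) : (stackBudget N B).Mono (popCtr W k a) :=
  (mono_block_pop a).seq ((Budget.Avoids.mono_drain (K := stackBudget N B)
    (avoids_of_subset (pop_neg_subset W) (pop_pos_subset W)) (balanced_pop W) (disjoint_pop W)
    (paired_stackCtr hk)).seq (mono_back k))

theorem mono_empty (hk : k < N) : (stackBudget N B).Mono (emptyCtr k) :=
  Budget.Paired.mono_zeroTest (K := stackBudget N B) (paired_stackCtr hk)

theorem testFree_push (W k a : ℕ) : (pushCtr W k a).TestFree :=
  ⟨testFree_drain _ _ _ _ _ _, testFree_drain _ _ _ _ _ _, testFree_block _ _⟩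

theorem testFree_pop (W k a : ℕ) : (popCtr W k a).TestFree :=
  ⟨testFree_block _ _, testFree_drain _ _ _ _ _ _, testFree_drain _ _ _ _ _ _⟩

theorem testFree_empty (k : ℕ) : (emptyCtr k).TestFree := testFree_zeroTest _ _ _ _

/-- Moving the scratch counter to an empty stack counter. -/
theorem exact_back (h : Rest N B r) (hk : k < N) (hv : ∀ k < N, v k ≤ B) (h0 : v k = 0)
    (hw : w ≤ B) : (stackBudget N B).Exact
      (drain (slot 2) (slot 3) [slot 4, costackCtr k] [slot 5, stackCtr k] (slot 4) (slot 5))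
      (stackState N B v w r) (stackState N B (Function.update v k w) 0 r) := by
  refine Budget.Avoids.exact_drain (K := stackBudget N B)
    (avoids_of_subset back_neg_subset back_pos_subset)
    disjoint_back balanced_back paired_scratch (inv_stackState h hv hw) (clean_stackState h)
    ?_ ?_ (xfer_stackState h hk back_neg_subset back_pos_subset ?_ ?_ ?_ ?_) ?_
  case refine_7 => rw [stackState_five h]; rfl
  all_goals simp [stackState_four h, stackCtr, costackCtr, slot_inj, h0]
  all_goals omega

theorem xfer_push (h : Rest N B r) (hk : k < N) {W : ℕ} (hv : v k ≤ B) (hW : v k * W ≤ B) :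
    Xfer (stackCtr k :: List.replicate W (slot 5)) (costackCtr k :: List.replicate W (slot 4))
      (v k) (stackState N B v 0 r) (stackState N B (Function.update v k 0) (v k * W) r) := by
  refine xfer_stackState h hk (push_neg_subset W) (push_pos_subset W) ?_ ?_ ?_ ?_ <;>
  simp [List.count_cons, List.count_replicate, stackCtr, costackCtr, slot_inj] <;> omega

theorem xfer_pop (h : Rest N B r) (hk : k < N) {W q : ℕ} (hv : v k ≤ B) (hW : v k = q * W)
    (hq : q ≤ B) :
    Xfer (slot 5 :: List.replicate W (stackCtr k)) (slot 4 :: List.replicate W (costackCtr k))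
      q (stackState N B v 0 r) (stackState N B (Function.update v k 0) q r) := by
  refine xfer_stackState h hk (pop_neg_subset W) (pop_pos_subset W) ?_ ?_ ?_ ?_ <;>
  simp [List.count_cons, List.count_replicate, stackCtr, costackCtr, slot_inj] <;> omega

theorem xfer_add (h : Rest N B r) (hk : k < N) {a : ℕ} (ha : v k + a ≤ B) :
    Xfer (List.replicate a (costackCtr k)) (List.replicate a (stackCtr k)) 1
      (stackState N B v 0 r) (stackState N B (Function.update v k (v k + a)) 0 r) := by
  refine xfer_stackState h hk (replicate_subset_of_mem (by simp))
    (replicate_subset_of_mem (by simp)) ?_ ?_ ?_ ?_ <;>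
  simp [List.count_cons, List.count_replicate, stackCtr, costackCtr, slot_inj]
  omega

theorem xfer_sub (h : Rest N B r) (hk : k < N) {a q : ℕ} (hv : v k ≤ B) (ha : v k = q + a) :
    Xfer (List.replicate a (stackCtr k)) (List.replicate a (costackCtr k)) 1
      (stackState N B v 0 r) (stackState N B (Function.update v k q) 0 r) := by
  refine xfer_stackState h hk (replicate_subset_of_mem (by simp))
    (replicate_subset_of_mem (by simp)) ?_ ?_ ?_ ?_ <;>
  simp [List.count_cons, List.count_replicate, stackCtr, costackCtr, slot_inj] <;> omega

theorem update_le (hv : ∀ k < N, v k ≤ B) {a : ℕ} (ha : a ≤ B) :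
    ∀ j < N, Function.update v k a j ≤ B := by
  intro j hj
  by_cases h : j = k
  · subst h; simpa using ha
  · simpa [h] using hv j hj

/-- Each unit of the old code takes `W` units of room from the partner of the scratch counter, and
the digit takes room from the partner of the stack. A run without overflow is the only possible one,
so the bound on the new code is a conclusion and not an assumption. -/
theorem sound_push (h : Rest N B r) (hk : k < N) (hv : ∀ k < N, v k ≤ B) (W a : ℕ) :
    (stackBudget N B).Sound (pushCtr W k a) (stackState N B v 0 r) fun β =>
      W * v k + a ≤ B ∧ β = stackState N B (Function.update v k (W * v k + a)) 0 r := by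
  refine ((Budget.Avoids.sound_drain (K := stackBudget N B) (avoids_of_subset (push_neg_subset W)
    (push_pos_subset W)) (disjoint_push W) (balanced_push W) (paired_stackCtr hk)
    (inv_stackState h hv (Nat.zero_le _)) (clean_stackState h)).mono
    (T := fun β => v k * W ≤ B ∧ β = stackState N B (Function.update v k 0) (v k * W) r)
    ?_).seq' ((mono_back k).seq (mono_block_push a)) ?_
  · rintro β - - ⟨n, hn, h0, -⟩
    have h₁ := (hn (stackCtr k)).2
    have h₂ := (hn (slot 5)).1
    rw [h0, stackState_stackCtr h hk] at h₁
    rw [stackState_five h] at h₂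
    simp [List.count_cons, List.count_replicate, stackCtr, costackCtr, slot_inj] at h₁ h₂
    subst h₁
    exact ⟨h₂, hn.unique (xfer_push h hk (hv k hk) h₂)⟩
  rintro γ hI hc ⟨hW, rfl⟩
  refine (exact_back h hk (update_le hv (Nat.zero_le _)) (by simp) hW).sound.seq'
    (mono_block_push a) ?_
  rintro γ hI hc rfl
  rw [Function.update_idem] at hI hc ⊢
  refine (Budget.Avoids.sound_block (avoids_of_subset (k := k) (replicate_subset_of_mem (by simp))
    (replicate_subset_of_mem (by simp))) (balanced_of_subset (k := k)
    (replicate_subset_of_mem (by simp)) ?_ ?_) hI hc).mono ?_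
  any_goals simp [List.count_replicate, stackCtr, costackCtr, slot_inj]; done
  rintro β - - hβ
  have ha : W * v k + a ≤ B := by
    have := (hβ (costackCtr k)).1
    rw [stackState_costackCtr h hk] at this
    simp [List.count_replicate] at this
    rw [mul_comm W]
    omega
  refine ⟨ha, hβ.unique ?_⟩
  have := xfer_add (v := Function.update v k (v k * W)) h hk (a := a)
    (by simpa [mul_comm W] using ha)
  rw [Function.update_idem, Function.update_self] at this
  rwa [mul_comm W]

theorem reach_push (h : Rest N B r) (hk : k < N) (hv : ∀ k < N, v k ≤ B) {W a : ℕ}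
    (hW : W * v k + a ≤ B) : (stackBudget N B).Reach (pushCtr W k a) (stackState N B v 0 r)
      (stackState N B (Function.update v k (W * v k + a)) 0 r) := by
  rw [mul_comm W] at hW ⊢
  refine (Budget.Paired.reach_drain (K := stackBudget N B) (disjoint_push W) (paired_stackCtr hk)
    (xfer_push h hk (hv k hk) (by omega)) (by simp [stackState_stackCtr h hk])
    (by simp [stackState_costackCtr h hk, stackBudget])).seq (testFree_drain _ _ _ _ _ _)
    ((exact_back h hk (update_le hv (Nat.zero_le _)) (by simp) (by omega)).reach.seq
      (testFree_drain _ _ _ _ _ _) (Budget.reach_block ?_))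
  have := xfer_add (v := Function.update v k (v k * W)) h hk (a := a) (by simpa using hW)
  simpa using this

/-- Subtracting the guessed digit and then draining in portions of `W` units leaves zero only if the
difference is divisible by `W`. The test of the stack counter therefore verifies the guess. -/
theorem sound_pop (h : Rest N B r) (hk : k < N) (hv : ∀ k < N, v k ≤ B) (W a : ℕ) :
    (stackBudget N B).Sound (popCtr W k a) (stackState N B v 0 r) fun β =>
      ∃ q, q ≤ B ∧ v k = W * q + a ∧ β = stackState N B (Function.update v k q) 0 r := by
  refine ((Budget.Avoids.sound_block (avoids_of_subset (k := k) (replicate_subset_of_mem (by simp))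
    (replicate_subset_of_mem (by simp))) (balanced_of_subset (k := k)
    (replicate_subset_of_mem (by simp)) ?_ ?_) (inv_stackState h hv (Nat.zero_le _))
    (clean_stackState h)).mono (T := fun β => ∃ q, v k = q + a ∧
      β = stackState N B (Function.update v k q) 0 r) ?_).seq'
    ((Budget.Avoids.mono_drain (K := stackBudget N B)
    (avoids_of_subset (pop_neg_subset W) (pop_pos_subset W)) (balanced_pop W) (disjoint_pop W)
    (paired_stackCtr hk)).seq (mono_back k)) ?_
  any_goals simp [List.count_replicate, stackCtr, costackCtr, slot_inj]; done
  · rintro β - - hβ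
    have h₁ := (hβ (stackCtr k)).1
    rw [stackState_stackCtr h hk] at h₁
    simp at h₁
    exact ⟨v k - a, by omega, hβ.unique (xfer_sub h hk (hv k hk) (by omega))⟩
  rintro γ hI hc ⟨p, hp, rfl⟩
  have hpB : p ≤ B := by have := hv k hk; omega
  have hv' := update_le (k := k) hv hpB
  refine ((Budget.Avoids.sound_drain (K := stackBudget N B) (avoids_of_subset (pop_neg_subset W)
    (pop_pos_subset W)) (disjoint_pop W) (balanced_pop W) (paired_stackCtr hk)
    hI hc).mono
    (T := fun β => ∃ q, q ≤ B ∧ p = q * W ∧ β = stackState N B (Function.update v k 0) q r)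
    ?_).seq' (mono_back k) ?_
  · rintro β - - ⟨n, hn, h0, -⟩
    have h₁ := (hn (stackCtr k)).2
    have h₂ := (hn (slot 5)).1
    rw [h0, stackState_stackCtr h hk] at h₁
    rw [stackState_five h] at h₂
    simp [List.count_cons, List.count_replicate, stackCtr, costackCtr, slot_inj] at h₁ h₂
    refine ⟨n, h₂, h₁.symm, ?_⟩
    have := xfer_pop (v := Function.update v k p) h hk (W := W) (q := n) (by simpa using hpB)
      (by simp [h₁]) h₂
    rw [Function.update_idem] at this
    exact hn.unique this
  rintro γ hI hc ⟨q, hq, rfl, rfl⟩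
  refine (exact_back h hk (update_le hv (Nat.zero_le _)) (by simp) hq).sound.mono ?_
  rintro β - - rfl
  exact ⟨q, hq, by rw [hp, mul_comm], by rw [Function.update_idem]⟩

theorem reach_pop (h : Rest N B r) (hk : k < N) (hv : ∀ k < N, v k ≤ B) {W a q : ℕ}
    (hq : q ≤ B) (hW : v k = W * q + a) :
    (stackBudget N B).Reach (popCtr W k a) (stackState N B v 0 r)
      (stackState N B (Function.update v k q) 0 r) := by
  rw [mul_comm W] at hW
  have hvk := hv k hk
  refine (Budget.reach_block (xfer_sub h hk hvk hW)).seq (testFree_block _ _)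
    ((Budget.Paired.reach_drain (K := stackBudget N B) (disjoint_pop W) (paired_stackCtr hk)
    (xfer_pop (q := q) h hk (by simp; omega) (by simp) hq) (by simp [stackState_stackCtr h hk])
    (by simp [stackState_costackCtr h hk, stackBudget])).seq (testFree_drain _ _ _ _ _ _) ?_)
  have := (exact_back (v := Function.update v k 0) (w := q) h hk (update_le hv (Nat.zero_le _))
    (by simp) hq).reach
  simpa using this

theorem sound_empty (h : Rest N B r) (hk : k < N) (hv : ∀ k < N, v k ≤ B) :
    (stackBudget N B).Sound (emptyCtr k) (stackState N B v 0 r) fun β =>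
      v k = 0 ∧ β = stackState N B v 0 r := by
  refine (Budget.Paired.sound_zeroTest (K := stackBudget N B) (paired_stackCtr hk)
    (inv_stackState h hv (Nat.zero_le _)) (clean_stackState h)).mono ?_
  rintro β - - ⟨rfl, h₁, -⟩
  exact ⟨by rwa [stackState_stackCtr h hk] at h₁, rfl⟩

theorem reach_empty (h : Rest N B r) (hk : k < N) (h0 : v k = 0) :
    (stackBudget N B).Reach (emptyCtr k) (stackState N B v 0 r) (stackState N B v 0 r) := by
  refine Budget.Paired.reach_zeroTest (K := stackBudget N B) (paired_stackCtr hk) ?_ ?_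
  · rw [stackState_stackCtr h hk, h0]
  · rw [stackState_costackCtr h hk, h0]; rfl

end

open Turing

/-! ### Simulation of stack machines -/

/-- A numbering of stacks, states and symbols of a stack machine. Only the symbols in `alph` need
to be numbered injectively. -/
structure StackCode {K : Type} (Γ : K → Type) (Λ σ : Type) where
  N : ℕ
  idx : K → ℕ
  idx_lt : ∀ k, idx k < N
  idx_inj : Function.Injective idx
  st : Option Λ × σ → ℕ
  st_inj : Function.Injective st
  W : ℕ
  W_pos : 0 < W
  alph : ∀ k, List (Γ k)
  digit : ∀ k, Γ k → ℕ
  digit_pos : ∀ k a, 0 < digit k a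
  digit_lt : ∀ k, ∀ a ∈ alph k, digit k a < W
  digit_inj : ∀ k, ∀ a ∈ alph k, ∀ b ∈ alph k, digit k a = digit k b → a = b

/-- Nondeterministic choice from a list. -/
def choiceList (M : CounterProgram) (l : List CounterProgram) : CounterProgram :=
  l.foldr choice M

theorem testFree_choiceList {M : CounterProgram} {l : List CounterProgram} (hM : M.TestFree)
    (h : ∀ P ∈ l, P.TestFree) : (choiceList M l).TestFree := by
  induction l with
  | nil => exact hM
  | cons P l ih =>
    exact ⟨h P (by simp), ih fun Q hQ => h Q (by simp [hQ])⟩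

theorem Budget.mono_choiceList {B : Budget} {M : CounterProgram} {l : List CounterProgram}
    (hM : B.Mono M) (h : ∀ P ∈ l, B.Mono P) : B.Mono (choiceList M l) := by
  induction l with
  | nil => exact hM
  | cons P l ih => exact (h P (by simp)).choice (ih fun Q hQ => h Q (by simp [hQ]))

theorem Budget.sound_choiceList {B : Budget} {M : CounterProgram} {l : List CounterProgram}
    {α : Config} {S : Config → Prop} (hM : B.Sound M α S) (h : ∀ P ∈ l, B.Sound P α S) :
    B.Sound (choiceList M l) α S := by
  induction l with
  | nil => exact hM
  | cons P l ih => exact (h P (by simp)).choice (ih fun Q hQ => h Q (by simp [hQ]))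

theorem Budget.reach_choiceList_head {B : Budget} {M : CounterProgram} {l : List CounterProgram}
    {α β : Config} (hM : B.Reach M α β) : B.Reach (choiceList M l) α β := by
  induction l with
  | nil => exact hM
  | cons P l ih => exact ih.choice_right

theorem Budget.reach_choiceList_mem {B : Budget} {M P : CounterProgram} {l : List CounterProgram}
    {α β : Config} (hP : P ∈ l) (h : B.Reach P α β) : B.Reach (choiceList M l) α β := by
  induction l with
  | nil => simp at hP
  | cons Q l ih =>
    rcases List.mem_cons.1 hP with rfl | hP
    · exact h.choice_left
    · exact (ih hP).choice_right

/-! ### Coding of stacks and soundness of simulated statements. -/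

namespace StackCode

variable {K : Type} {Γ : K → Type} {Λ σ : Type} (E : StackCode Γ Λ σ)

/-- The number that represents a stack. -/
def code (k : K) : List (Γ k) → ℕ
  | [] => 0
  | a :: s => E.W * code k s + E.digit k a

/-- The numbers that represent all stacks. -/
noncomputable def codes (S : ∀ k, List (Γ k)) : ℕ → ℕ :=
  Function.extend E.idx (fun k => E.code k (S k)) 0

/-- The counter for the state `s`. -/
def stateCtr (s : Option Λ × σ) : ℕ := slot (2 * E.N + 6 + E.st s)

/-- All symbols on the stacks are in the alphabet. -/
def Good (S : ∀ k, List (Γ k)) : Prop := ∀ k, ∀ a ∈ S k, a ∈ E.alph k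

/-- All symbols pushed by the statement are in the alphabet. -/
def Allowed : TM2.Stmt Γ Λ σ → Prop
  | .push k f q => (∀ v, f v ∈ E.alph k) ∧ Allowed q
  | .peek _ _ q => Allowed q
  | .pop _ _ q => Allowed q
  | .load _ q => Allowed q
  | .branch _ q₁ q₂ => Allowed q₁ ∧ Allowed q₂
  | .goto _ => True
  | .halt => True

/-- The program that simulates a statement in the internal state `v`. -/
def stmtProg : TM2.Stmt Γ Λ σ → σ → CounterProgram
  | .push k f q, v => seq (pushCtr E.W (E.idx k) (E.digit k (f v))) (stmtProg q v)
  -- The top symbol is guessed, popped and pushed back. The internal state `v` is resolved in the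
  -- text of the program and needs no counter here.
  | .peek k f q, v => choiceList (seq (emptyCtr (E.idx k)) (stmtProg q (f v none)))
      ((E.alph k).map fun a => seq (popCtr E.W (E.idx k) (E.digit k a))
        (seq (pushCtr E.W (E.idx k) (E.digit k a)) (stmtProg q (f v (some a)))))
  | .pop k f q, v => choiceList (seq (emptyCtr (E.idx k)) (stmtProg q (f v none)))
      ((E.alph k).map fun a => seq (popCtr E.W (E.idx k) (E.digit k a))
        (stmtProg q (f v (some a))))
  | .load f q, v => stmtProg q (f v)
  | .branch p q₁ q₂, v => bif p v then stmtProg q₁ v else stmtProg q₂ v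
  | .goto f, v => inc (E.stateCtr (some (f v), v))
  | .halt, v => inc (E.stateCtr (none, v))

/-- The number of pushes in a statement. -/
def pushes : TM2.Stmt Γ Λ σ → ℕ
  | .push _ _ q => pushes q + 1
  | .peek _ _ q => pushes q
  | .pop _ _ q => pushes q
  | .load _ q => pushes q
  | .branch _ q₁ q₂ => pushes q₁ + pushes q₂
  | .goto _ => 0
  | .halt => 0

variable {E}

theorem code_lt {k : K} {s : List (Γ k)} (h : ∀ a ∈ s, a ∈ E.alph k) :
    E.code k s < E.W ^ s.length := by
  induction s with
  | nil => simp [code]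
  | cons a s ih =>
    have h₁ := ih fun b hb => h b (by simp [hb])
    have h₂ := E.digit_lt k a (h a (by simp))
    rw [code, List.length_cons, pow_succ]
    calc E.W * E.code k s + E.digit k a < E.W * E.code k s + E.W := by omega
      _ = (E.code k s + 1) * E.W := by ring
      _ ≤ _ := Nat.mul_le_mul_right _ h₁

theorem code_eq_zero {k : K} {s : List (Γ k)} (h : E.code k s = 0) : s = [] := by
  cases s with
  | nil => rfl
  | cons a s =>
    have := E.digit_pos k a
    simp [code] at h
    omega

/-- Uniqueness of the last digit in base `W`; digits are positive, so the empty stack, with code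
zero, is excluded. -/
theorem code_eq {k : K} {s : List (Γ k)} {a : Γ k} {q : ℕ} (hs : ∀ a ∈ s, a ∈ E.alph k)
    (ha : a ∈ E.alph k) (h : E.code k s = E.W * q + E.digit k a) :
    ∃ t, s = a :: t ∧ q = E.code k t := by
  cases s with
  | nil =>
    have := E.digit_pos k a
    simp [code] at h
    omega
  | cons b t =>
    have hb := hs b (by simp)
    have h₁ := E.digit_lt k a ha
    have h₂ := E.digit_lt k b hb
    rw [code] at h
    have hm := congrArg (· % E.W) h
    have hd := congrArg (· / E.W) h
    have hW : 0 < E.W := by omega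
    simp only [Nat.mul_add_mod, Nat.mod_eq_of_lt h₁, Nat.mod_eq_of_lt h₂] at hm
    simp only [Nat.mul_add_div hW, Nat.div_eq_of_lt h₁, Nat.div_eq_of_lt h₂, add_zero] at hd
    obtain rfl := E.digit_inj k b hb a ha hm
    exact ⟨t, rfl, hd.symm⟩

theorem codes_idx {S : ∀ k, List (Γ k)} {k : K} : E.codes S (E.idx k) = E.code k (S k) :=
  E.idx_inj.extend_apply _ _ _

theorem codes_update [DecidableEq K] {S : ∀ k, List (Γ k)} {k : K} {s : List (Γ k)} :
    E.codes (Function.update S k s) = Function.update (E.codes S) (E.idx k) (E.code k s) := by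
  funext n
  by_cases hn : ∃ j, E.idx j = n
  · obtain ⟨j, rfl⟩ := hn
    rw [codes_idx]
    by_cases hj : j = k
    · subst hj; simp
    · rw [Function.update_of_ne hj, Function.update_of_ne (E.idx_inj.ne hj), codes_idx]
  · rw [codes, Function.extend_apply' _ _ _ hn, Function.update_of_ne, codes,
      Function.extend_apply' _ _ _ hn]
    rintro rfl
    exact hn ⟨k, rfl⟩

theorem codes_le {S : ∀ k, List (Γ k)} {B : ℕ} (h : ∀ k, E.code k (S k) ≤ B) (n : ℕ) :
    E.codes S n ≤ B := by
  by_cases hn : ∃ j, E.idx j = n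
  · obtain ⟨j, rfl⟩ := hn
    rw [codes_idx]
    exact h j
  · rw [codes, Function.extend_apply' _ _ _ hn]
    exact Nat.zero_le _

theorem testFree_stmtProg (q : TM2.Stmt Γ Λ σ) : ∀ v, (E.stmtProg q v).TestFree := by
  induction q with
  | push k f q ih => exact fun v => ⟨testFree_push _ _ _, ih v⟩
  | peek k f q ih =>
    refine fun v => testFree_choiceList ⟨testFree_empty _, ih _⟩ fun P hP => ?_
    obtain ⟨a, -, rfl⟩ := List.mem_map.1 hP
    exact ⟨testFree_pop _ _ _, testFree_push _ _ _, ih _⟩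
  | pop k f q ih =>
    refine fun v => testFree_choiceList ⟨testFree_empty _, ih _⟩ fun P hP => ?_
    obtain ⟨a, -, rfl⟩ := List.mem_map.1 hP
    exact ⟨testFree_pop _ _ _, ih _⟩
  | load f q ih => exact fun v => ih _
  | branch p q₁ q₂ ih₁ ih₂ =>
    intro v
    rw [stmtProg]
    cases p v
    · exact ih₂ v
    · exact ih₁ v
  | goto f => exact fun _ => trivial
  | halt => exact fun _ => trivial

theorem stateCtr_ne {B : ℕ} (s : Option Λ × σ) :
    E.stateCtr s ≠ (stackBudget E.N B).c ∧ E.stateCtr s ≠ (stackBudget E.N B).d := by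
  simp only [stateCtr, stackBudget, ne_eq, slot_inj]; omega

theorem stateCtr_pairs_ne {B : ℕ} (s : Option Λ × σ) :
    ∀ p ∈ (stackBudget E.N B).pairs, p.1 ≠ E.stateCtr s ∧ p.2 ≠ E.stateCtr s := by
  rintro - ⟨t, -, ht, rfl⟩
  simp only [stateCtr, ne_eq, slot_inj]; omega

theorem mono_stmtProg {B : ℕ} (q : TM2.Stmt Γ Λ σ) :
    ∀ v, (stackBudget E.N B).Mono (E.stmtProg q v) := by
  induction q with
  | push k f q ih => exact fun v => (mono_push _ _ (E.idx_lt k)).seq (ih v)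
  | peek k f q ih =>
    refine fun v => Budget.mono_choiceList ((mono_empty (E.idx_lt k)).seq (ih _)) fun P hP => ?_
    obtain ⟨a, -, rfl⟩ := List.mem_map.1 hP
    exact (mono_pop _ _ (E.idx_lt k)).seq ((mono_push _ _ (E.idx_lt k)).seq (ih _))
  | pop k f q ih =>
    refine fun v => Budget.mono_choiceList ((mono_empty (E.idx_lt k)).seq (ih _)) fun P hP => ?_
    obtain ⟨a, -, rfl⟩ := List.mem_map.1 hP
    exact (mono_pop _ _ (E.idx_lt k)).seq (ih _)
  | load f q ih => exact fun v => ih _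
  | branch p q₁ q₂ ih₁ ih₂ =>
    intro v
    rw [stmtProg]
    cases p v
    · exact ih₂ v
    · exact ih₁ v
  | goto f => exact fun _ => Budget.mono_inc (stateCtr_ne _) (stateCtr_pairs_ne _)
  | halt => exact fun _ => Budget.mono_inc (stateCtr_ne _) (stateCtr_pairs_ne _)

theorem Good.update [DecidableEq K] {S : ∀ k, List (Γ k)} (h : E.Good S) {k : K}
    {s : List (Γ k)} (hs : ∀ a ∈ s, a ∈ E.alph k) : E.Good (Function.update S k s) := by
  intro j
  by_cases hj : j = k
  · subst hj; simpa using hs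
  · rw [Function.update_of_ne hj]; exact h j

theorem update_code_le [DecidableEq K] {B : ℕ} {S : ∀ k, List (Γ k)}
    (h : ∀ k, E.code k (S k) ≤ B) {k : K} {s : List (Γ k)} (hs : E.code k s ≤ B) :
    ∀ j, E.code j (Function.update S k s j) ≤ B := by
  intro j
  by_cases hj : j = k
  · subst hj; simpa using hs
  · rw [Function.update_of_ne hj]; exact h j

/-- The configuration with stacks `S` and further counters `r`. -/
noncomputable def conf (E : StackCode Γ Λ σ) (B : ℕ) (S : ∀ k, List (Γ k)) (r : Config) : Config :=
  stackState E.N B (E.codes S) 0 r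

theorem conf_add_state {B : ℕ} {S : ∀ k, List (Γ k)} {r m : Config} :
    E.conf B S (r + m) = E.conf B S r + m := by
  simp only [conf, stackState]; abel

theorem sound_emptyCtr {B : ℕ} {r : Config} (hr : Rest E.N B r) {S : ∀ k, List (Γ k)}
    (hS : ∀ k, E.code k (S k) ≤ B) (k : K) :
    (stackBudget E.N B).Sound (emptyCtr (E.idx k)) (E.conf B S r) fun β =>
      S k = [] ∧ β = E.conf B S r := by
  refine (sound_empty hr (E.idx_lt k) fun j _ => codes_le hS j).mono ?_
  rintro β - - ⟨h, rfl⟩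
  rw [codes_idx] at h
  exact ⟨code_eq_zero h, rfl⟩

theorem rest_inv_clean {B : ℕ} {r : Config} (hr : Rest E.N B r) {S : ∀ k, List (Γ k)}
    (hS : ∀ k, E.code k (S k) ≤ B) : (stackBudget E.N B).Inv (E.conf B S r) ∧
      (stackBudget E.N B).Clean (E.conf B S r) :=
  ⟨inv_stackState hr (fun j _ => codes_le hS j) (Nat.zero_le _), clean_stackState hr⟩

/-- What a simulation of a statement has to produce. -/
def Outcome (E : StackCode Γ Λ σ) (B : ℕ) (r : Config) (c : TM2.Cfg Γ Λ σ) (β : Config) : Prop :=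
  E.Good c.stk ∧ (∀ k, E.code k (c.stk k) ≤ B) ∧
    β = E.conf B c.stk (r + Finsupp.single (E.stateCtr (c.l, c.var)) 1)

variable [DecidableEq K]

theorem sound_pushCtr {B : ℕ} {r : Config} (hr : Rest E.N B r) {S : ∀ k, List (Γ k)}
    (hS : ∀ k, E.code k (S k) ≤ B) (k : K) (a : Γ k) :
    (stackBudget E.N B).Sound (pushCtr E.W (E.idx k) (E.digit k a)) (E.conf B S r) fun β =>
      (∀ j, E.code j (Function.update S k (a :: S k) j) ≤ B) ∧
        β = E.conf B (Function.update S k (a :: S k)) r := by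
  refine (sound_push hr (E.idx_lt k) (fun j _ => codes_le hS j) E.W (E.digit k a)).mono ?_
  rintro β - - ⟨h, rfl⟩
  rw [codes_idx] at h ⊢
  refine ⟨update_code_le hS h, ?_⟩
  rw [conf, codes_update, code]

theorem sound_popCtr {B : ℕ} {r : Config} (hr : Rest E.N B r) {S : ∀ k, List (Γ k)}
    (hS : ∀ k, E.code k (S k) ≤ B) (hG : E.Good S) (k : K) {a : Γ k} (ha : a ∈ E.alph k) :
    (stackBudget E.N B).Sound (popCtr E.W (E.idx k) (E.digit k a)) (E.conf B S r) fun β =>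
      (S k).head? = some a ∧ (∀ j, E.code j (Function.update S k (S k).tail j) ≤ B) ∧
        β = E.conf B (Function.update S k (S k).tail) r := by
  refine (sound_pop hr (E.idx_lt k) (fun j _ => codes_le hS j) E.W (E.digit k a)).mono ?_
  rintro β - - ⟨q, hq, h, rfl⟩
  rw [codes_idx] at h
  obtain ⟨t, ht, rfl⟩ := code_eq (hG k) ha h
  rw [ht]
  refine ⟨rfl, update_code_le hS hq, ?_⟩
  rw [conf, codes_update, List.tail_cons]

/-- Wrong guesses cannot survive an accurate run: an emptiness guess forces code zero, and a popped
digit forces the top symbol. The only branch left is the one taken by the machine. -/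
theorem sound_stmtProg {B : ℕ} {r : Config} (hr : Rest E.N B r) (q : TM2.Stmt Γ Λ σ)
    (hq : E.Allowed q) : ∀ (v : σ) {S : ∀ k, List (Γ k)}, E.Good S →
    (∀ k, E.code k (S k) ≤ B) →
    (stackBudget E.N B).Sound (E.stmtProg q v) (E.conf B S r)
      (E.Outcome B r (TM2.stepAux q v S)) := by
  have hinc : ∀ s {S : ∀ k, List (Γ k)}, (∀ k, E.code k (S k) ≤ B) →
      (stackBudget E.N B).Sound (inc (E.stateCtr s)) (E.conf B S r)
        (· = E.conf B S (r + Finsupp.single (E.stateCtr s) 1)) := by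
    intro s S hS
    rw [conf_add_state]
    exact Budget.sound_inc (stateCtr_ne _) (stateCtr_pairs_ne _) (rest_inv_clean hr hS).1
      (rest_inv_clean hr hS).2
  induction q with
  | push k f q ih =>
    intro v S hG hS
    refine (sound_pushCtr hr hS k (f v)).seq' (mono_stmtProg q v) ?_
    rintro γ - - ⟨h, rfl⟩
    refine ih hq.2 v (hG.update ?_) h
    simpa using ⟨hq.1 v, hG k⟩
  | peek k f q ih =>
    intro v S hG hS
    refine Budget.sound_choiceList ?_ ?_
    · refine (sound_emptyCtr hr hS k).seq' (mono_stmtProg q _) ?_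
      rintro γ - - ⟨h, rfl⟩
      have := ih hq (f v none) hG hS
      rwa [TM2.stepAux, h]
    · intro P hP
      obtain ⟨a, ha, rfl⟩ := List.mem_map.1 hP
      refine (sound_popCtr hr hS hG k ha).seq' ((mono_push _ _ (E.idx_lt k)).seq
        (mono_stmtProg q _)) ?_
      rintro γ - - ⟨h₁, h₂, rfl⟩
      refine (sound_pushCtr hr h₂ k a).seq' (mono_stmtProg q _) ?_
      rintro γ - - ⟨h₃, rfl⟩
      -- Popping and pushing back the same symbol restores the stacks.
      have e : Function.update (Function.update S k (S k).tail) k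
          (a :: Function.update S k (S k).tail k) = S := by
        rw [Function.update_self, Function.update_idem, List.cons_head?_tail h₁,
          Function.update_eq_self]
      rw [e, TM2.stepAux, h₁]
      exact ih hq _ hG hS
  | pop k f q ih =>
    intro v S hG hS
    refine Budget.sound_choiceList ?_ ?_
    · refine (sound_emptyCtr hr hS k).seq' (mono_stmtProg q _) ?_
      rintro γ - - ⟨h, rfl⟩
      have := ih hq (f v none) hG hS
      rw [TM2.stepAux, h, List.tail_nil, ← h, Function.update_eq_self, h]
      exact this
    · intro P hP
      obtain ⟨a, ha, rfl⟩ := List.mem_map.1 hP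
      refine (sound_popCtr hr hS hG k ha).seq' (mono_stmtProg q _) ?_
      rintro γ - - ⟨h₁, h₂, rfl⟩
      rw [TM2.stepAux, h₁]
      exact ih hq _ (hG.update fun b hb => hG k b (List.mem_of_mem_tail hb)) h₂
  | load f q ih => exact fun v S hG hS => ih hq (f v) hG hS
  | branch p q₁ q₂ ih₁ ih₂ =>
    intro v S hG hS
    rw [TM2.stepAux, stmtProg]
    cases p v
    · exact ih₂ hq.2 v hG hS
    · exact ih₁ hq.1 v hG hS
  | goto f => exact fun v S hG hS => (hinc _ hS).mono fun β _ _ hβ => ⟨hG, hS, hβ⟩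
  | halt => exact fun v S hG hS => (hinc _ hS).mono fun β _ _ hβ => ⟨hG, hS, hβ⟩

end StackCode

/-! ### Completeness of simulated statements. -/

namespace StackCode

variable {K : Type} {Γ : K → Type} {Λ σ : Type} {E : StackCode Γ Λ σ}

theorem code_le {k : K} {s : List (Γ k)} {L B : ℕ} (h : ∀ a ∈ s, a ∈ E.alph k)
    (hL : s.length ≤ L) (hB : E.W ^ L ≤ B) : E.code k s ≤ B :=
  ((code_lt h).le.trans (Nat.pow_le_pow_right E.W_pos hL)).trans hB

variable [DecidableEq K]

theorem good_stepAux {q : TM2.Stmt Γ Λ σ} (hq : E.Allowed q) : ∀ {v : σ} {S : ∀ k, List (Γ k)},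
    E.Good S → E.Good (TM2.stepAux q v S).stk := by
  induction q with
  | push k f q ih =>
    exact fun {v S} hG => ih hq.2 (hG.update (by simpa using ⟨hq.1 v, hG k⟩))
  | peek k f q ih => exact fun hG => ih hq hG
  | pop k f q ih =>
    exact fun {v S} hG => ih hq (hG.update fun b hb => hG k b (List.mem_of_mem_tail hb))
  | load f q ih => exact fun hG => ih hq hG
  | branch p q₁ q₂ ih₁ ih₂ =>
    intro v S hG
    rw [TM2.stepAux]
    cases p v
    · exact ih₂ hq.2 hG
    · exact ih₁ hq.1 hG
  | goto f => exact fun hG => hG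
  | halt => exact fun hG => hG

theorem length_stepAux {q : TM2.Stmt Γ Λ σ} : ∀ {v : σ} {S : ∀ k, List (Γ k)} {L : ℕ},
    (∀ k, (S k).length ≤ L) → ∀ k, ((TM2.stepAux q v S).stk k).length ≤ L + pushes q := by
  have hup : ∀ {S : ∀ k, List (Γ k)} {k : K} {s : List (Γ k)} {L : ℕ},
      (∀ k, (S k).length ≤ L) → s.length ≤ L → ∀ j, (Function.update S k s j).length ≤ L := by
    intro S k s L hS hs j
    by_cases hj : j = k
    · subst hj; simpa using hs
    · rw [Function.update_of_ne hj]; exact hS j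
  induction q with
  | push k f q ih =>
    intro v S L hL j
    have := ih (v := v) (S := Function.update S k (f v :: S k)) (L := L + 1)
      (hup (fun k => (hL k).trans (by omega)) (by simpa using hL k)) j
    rw [TM2.stepAux, pushes]
    omega
  | peek k f q ih => exact fun hL => ih hL
  | pop k f q ih =>
    exact fun {v S L} hL => ih (hup hL (by have := hL k; simp; omega))
  | load f q ih => exact fun hL => ih hL
  | branch p q₁ q₂ ih₁ ih₂ =>
    intro v S L hL j
    rw [TM2.stepAux, pushes]
    cases p v
    · exact (ih₂ hL j).trans (by omega)
    · exact (ih₁ hL j).trans (by omega)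
  | goto f => exact fun hL => hL
  | halt => exact fun hL => hL

theorem reach_pushCtr {B : ℕ} {r : Config} (hr : Rest E.N B r) {S : ∀ k, List (Γ k)}
    (hS : ∀ k, E.code k (S k) ≤ B) {k : K} {a : Γ k} (ha : E.code k (a :: S k) ≤ B) :
    (stackBudget E.N B).Reach (pushCtr E.W (E.idx k) (E.digit k a)) (E.conf B S r)
      (E.conf B (Function.update S k (a :: S k)) r) := by
  have := reach_push hr (E.idx_lt k) (fun j _ => codes_le hS j) (W := E.W) (a := E.digit k a)
    (by rw [codes_idx]; exact ha)
  rw [codes_idx] at this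
  rwa [conf, conf, codes_update, code]

theorem reach_popCtr {B : ℕ} {r : Config} (hr : Rest E.N B r) {S : ∀ k, List (Γ k)}
    (hS : ∀ k, E.code k (S k) ≤ B) {k : K} {a : Γ k} {t : List (Γ k)} (hk : S k = a :: t) :
    (stackBudget E.N B).Reach (popCtr E.W (E.idx k) (E.digit k a)) (E.conf B S r)
      (E.conf B (Function.update S k t) r) := by
  have h := hS k
  rw [hk, code] at h
  have := E.W_pos
  have := reach_pop hr (E.idx_lt k) (fun j _ => codes_le hS j) (W := E.W) (a := E.digit k a)
    (q := E.code k t) (by nlinarith) (by rw [codes_idx, hk, code])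
  rwa [← codes_update] at this

/-- No stack becomes longer than `L + pushes q` during the statement, so `W ^ (L + pushes q) ≤ B`
leaves room for every code that is met. -/
theorem reach_stmtProg {B : ℕ} {r : Config} (hr : Rest E.N B r) (q : TM2.Stmt Γ Λ σ)
    (hq : E.Allowed q) : ∀ (v : σ) {S : ∀ k, List (Γ k)} {L : ℕ}, E.Good S →
    (∀ k, (S k).length ≤ L) → E.W ^ (L + pushes q) ≤ B →
    (stackBudget E.N B).Reach (E.stmtProg q v) (E.conf B S r)
      (E.conf B (TM2.stepAux q v S).stk (r + Finsupp.single (E.stateCtr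
        ((TM2.stepAux q v S).l, (TM2.stepAux q v S).var)) 1)) := by
  have hinc : ∀ s {S : ∀ k, List (Γ k)}, (stackBudget E.N B).Reach (inc (E.stateCtr s))
      (E.conf B S r) (E.conf B S (r + Finsupp.single (E.stateCtr s) 1)) := fun s S =>
    Budget.Reach.of_step (step_inc_iff.2 conf_add_state)
  have hle : ∀ {S : ∀ k, List (Γ k)} {L p : ℕ}, E.Good S → (∀ k, (S k).length ≤ L) →
      E.W ^ (L + p) ≤ B → ∀ k, E.code k (S k) ≤ B := fun hG hL hB k =>
    code_le (hG k) ((hL k).trans (Nat.le_add_right _ _)) hB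
  induction q with
  | push k f q ih =>
    intro v S L hG hL hB
    rw [pushes] at hB
    have hG' : E.Good (Function.update S k (f v :: S k)) :=
      hG.update (by simpa using ⟨hq.1 v, hG k⟩)
    have hL' : ∀ j, (Function.update S k (f v :: S k) j).length ≤ L + 1 := by
      intro j
      by_cases hj : j = k
      · subst hj; simpa using hL j
      · rw [Function.update_of_ne hj]; exact (hL j).trans (by omega)
    have hB' : E.W ^ (L + 1 + pushes q) ≤ B := by
      rwa [show L + 1 + pushes q = L + (pushes q + 1) by omega]
    refine (reach_pushCtr hr (hle hG hL hB) ?_).seq (testFree_push _ _ _)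
      (ih hq.2 v hG' hL' hB')
    have := hle hG' hL' hB' k
    rwa [Function.update_self] at this
  | peek k f q ih =>
    intro v S L hG hL hB
    have hS := hle hG hL hB
    cases hk : S k with
    | nil =>
      refine Budget.reach_choiceList_head ((reach_empty hr (E.idx_lt k) ?_).seq
        (testFree_empty _) ?_)
      · rw [codes_idx, hk]; rfl
      · have := ih hq (f v none) hG hL hB
        rwa [TM2.stepAux, hk]
    | cons a t =>
      have ha : a ∈ E.alph k := hG k a (by simp [hk])
      refine Budget.reach_choiceList_mem (List.mem_map.2 ⟨a, ha, rfl⟩)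
        ((reach_popCtr hr hS hk).seq (testFree_pop _ _ _) (Budget.Reach.seq (γ := E.conf B S r)
          (testFree_push _ _ _) ?_ ?_))
      · have h := hS k
        rw [hk] at h
        have ht : E.code k t ≤ B := by
          have := E.W_pos
          rw [code] at h
          nlinarith
        have := reach_pushCtr (S := Function.update S k t) hr (update_code_le hS ht)
          (k := k) (a := a) (by rwa [Function.update_self])
        rwa [Function.update_self, Function.update_idem, ← hk, Function.update_eq_self] at this
      · have := ih hq (f v (some a)) hG hL hB
        rwa [TM2.stepAux, hk]
  | pop k f q ih =>
    intro v S L hG hL hB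
    have hS := hle hG hL hB
    cases hk : S k with
    | nil =>
      refine Budget.reach_choiceList_head ((reach_empty hr (E.idx_lt k) ?_).seq
        (testFree_empty _) ?_)
      · rw [codes_idx, hk]; rfl
      · have := ih hq (f v none) hG hL hB
        rw [TM2.stepAux, hk, List.tail_nil, ← hk, Function.update_eq_self, hk]
        exact this
    | cons a t =>
      have ha : a ∈ E.alph k := hG k a (by simp [hk])
      refine Budget.reach_choiceList_mem (List.mem_map.2 ⟨a, ha, rfl⟩)
        ((reach_popCtr hr hS hk).seq (testFree_pop _ _ _) ?_)
      have hG' : E.Good (Function.update S k t) :=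
        hG.update fun b hb => hG k b (by simp [hk, hb])
      have hL' : ∀ j, (Function.update S k t j).length ≤ L := by
        intro j
        by_cases hj : j = k
        · subst hj
          have := hL j
          simp [hk] at this ⊢
          omega
        · rw [Function.update_of_ne hj]; exact hL j
      have := ih hq (f v (some a)) hG' hL' hB
      rw [TM2.stepAux, hk]
      exact this
  | load f q ih => exact fun v S L hG hL hB => ih hq (f v) hG hL hB
  | branch p q₁ q₂ ih₁ ih₂ =>
    intro v S L hG hL hB
    rw [pushes] at hB
    rw [TM2.stepAux, stmtProg]
    cases p v
    · exact ih₂ hq.2 v hG hL ((Nat.pow_le_pow_right E.W_pos (by omega)).trans hB)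
    · exact ih₁ hq.1 v hG hL ((Nat.pow_le_pow_right E.W_pos (by omega)).trans hB)
  | goto f => exact fun v S L hG hL hB => hinc _
  | halt => exact fun v S L hG hL hB => hinc _

end StackCode

/-- Decrease the given counters arbitrarily. -/
def clearProg (x : ℕ) (l : List ℕ) : CounterProgram := loop (choiceList (dec x) (l.map dec))

theorem testFree_clearProg (x : ℕ) (l : List ℕ) : (clearProg x l).TestFree := by
  refine testFree_choiceList (l := l.map dec) (M := dec x) trivial fun P hP => ?_
  obtain ⟨y, -, rfl⟩ := List.mem_map.1 hP
  trivial

theorem step_choiceList_mem {M P : CounterProgram} {l : List CounterProgram} {α β : Config}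
    (hP : P ∈ M :: l) (h : P.Step α β) : (choiceList M l).Step α β := by
  induction l with
  | nil => rw [List.mem_singleton.1 hP] at h; exact h
  | cons Q l ih =>
    by_cases hQ : P = Q
    · subst hQ; exact Or.inl h
    · exact Or.inr (ih (by simpa [hQ] using hP))

theorem step_clearProg {x : ℕ} {l : List ℕ} : ∀ {α : Config}, (∀ y, y ∉ x :: l → α y = 0) →
    (clearProg x l).Step α 0 := by
  suffices H : ∀ n, ∀ α : Config, α.degree = n → (∀ y, y ∉ x :: l → α y = 0) →
      (clearProg x l).Step α 0 from fun {α} h => H _ α rfl h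
  intro n
  induction n with
  | zero =>
    intro α hα _
    rw [(Finsupp.degree_eq_zero_iff α).1 hα]
    exact ReflTransGen.refl
  | succ n ih =>
    intro α hα h
    obtain ⟨y, hy⟩ : ∃ y, α y ≠ 0 := by
      by_contra! h0
      rw [show α = 0 from Finsupp.ext h0, map_zero] at hα
      omega
    obtain ⟨β, rfl⟩ : ∃ β, α = β + Finsupp.single y 1 :=
      exists_add_single_of_le (Nat.one_le_iff_ne_zero.2 hy)
    have hmem : y ∈ x :: l := by
      by_contra h'
      exact hy (h y h')
    rw [map_add, Finsupp.degree_single] at hα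
    refine ReflTransGen.head (b := β) (step_choiceList_mem (P := dec y) ?_ (step_dec_iff'.2 rfl))
      (ih β (by omega) fun w hw => ?_)
    · rcases List.mem_cons.1 hmem with rfl | hm
      · simp
      · exact List.mem_cons_of_mem _ (List.mem_map.2 ⟨y, hm, rfl⟩)
    · have := h w hw
      simp at this
      exact this.1

/-! ### Initialization, loading of the input and the main program. -/

namespace StackCode

variable {K : Type} {Γ : K → Type} {Λ σ : Type} (E : StackCode Γ Λ σ)

/-- The partners that are initialized to the bound. -/
def partners : List ℕ := slot 5 :: (List.range E.N).map costackCtr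

/-- Initialize the partners. -/
def setupProg : CounterProgram :=
  drain (slot 2) (slot 3) [slot 0] (slot 1 :: E.partners) (slot 0) (slot 1)

/-- Put a word on the stack `k`. -/
def loadProg (k : K) : List (Γ k) → CounterProgram
  | [] => E.setupProg
  | a :: w => seq (loadProg k w) (pushCtr E.W (E.idx k) (E.digit k a))

/-- One step of the machine. -/
def stepProg (m : Λ → TM2.Stmt Γ Λ σ) (p : Λ × σ) : CounterProgram :=
  seq (dec (E.stateCtr (some p.1, p.2))) (E.stmtProg (m p.1) p.2)

/-- Run the machine, check that it halts with the symbol `a` on the stack `k`, and clear the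
counters. -/
def mainProg (m : Λ → TM2.Stmt Γ Λ σ) (l₀ : Λ) (v₀ : σ) (ps : List (Λ × σ)) (k : K) (a : Γ k) :
    CounterProgram :=
  seq (inc (E.stateCtr (some l₀, v₀)))
    (seq (loop (choiceList (E.stepProg m (l₀, v₀)) (ps.map (E.stepProg m))))
      (seq (dec (E.stateCtr (none, v₀)))
        (seq (block (List.replicate (E.digit k a) (stackCtr (E.idx k))) [])
          (clearProg (slot 1) E.partners))))

variable {E} {B : ℕ}

theorem nodup_partners : (slot 1 :: E.partners).Nodup := by
  rw [partners, List.nodup_cons, List.nodup_cons]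
  refine ⟨?_, ?_, ?_⟩
  · simp only [List.mem_cons, List.mem_map, slot_inj, costackCtr]
    rintro (h | ⟨k, -, h⟩) <;> omega
  · simp only [List.mem_map, slot_inj, costackCtr]
    rintro ⟨k, -, h⟩
    omega
  · refine List.Nodup.map (fun i j h => ?_) List.nodup_range
    simp only [costackCtr, slot_inj] at h
    omega

theorem mem_partners {x : ℕ} : x ∈ slot 1 :: E.partners ↔
    x = slot 1 ∨ x = slot 5 ∨ ∃ k < E.N, x = costackCtr k := by
  simp [partners, eq_comm]

theorem slot_notMem_partners {s : ℕ} (h : s % 2 = 0) : slot s ∉ slot 1 :: E.partners := by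
  rw [mem_partners]
  simp only [slot_inj, costackCtr]
  rintro (h' | h' | ⟨k, -, h'⟩) <;> omega

/-- The counters besides the stacks. -/
noncomputable def base (B : ℕ) : Config := Finsupp.single (slot 1) B

theorem rest_base (N : ℕ) : Rest N B (base B) := by
  constructor
  · intro s h₁ _
    rw [base, Finsupp.single_eq_of_ne]
    simp only [ne_eq, slot_inj]; omega
  · simp [base, slot_inj]

theorem base_stateCtr (s : Option Λ × σ) : base B (E.stateCtr s) = 0 := by
  rw [base, Finsupp.single_eq_of_ne]
  simp only [stateCtr, ne_eq, slot_inj]; omega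

theorem conf_stateCtr {S : ∀ k, List (Γ k)} {r : Config} (s : Option Λ × σ) :
    E.conf B S r (E.stateCtr s) = r (E.stateCtr s) := by
  have h : stackPart E.N B (E.codes S) (E.stateCtr s) = 0 := by
    refine stackPart_of_ne fun k hk => ?_
    simp only [stateCtr, stackCtr, costackCtr, ne_eq, slot_inj]
    omega
  rw [conf, stackState, Finsupp.add_apply, Finsupp.add_apply, h, Finsupp.add_apply,
    Finsupp.single_eq_of_ne, Finsupp.single_eq_of_ne]
  · simp
  all_goals simp only [stateCtr, ne_eq, slot_inj]; omega

theorem codes_nil : E.codes (fun _ => []) = 0 := by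
  funext n
  by_cases hn : ∃ j, E.idx j = n
  · obtain ⟨j, rfl⟩ := hn
    rw [codes_idx]; rfl
  · rw [codes, Function.extend_apply' _ _ _ hn]

theorem avoids_setup : (stackBudget E.N B).Avoids [slot 0] (slot 1 :: E.partners) := by
  refine ⟨⟨?_, ?_⟩, slot_notMem_partners (by rfl), ?_⟩
  · simp [stackBudget, slot_inj]
  · simp [stackBudget, slot_inj]
  · rw [mem_partners]
    simp only [stackBudget, slot_inj, costackCtr]
    rintro (h' | h' | ⟨k, -, h'⟩) <;> omega

/-- A single loop copies the bound to all partners at once; the test that `slot 0` is exhausted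
forces exactly `B` rounds. -/
theorem exact_setupProg : (stackBudget E.N B).Exact E.setupProg (Finsupp.single (slot 0) B)
    (E.conf B (fun _ => []) (base B)) := by
  have hd : [slot 0].Disjoint (slot 1 :: E.partners) := by
    intro x hx
    rw [List.mem_singleton.1 hx]
    exact slot_notMem_partners (by rfl)
  have hp : (stackBudget E.N B).Paired (slot 0) (slot 1) :=
    Or.inl ⟨0, by omega, by omega, rfl⟩
  refine Budget.Avoids.exact_drain' (K := stackBudget E.N B) avoids_setup hd hp ?_ ?_
    (by simp) (slot_notMem_partners (by rfl)) ?_ ?_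
  · simp [Budget.Clean, stackBudget, slot_inj]
  -- The loop is not balanced. The partners are distinct, so each receives at most `n ≤ B` units,
  -- while its mate stays at zero; for `t = 0` the gain of `slot 1` is the loss of `slot 0`.
  · rintro n β hn - ⟨t, ht, -, rfl⟩
    have h₁ := hn (slot (2 * t))
    have h₂ := hn (slot (2 * t + 1))
    have h₃ : (slot 1 :: E.partners).count (slot (2 * t + 1)) ≤ 1 :=
      List.nodup_iff_count_le_one.1 nodup_partners _
    have h₄ : (slot 1 :: E.partners).count (slot (2 * t)) = 0 :=
      List.count_eq_zero.2 (slot_notMem_partners (by omega))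
    have h₅ : [slot 0].count (slot (2 * t + 1)) = 0 := by
      simp [List.count_cons, slot_inj]
    have h₆ := Nat.mul_le_mul_left n h₃
    have h₇ := (hn (slot 0)).1
    simp at h₇
    rw [h₅, Finsupp.single_eq_of_ne (by simp [slot_inj])] at h₂
    rw [h₄] at h₁
    change β (slot (2 * t)) + β (slot (2 * t + 1)) ≤ B
    rcases Nat.eq_zero_or_pos t with rfl | hpos
    · simp only [mul_zero, zero_add] at h₁ h₂ h₆ ⊢
      simp at h₁
      omega
    · rw [Finsupp.single_eq_of_ne (by simp [slot_inj]; omega)] at h₁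
      omega
  · rw [Finsupp.single_eq_same]
    refine Xfer.of_list (slot 0 :: slot 1 :: E.partners) ?_ ?_ (by simp) (by simp)
    · intro x hx
      rcases List.mem_cons.1 hx with rfl | hx
      · rw [List.count_eq_zero.2 (slot_notMem_partners (by rfl))]
        simp [conf, stackState, stackPart_slot_of_lt, base, slot_inj]
      · have hx0 : x ≠ slot 0 := fun h => slot_notMem_partners (by rfl) (h ▸ hx)
        rw [List.count_eq_one_of_mem nodup_partners hx, Finsupp.single_eq_of_ne hx0]
        simp only [List.count_cons, List.count_nil, beq_iff_eq, hx0.symm]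
        rcases mem_partners.1 hx with rfl | rfl | ⟨k, hk, rfl⟩
        · simp [conf, stackState, stackPart_slot_of_lt, base, slot_inj]
        · simp [conf, stackState_five (rest_base E.N)]
        · simp [conf, stackState_costackCtr (rest_base E.N) hk, codes_nil]
    · intro x hx
      simp only [List.mem_cons, not_or] at hx
      obtain ⟨h₀, h₁, h₂⟩ := hx
      have h₃ : x ∉ slot 1 :: E.partners := by simp [h₁, h₂]
      rw [mem_partners] at h₃
      push Not at h₃
      obtain ⟨-, h₅, h₆⟩ := h₃
      rw [Finsupp.single_eq_of_ne h₀]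
      have : stackPart E.N B (E.codes fun _ => []) x = 0 := by
        by_cases hk : ∃ k < E.N, x = stackCtr k
        · obtain ⟨k, hk, rfl⟩ := hk
          rw [stackPart_stackCtr hk, codes_nil]; rfl
        · push Not at hk
          exact stackPart_of_ne fun k hk' => ⟨hk k hk', h₆ k hk'⟩
      simp [conf, stackState, this, base, h₁, h₅]
  · simp [conf, stackState, stackPart_slot_of_lt, base, slot_inj, stackBudget]

theorem testFree_loadProg {k : K} : ∀ w : List (Γ k), (E.loadProg k w).TestFree
  | [] => testFree_drain _ _ _ _ _ _
  | _ :: w => ⟨testFree_loadProg w, testFree_push _ _ _⟩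

variable [DecidableEq K]

theorem sound_loadProg {k : K} : ∀ {w : List (Γ k)}, (∀ a ∈ w, a ∈ E.alph k) →
    (stackBudget E.N B).Sound (E.loadProg k w) (Finsupp.single (slot 0) B) fun β =>
      (∀ j, E.code j (Function.update (fun _ => []) k w j) ≤ B) ∧
        β = E.conf B (Function.update (fun _ => []) k w) (base B) := by
  intro w
  induction w with
  | nil =>
    intro _
    refine exact_setupProg.sound.mono ?_
    rintro β - - rfl
    rw [show Function.update (fun j => ([] : List (Γ j))) k [] = fun _ => [] from
      Function.update_eq_self k _]
    exact ⟨fun j => Nat.zero_le _, rfl⟩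
  | cons a w ih =>
    intro hw
    refine (ih fun b hb => hw b (by simp [hb])).seq' (mono_push _ _ (E.idx_lt k)) ?_
    rintro γ - - ⟨hS, rfl⟩
    have := sound_pushCtr (rest_base E.N) hS k a
    rwa [Function.update_self, Function.update_idem] at this

theorem reach_loadProg {k : K} : ∀ {w : List (Γ k)}, (∀ a ∈ w, a ∈ E.alph k) →
    E.W ^ w.length ≤ B → (stackBudget E.N B).Reach (E.loadProg k w) (Finsupp.single (slot 0) B)
      (E.conf B (Function.update (fun _ => []) k w) (base B)) := by
  intro w
  induction w with
  | nil =>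
    intro _ _
    rw [show Function.update (fun j => ([] : List (Γ j))) k [] = fun _ => [] from
      Function.update_eq_self k _]
    exact exact_setupProg.reach
  | cons a w ih =>
    intro hw hB
    have hB' : E.W ^ w.length ≤ B := (Nat.pow_le_pow_right E.W_pos (by simp)).trans hB
    have hw' : ∀ b ∈ w, b ∈ E.alph k := fun b hb => hw b (by simp [hb])
    refine (ih hw' hB').seq (testFree_loadProg w) ?_
    have := reach_pushCtr (B := B) (r := base B) (S := Function.update (fun _ => []) k w) (k := k)
      (a := a) (rest_base E.N) (update_code_le (fun _ => Nat.zero_le _) (code_le hw' le_rfl hB'))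
      (by rw [Function.update_self]; exact code_le hw le_rfl hB)
    rwa [Function.update_self, Function.update_idem] at this

end StackCode

/-! ### Runs of the machine. -/

namespace StackCode

variable {K : Type} {Γ : K → Type} {Λ σ : Type} {E : StackCode Γ Λ σ} {B : ℕ}

theorem mono_stepProg (m : Λ → TM2.Stmt Γ Λ σ) (p : Λ × σ) :
    (stackBudget E.N B).Mono (E.stepProg m p) :=
  (Budget.mono_dec (stateCtr_ne _)).seq (mono_stmtProg _ _)

theorem testFree_stepProg (m : Λ → TM2.Stmt Γ Λ σ) (p : Λ × σ) : (E.stepProg m p).TestFree :=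
  ⟨trivial, testFree_stmtProg _ _⟩

theorem mono_runBody (m : Λ → TM2.Stmt Γ Λ σ) (p : Λ × σ) (ps : List (Λ × σ)) :
    (stackBudget E.N B).Mono (choiceList (E.stepProg m p) (ps.map (E.stepProg m))) :=
  Budget.mono_choiceList (mono_stepProg m p) fun P hP => by
    obtain ⟨q, -, rfl⟩ := List.mem_map.1 hP
    exact mono_stepProg m q

theorem testFree_runBody (m : Λ → TM2.Stmt Γ Λ σ) (p : Λ × σ) (ps : List (Λ × σ)) :
    (choiceList (E.stepProg m p) (ps.map (E.stepProg m))).TestFree :=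
  testFree_choiceList (testFree_stepProg m p) fun P hP => by
    obtain ⟨q, -, rfl⟩ := List.mem_map.1 hP
    exact testFree_stepProg m q

theorem testFree_mainProg (m : Λ → TM2.Stmt Γ Λ σ) (l₀ : Λ) (v₀ : σ) (ps : List (Λ × σ)) (k : K)
    (a : Γ k) : (E.mainProg m l₀ v₀ ps k a).TestFree :=
  ⟨trivial, testFree_runBody m _ ps, trivial, testFree_block _ _, testFree_clearProg _ _⟩

theorem partners_ne {x : ℕ} (hx : x ∈ slot 1 :: E.partners) : (x ≠ (stackBudget E.N B).c ∧
    x ≠ (stackBudget E.N B).d) ∧ ∀ i, stackCtr i ≠ x := by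
  rcases mem_partners.1 hx with rfl | rfl | ⟨j, -, rfl⟩ <;>
  · simp only [stackBudget, stackCtr, costackCtr, ne_eq, slot_inj]
    exact ⟨by omega, fun i => by omega⟩

theorem mono_clearPartners : (stackBudget E.N B).Mono
    (choiceList (dec (slot 1)) (E.partners.map dec)) := by
  refine Budget.mono_choiceList (Budget.mono_dec (partners_ne (by simp)).1) fun P hP => ?_
  obtain ⟨x, hx, rfl⟩ := List.mem_map.1 hP
  exact Budget.mono_dec (partners_ne (by simp [hx])).1

theorem mono_outputBlock (k : K) (a : Γ k) : (stackBudget E.N B).Mono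
    (block (List.replicate (E.digit k a) (stackCtr (E.idx k))) []) :=
  Budget.Avoids.mono_block (avoids_of_subset (k := E.idx k)
    (replicate_subset_of_mem (by simp)) (by simp)) (fun p _ => by simp)

theorem mono_mainProg (m : Λ → TM2.Stmt Γ Λ σ) (l₀ : Λ) (v₀ : σ) (ps : List (Λ × σ)) (k : K)
    (a : Γ k) : (stackBudget E.N B).Mono (E.mainProg m l₀ v₀ ps k a) :=
  (Budget.mono_inc (stateCtr_ne _) (stateCtr_pairs_ne _)).seq ((mono_runBody m _ ps).loop.seq
    ((Budget.mono_dec (stateCtr_ne _)).seq ((mono_outputBlock k a).seq mono_clearPartners.loop)))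

/-- The configuration that represents a machine configuration. -/
noncomputable def cfgConf (E : StackCode Γ Λ σ) (B : ℕ) (c : TM2.Cfg Γ Λ σ) : Config :=
  E.conf B c.stk (base B + Finsupp.single (E.stateCtr (c.l, c.var)) 1)

theorem rest_add_state {r : Config} (hr : Rest E.N B r) (s : Option Λ × σ) :
    Rest E.N B (r + Finsupp.single (E.stateCtr s) 1) := by
  have h : ∀ t, t < 2 * E.N + 6 →
      (r + Finsupp.single (E.stateCtr s) 1 : Config) (slot t) = r (slot t) := by
    intro t ht
    rw [Finsupp.add_apply, Finsupp.single_eq_of_ne, add_zero]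
    simp only [stateCtr, ne_eq, slot_inj]; omega
  refine ⟨fun t h₁ h₂ => by rw [h t h₂]; exact hr.1 t h₁ h₂, ?_⟩
  rw [h 0 (by omega), h 1 (by omega)]
  exact hr.2

/-- Exactly one state counter is nonzero, so a decrement on the counter of `s` is possible only in
the state `s`. No zero test is needed for control states. -/
theorem sound_dec_state {c : TM2.Cfg Γ Λ σ} (hS : ∀ k, E.code k (c.stk k) ≤ B)
    (s : Option Λ × σ) : (stackBudget E.N B).Sound (dec (E.stateCtr s)) (E.cfgConf B c) fun β =>
      (c.l, c.var) = s ∧ β = E.conf B c.stk (base B) := by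
  have h := rest_inv_clean (rest_add_state (rest_base E.N) (c.l, c.var)) hS
  refine (Budget.sound_dec (stateCtr_ne s) h.1 h.2).mono ?_
  intro β _ _ hβ
  have hs : (c.l, c.var) = s := by
    by_contra hne
    have := DFunLike.congr_fun hβ (E.stateCtr s)
    rw [conf_stateCtr, Finsupp.add_apply, base_stateCtr, Finsupp.single_eq_of_ne] at this
    · simp at this
    · simp only [stateCtr, ne_eq, slot_inj]
      intro h'
      exact hne (E.st_inj (by omega))
  refine ⟨hs, ?_⟩
  rw [conf_add_state, hs] at hβ
  exact (add_right_cancel hβ).symm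

variable [DecidableEq K]

/-- The invariant of the main loop. -/
def RunInv (E : StackCode Γ Λ σ) (B : ℕ) (m : Λ → TM2.Stmt Γ Λ σ) (c₀ : TM2.Cfg Γ Λ σ)
    (β : Config) : Prop :=
  ∃ c, TM2.Reaches m c₀ c ∧ E.Outcome B (base B) c β

theorem sound_stepProg {m : Λ → TM2.Stmt Γ Λ σ} (hm : ∀ l, E.Allowed (m l))
    {c₀ : TM2.Cfg Γ Λ σ} {α : Config} (h : E.RunInv B m c₀ α) (p : Λ × σ) :
    (stackBudget E.N B).Sound (E.stepProg m p) α (E.RunInv B m c₀) := by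
  obtain ⟨c, hc, hG, hS, rfl⟩ := h
  refine (sound_dec_state hS _).seq' (mono_stmtProg _ _) ?_
  rintro γ - - ⟨hs, rfl⟩
  refine (sound_stmtProg (rest_base E.N) (m p.1) (hm p.1) p.2 hG hS).mono ?_
  intro β _ _ hβ
  refine ⟨_, hc.tail ?_, hβ⟩
  obtain ⟨l, v, S⟩ := c
  obtain ⟨rfl, rfl⟩ := Prod.mk.inj hs
  simp [TM2.step]

theorem sound_run {m : Λ → TM2.Stmt Γ Λ σ} (hm : ∀ l, E.Allowed (m l))
    {c₀ : TM2.Cfg Γ Λ σ} (hG : E.Good c₀.stk) (hS : ∀ k, E.code k (c₀.stk k) ≤ B) (p : Λ × σ)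
    (ps : List (Λ × σ)) :
    (stackBudget E.N B).Sound (loop (choiceList (E.stepProg m p) (ps.map (E.stepProg m))))
      (E.cfgConf B c₀) (E.RunInv B m c₀) := by
  have h := rest_inv_clean (rest_add_state (rest_base E.N) (c₀.l, c₀.var)) hS
  refine Budget.Sound.loop_inv (mono_runBody m p ps) h.1 h.2
    ⟨c₀, ReflTransGen.refl, hG, hS, rfl⟩ fun γ _ _ hγ => ?_
  refine Budget.sound_choiceList (sound_stepProg hm hγ p) fun P hP => ?_
  obtain ⟨q, -, rfl⟩ := List.mem_map.1 hP
  exact sound_stepProg hm hγ q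

theorem reach_stepProg {m : Λ → TM2.Stmt Γ Λ σ} (hm : ∀ l, E.Allowed (m l)) {s : ℕ}
    (hs : ∀ l, pushes (m l) ≤ s) {c c' : TM2.Cfg Γ Λ σ} {L : ℕ} (hG : E.Good c.stk)
    (hL : ∀ k, (c.stk k).length ≤ L) (hB : E.W ^ (L + s) ≤ B) (hc : TM2.step m c = some c') :
    (∃ p, (stackBudget E.N B).Reach (E.stepProg m p) (E.cfgConf B c) (E.cfgConf B c')) ∧
      E.Good c'.stk ∧ ∀ k, (c'.stk k).length ≤ L + s := by
  obtain ⟨l, v, S⟩ := c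
  cases l with
  | none => simp [TM2.step] at hc
  | some l =>
    simp only [TM2.step, Option.some.injEq] at hc
    subst hc
    refine ⟨⟨(l, v), ?_⟩, good_stepAux (hm l) hG, fun k =>
      (length_stepAux hL k).trans (Nat.add_le_add_left (hs l) L)⟩
    refine Budget.Reach.seq (γ := E.conf B S (base B)) trivial
      (Budget.Reach.of_step (step_dec_iff'.2 conf_add_state)) ?_
    exact reach_stmtProg (rest_base E.N) (m l) (hm l) v hG hL
      ((Nat.pow_le_pow_right E.W_pos (Nat.add_le_add_left (hs l) L)).trans hB)

/-- Each step lengthens a stack by at most `s`, so `n` steps stay within `L + n * s` symbols. -/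
theorem reach_run {m : Λ → TM2.Stmt Γ Λ σ} (hm : ∀ l, E.Allowed (m l)) {s : ℕ}
    (hs : ∀ l, pushes (m l) ≤ s) {c₀ : TM2.Cfg Γ Λ σ} {L : ℕ} (hG : E.Good c₀.stk)
    (hL : ∀ k, (c₀.stk k).length ≤ L) (p : Λ × σ) {ps : List (Λ × σ)} (hps : ∀ q, q ∈ ps)
    {n : ℕ} : ∀ {c : TM2.Cfg Γ Λ σ}, E.W ^ (L + n * s) ≤ B →
    (flip bind (TM2.step m))^[n] (some c₀) = some c →
    (stackBudget E.N B).Reach (loop (choiceList (E.stepProg m p) (ps.map (E.stepProg m))))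
      (E.cfgConf B c₀) (E.cfgConf B c) := by
  suffices H : ∀ {c : TM2.Cfg Γ Λ σ}, E.W ^ (L + n * s) ≤ B →
      (flip bind (TM2.step m))^[n] (some c₀) = some c →
      ReflTransGen ((stackBudget E.N B).Reach
        (choiceList (E.stepProg m p) (ps.map (E.stepProg m)))) (E.cfgConf B c₀) (E.cfgConf B c) ∧
        E.Good c.stk ∧ ∀ k, (c.stk k).length ≤ L + n * s from
    fun {_} hB hc => Budget.Reach.loop (testFree_runBody m p ps) (H hB hc).1
  induction n with
  | zero =>
    intro c _ hc
    obtain rfl : c₀ = c := by simpa using hc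
    exact ⟨ReflTransGen.refl, hG, by simpa using hL⟩
  | succ n ih =>
    intro c hB hc
    rw [Function.iterate_succ_apply'] at hc
    have hB' : E.W ^ (L + n * s + s) ≤ B := by rwa [add_assoc, ← Nat.succ_mul]
    cases hd : (flip bind (TM2.step m))^[n] (some c₀) with
    | none => rw [hd] at hc; simp [flip] at hc
    | some d =>
      rw [hd] at hc
      obtain ⟨h₁, h₂, h₃⟩ := ih ((Nat.pow_le_pow_right E.W_pos (by omega)).trans hB') hd
      obtain ⟨⟨q, hq⟩, h₅, h₆⟩ := reach_stepProg hm hs h₂ h₃ hB' (c' := c) hc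
      refine ⟨h₁.tail (Budget.reach_choiceList_mem (List.mem_map.2 ⟨q, hps q, rfl⟩) hq), h₅, ?_⟩
      rw [Nat.succ_mul, ← add_assoc]
      exact h₆

/-- The machine halts with the symbol `a` as the only one on the stack `k`. -/
theorem sound_mainProg {m : Λ → TM2.Stmt Γ Λ σ} (hm : ∀ l, E.Allowed (m l)) {l₀ : Λ} {v₀ : σ}
    {ps : List (Λ × σ)} {S : ∀ k, List (Γ k)} (hG : E.Good S) (hS : ∀ k, E.code k (S k) ≤ B)
    {k : K} {a : Γ k} :
    (stackBudget E.N B).Sound (E.mainProg m l₀ v₀ ps k a) (E.conf B S (base B)) fun β =>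
      ∃ c, TM2.Reaches m ⟨some l₀, v₀, S⟩ c ∧ c.l = none ∧ E.Good c.stk ∧
        E.code k (c.stk k) = β (stackCtr (E.idx k)) + E.digit k a := by
  have mclr := mono_clearPartners (E := E) (B := B)
  have mblk := mono_outputBlock (E := E) (B := B) k a
  have mdec : (stackBudget E.N B).Mono (dec (E.stateCtr (none, v₀))) :=
    Budget.mono_dec (stateCtr_ne _)
  have h₀ := rest_inv_clean (rest_base E.N) hS
  refine (Budget.sound_inc (stateCtr_ne _) (stateCtr_pairs_ne _) h₀.1 h₀.2).seq'
    ((mono_runBody m _ ps).loop.seq (mdec.seq (mblk.seq mclr.loop))) ?_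
  rintro γ - - rfl
  rw [← conf_add_state]
  refine (sound_run hm (c₀ := ⟨some l₀, v₀, S⟩) hG hS _ ps).seq' (mdec.seq (mblk.seq mclr.loop)) ?_
  rintro γ - - ⟨c, hc, hG', hS', rfl⟩
  refine (sound_dec_state hS' _).seq' (mblk.seq mclr.loop) ?_
  rintro γ hI hcl ⟨hs, rfl⟩
  refine ((Budget.Avoids.sound_block (avoids_of_subset (k := E.idx k)
    (replicate_subset_of_mem (by simp)) (by simp)) (fun p _ => by simp) hI hcl).mono
    -- From here on only the output counter matters: its code is its current value plus the
    -- subtracted digit. Clearing touches only the partners and the bound, so this relation persists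
    -- until the final test.
    (T := fun β => E.code k (c.stk k) = β (stackCtr (E.idx k)) + E.digit k a) ?_).seq' mclr.loop ?_
  · intro β _ _ hβ
    have := (hβ (stackCtr (E.idx k))).2
    rw [conf, stackState_stackCtr (rest_base E.N) (E.idx_lt k), codes_idx] at this
    simpa using this.symm
  · intro γ hI hcl hγ
    refine (Budget.Sound.loop_inv (S := fun β => E.code k (c.stk k) =
      β (stackCtr (E.idx k)) + E.digit k a) mclr hI hcl hγ ?_).mono
      fun β _ _ hβ => ⟨c, hc, (Prod.mk.inj hs).1, hG', hβ⟩
    have hdec : ∀ x ∈ slot 1 :: E.partners, ∀ γ : Config, (stackBudget E.N B).Inv γ →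
        (stackBudget E.N B).Clean γ →
        E.code k (c.stk k) = γ (stackCtr (E.idx k)) + E.digit k a →
        (stackBudget E.N B).Sound (dec x) γ fun β =>
          E.code k (c.stk k) = β (stackCtr (E.idx k)) + E.digit k a := by
      intro x hx γ hI hcl hγ
      refine (Budget.sound_dec (partners_ne hx).1 hI hcl).mono ?_
      rintro β - - rfl
      rw [hγ, Finsupp.add_apply, Finsupp.single_eq_of_ne ((partners_ne (B := B) hx).2 _), add_zero]
    intro γ hI hcl hγ
    refine Budget.sound_choiceList (hdec _ (by simp) γ hI hcl hγ) fun P hP => ?_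
    obtain ⟨x, hx, rfl⟩ := List.mem_map.1 hP
    exact hdec x (by simp [hx]) γ hI hcl hγ

theorem reach_mainProg {m : Λ → TM2.Stmt Γ Λ σ} (hm : ∀ l, E.Allowed (m l)) {s : ℕ}
    (hs : ∀ l, pushes (m l) ≤ s) {l₀ : Λ} {v₀ : σ}
    {ps : List (Λ × σ)} (hps : ∀ q, q ∈ ps) {S S' : ∀ k, List (Γ k)} {L n : ℕ} (hG : E.Good S)
    (hL : ∀ k, (S k).length ≤ L) (hB : E.W ^ (L + n * s) ≤ B)
    {k : K} {a : Γ k} (hk : S' k = [a]) (hk' : ∀ j, j ≠ k → S' j = [])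
    (hn : (flip bind (TM2.step m))^[n] (some ⟨some l₀, v₀, S⟩) = some ⟨none, v₀, S'⟩) :
    (stackBudget E.N B).Reach (E.mainProg m l₀ v₀ ps k a) (E.conf B S (base B)) 0 := by
  have hx : ∀ x ∈ List.replicate (E.digit k a) (stackCtr (E.idx k)),
      1 * (List.replicate (E.digit k a) (stackCtr (E.idx k))).count x ≤
        E.conf B S' (base B) x := by
    intro x hx
    rw [List.eq_of_mem_replicate hx, List.count_replicate_self, conf,
      stackState_stackCtr (rest_base E.N) (E.idx_lt k), codes_idx, hk]
    simp [code]
  obtain ⟨β, hβ⟩ := Xfer.exists (pos := []) hx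
  refine Budget.Reach.seq (γ := E.cfgConf B ⟨some l₀, v₀, S⟩) trivial
    (Budget.Reach.of_step (step_inc_iff.2 conf_add_state))
    ((reach_run hm hs hG hL _ hps hB hn).seq (M := loop _) (testFree_runBody m _ ps)
    (Budget.Reach.seq (γ := E.conf B S' (base B)) trivial
      (Budget.Reach.of_step (step_dec_iff'.2 conf_add_state))
    ((Budget.reach_block hβ).seq (testFree_block _ _)
    (Budget.Reach.of_step (step_clearProg fun x hx => ?_)))))
  -- Outside the cleared counters everything is already zero: the output code has been subtracted,
  -- and all other stacks are empty.
  rw [mem_partners] at hx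
  push Not at hx
  obtain ⟨h₁, h₂, h₃⟩ := hx
  have hβx := (hβ x).2
  simp only [List.count_nil, mul_zero, add_zero, one_mul] at hβx
  have hc : E.conf B S' (base B) x = stackPart E.N B (E.codes S') x := by
    simp [conf, stackState, base, h₁, h₂]
  rw [hc] at hβx
  by_cases hk₁ : ∃ i < E.N, x = stackCtr i
  · obtain ⟨i, hi, rfl⟩ := hk₁
    rw [stackPart_stackCtr hi] at hβx
    by_cases hi' : ∃ j, E.idx j = i
    · obtain ⟨j, rfl⟩ := hi'
      rw [codes_idx] at hβx
      by_cases hj : j = k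
      · subst hj
        rw [hk, List.count_replicate_self] at hβx
        simpa [code] using hβx
      · rw [hk' j hj, code] at hβx
        omega
    · rw [codes, Function.extend_apply' _ _ _ hi'] at hβx
      simp at hβx
      exact hβx.1
  · push Not at hk₁
    rw [stackPart_of_ne fun i hi => ⟨hk₁ i hi, h₃ i hi⟩] at hβx
    omega

end StackCode

/-! ### Existence of a finite coding. -/

namespace StackCode

variable {K : Type} {Γ : K → Type} {Λ σ : Type}

/-- The symbols that a statement may push. -/
def pushed : TM2.Stmt Γ Λ σ → Set (Σ k, Γ k)
  | .push k f q => Set.range (fun v => ⟨k, f v⟩) ∪ pushed q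
  | .peek _ _ q => pushed q
  | .pop _ _ q => pushed q
  | .load _ q => pushed q
  | .branch _ q₁ q₂ => pushed q₁ ∪ pushed q₂
  | .goto _ => ∅
  | .halt => ∅

theorem finite_pushed [Finite σ] (q : TM2.Stmt Γ Λ σ) : (pushed q).Finite := by
  induction q with
  | push k f q ih => exact (Set.finite_range _).union ih
  | peek k f q ih => exact ih
  | pop k f q ih => exact ih
  | load f q ih => exact ih
  | branch p q₁ q₂ ih₁ ih₂ => exact ih₁.union ih₂
  | goto f => exact Set.finite_empty
  | halt => exact Set.finite_empty

theorem allowed_of_pushed {E : StackCode Γ Λ σ} (q : TM2.Stmt Γ Λ σ)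
    (h : ∀ k a, ⟨k, a⟩ ∈ pushed q → a ∈ E.alph k) : E.Allowed q := by
  induction q with
  | push k f q ih =>
    exact ⟨fun v => h k _ (Or.inl ⟨v, rfl⟩), ih fun j a hj => h j a (Or.inr hj)⟩
  | peek k f q ih => exact ih h
  | pop k f q ih => exact ih h
  | load f q ih => exact ih h
  | branch p q₁ q₂ ih₁ ih₂ =>
    exact ⟨ih₁ fun j a hj => h j a (Or.inl hj), ih₂ fun j a hj => h j a (Or.inr hj)⟩
  | goto f => trivial
  | halt => trivial

/-- The stack alphabets need not be finite, but only finitely many symbols are relevant. A digit is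
the position in one list of all of them, plus one to make it positive; symbols outside the list
share a digit, which is harmless. -/
theorem exists_alph [Finite K] [Finite Λ] [Finite σ] {A : Set (Σ k, Γ k)} (hA : A.Finite) :
    ∃ E : StackCode Γ Λ σ, ∀ k a, ⟨k, a⟩ ∈ A → a ∈ E.alph k := by
  classical
  have := Fintype.ofFinite K
  have := Fintype.ofFinite (Option Λ × σ)
  let A' := hA.toFinset.toList
  let alph : ∀ k, List (Γ k) := fun k =>
    (hA.preimage (sigma_mk_injective (i := k)).injOn).toFinset.toList
  have hmem : ∀ k a, a ∈ alph k ↔ ⟨k, a⟩ ∈ A := fun k a => by simp [alph]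
  have hA' : ∀ k a, a ∈ alph k → (⟨k, a⟩ : Σ k, Γ k) ∈ A' := fun k a h => by
    simpa [A'] using (hmem k a).1 h
  refine ⟨{
    N := Fintype.card K
    idx := fun k => (Fintype.equivFin K k).val
    idx_lt := fun k => (Fintype.equivFin K k).isLt
    idx_inj := fun _ _ h => (Fintype.equivFin K).injective (Fin.ext h)
    st := fun s => (Fintype.equivFin (Option Λ × σ) s).val
    st_inj := fun _ _ h => (Fintype.equivFin (Option Λ × σ)).injective (Fin.ext h)
    W := A'.length + 1
    W_pos := Nat.succ_pos _
    alph := alph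
    digit := fun k a => A'.idxOf ⟨k, a⟩ + 1
    digit_pos := fun _ _ => Nat.succ_pos _
    digit_lt := fun k a ha => Nat.succ_lt_succ (List.idxOf_lt_length_of_mem (hA' k a ha))
    digit_inj := fun k a ha b _ h => sigma_mk_injective
      ((List.idxOf_inj (hA' k a ha)).1 (Nat.succ_injective h)) },
    fun k a h => (hmem k a).2 h⟩

/-- The machine can be simulated. -/
theorem exists_allowed [Finite K] [Finite Λ] [Finite σ] (m : Λ → TM2.Stmt Γ Λ σ) {k₀ k₁ : K}
    [Finite (Γ k₀)] (a₁ : Γ k₁) : ∃ E : StackCode Γ Λ σ, (∀ l, E.Allowed (m l)) ∧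
      (∀ a, a ∈ E.alph k₀) ∧ a₁ ∈ E.alph k₁ := by
  obtain ⟨E, hE⟩ := exists_alph (Λ := Λ) (σ := σ) (A := (⋃ l, pushed (m l)) ∪
      (Set.range (fun a : Γ k₀ => (⟨k₀, a⟩ : Σ k, Γ k)) ∪ {⟨k₁, a₁⟩}))
    ((Set.finite_iUnion fun l => finite_pushed (m l)).union
      ((Set.finite_range _).union (Set.finite_singleton _)))
  exact ⟨E, fun l => allowed_of_pushed _ fun k a h => hE k a (Or.inl (Set.mem_iUnion.2 ⟨l, h⟩)),
    fun a => hE _ _ (Or.inr (Or.inl ⟨a, rfl⟩)), hE _ _ (Or.inr (Or.inr rfl))⟩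

end StackCode

/-! ### Growth of the amplifiers -/

theorem amplify_one : ∀ k, amplify k 1 = 2
  | 0 => rfl
  | k + 1 => amplify_one k

theorem amplify_two : ∀ k, amplify k 2 = 4
  | 0 => rfl
  | k + 1 => by
    change amplify k (amplify k 1) = 4
    rw [amplify_one, amplify_two k]

theorem amplify_succ_succ (k n : ℕ) : amplify (k + 1) (n + 1) = amplify k (amplify (k + 1) n) :=
  Function.iterate_succ_apply' (amplify k) n 1

/-- After a shift of argument and value by `3`, the iterates satisfy the recursion of the Ackermann
function. The base case is `2 * (n + 3) = (2 * n + 3) + 3`, and the value `4` at `2`, common to all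
levels, matches `ack (m + 1) 0 = ack m 1`. -/
theorem amplify_add_three (k : ℕ) : ∀ n, amplify k (n + 3) = ack (k + 2) n + 3 := by
  induction k with
  | zero =>
    intro n
    rw [ack_two]
    change 2 * (n + 3) = _
    omega
  | succ k ih =>
    intro n
    induction n with
    | zero => rw [amplify_succ_succ, amplify_two, ack_succ_zero, ← ih]
    | succ n ihn => rw [ack_succ_succ, amplify_succ_succ, ihn, ih]

theorem iterate_ack_le (m n : ℕ) : ∀ i, (ack m)^[i] n ≤ ack (m + 1) (n + i)
  | 0 => (lt_ack_right _ _).le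
  | i + 1 => by
    rw [Function.iterate_succ_apply', ← add_assoc, ack_succ_succ]
    exact ack_mono_right m (iterate_ack_le m n i)

/-- One level pays for the iteration. As the number of iterations also depends on `n`, a composition
with `ack 2` follows, which the bound for composed Ackermann functions absorbs; five levels suffice
for all of this. -/
theorem fastGrowing_le_ack (d : ℕ) : ∀ n, fastGrowing d n ≤ ack (5 * d) n := by
  induction d with
  | zero => intro n; simp [fastGrowing]
  | succ d ih =>
    intro n
    calc (fastGrowing d)^[n + 1] n ≤ (ack (5 * d))^[n + 1] n :=
          (ack_mono_right _).le_iterate_of_le ih (n + 1) n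
      _ ≤ ack (5 * d + 1) (n + (n + 1)) := iterate_ack_le _ _ _
      -- Here `ack 2 n = 2 * n + 3` exceeds `n + (n + 1)`.
      _ ≤ ack (5 * d + 1) (ack 2 n) := ack_mono_right _ (by rw [ack_two]; omega)
      _ ≤ ack (max (5 * d + 1) 2 + 2) n := (ack_ack_lt_ack_max_add_two _ _ _).le
      _ ≤ ack (5 * (d + 1)) n := ack_mono_left n (by omega)

theorem ack_le_ack_add_zero : ∀ m n, ack m n ≤ ack (m + n) 0
  | _, 0 => le_rfl
  | m, n + 1 => (ack_succ_right_le_ack_succ_left m n).trans <| by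
    simpa [add_assoc, add_comm 1] using ack_le_ack_add_zero (m + 1) n

theorem fastGrowingOmega_le_ack (n : ℕ) : fastGrowingOmega n ≤ ack (6 * n + 5) 0 :=
  (fastGrowing_le_ack _ _).trans ((ack_le_ack_add_zero _ _).trans (ack_mono_left 0 (by omega)))

theorem ack_zero_add_le (m n : ℕ) : ack m 0 + n ≤ ack (m + n) 0 := by
  induction n with
  | zero => rfl
  | succ n ih =>
    have : ack (m + n) 0 < ack (m + n + 1) 0 := ack_strictMono_left 0 (Nat.lt_succ_self _)
    rw [← add_assoc, ← add_assoc]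
    omega

/-- Simulations in time `O(F_ω(p(n)))` fit below an amplifier of primitive recursive level. -/
theorem exists_pow_le_amplify (W s c : ℕ) (hW : 0 < W) :
    ∃ a, ∀ n q t, t ≤ c * (fastGrowingOmega q + 1) →
      W ^ (n + t * s) ≤ amplify (a + (6 * q + n)) 3 := by
  -- With both the input length and the time estimated through one variable `x`, the needed bound is
  -- a primitive recursive function of `x`, hence lies below some `ack m`.
  have hp : Primrec fun x => W ^ (x + c * (x + 1) * s) := by
    have hmul : Primrec fun x : ℕ => x + c * (x + 1) * s :=
      Primrec.nat_add.comp Primrec.id (Primrec.nat_mul.comp (Primrec.nat_mul.comp (Primrec.const c)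
        (Primrec.succ)) (Primrec.const s))
    have hpow : Primrec fun e : ℕ => W ^ e := by
      refine (Primrec.nat_rec₁ 1 (f := fun _ r => r * W)
        (Primrec.nat_mul.comp Primrec.snd (Primrec.const W))).of_eq fun e => ?_
      induction e with
      | zero => rfl
      | succ e ih => rw [pow_succ, ← ih]
    exact hpow.comp hmul
  obtain ⟨m, hm⟩ := exists_lt_ack_of_nat_primrec (Primrec.nat_iff.1 hp)
  refine ⟨m + 5, fun n q t ht => ?_⟩
  have h₁ := fastGrowingOmega_le_ack q
  have h₂ := ack_zero_add_le (6 * q + 5) n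
  -- This choice makes `ack M 0` at least both `fastGrowingOmega q` and `n`.
  set M := 6 * q + 5 + n with hM
  calc W ^ (n + t * s) ≤ W ^ (ack M 0 + c * (ack M 0 + 1) * s) := by
        refine Nat.pow_le_pow_right hW (Nat.add_le_add (by omega) (Nat.mul_le_mul_right s
          (ht.trans (Nat.mul_le_mul_left c (by omega)))))
    _ ≤ ack m (ack M 0) := (hm _).le
    _ ≤ ack (max m M + 2) 0 := (ack_ack_lt_ack_max_add_two _ _ _).le
    _ ≤ ack (m + 5 + (6 * q + n) + 2) 0 := ack_mono_left 0 (by omega)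
    _ ≤ amplify (m + 5 + (6 * q + n)) 3 := by
      rw [show 3 = 0 + 3 from rfl, amplify_add_three]
      omega

/-! ### The reduction -/

theorem step_thenTests {M : CounterProgram} {cs : List ℕ} {α β : Config} :
    (M.thenTests cs).Step α β ↔ M.Step α β ∧ ∀ c ∈ cs, β c = 0 := by
  induction cs using List.reverseRecOn generalizing β with
  | nil => simp [thenTests]
  | append_singleton cs c ih =>
    rw [thenTests, List.foldl_append]
    change Comp (Step (M.thenTests cs)) (Step (test c)) α β ↔ _
    constructor
    · rintro ⟨γ, h₁, h₂, h₃, h₄⟩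
      obtain rfl : γ = β := by
        ext x
        by_cases hx : x = c
        · rw [hx, h₃, h₄]
        · exact h₂ x hx
      obtain ⟨h₅, h₆⟩ := ih.1 h₁
      refine ⟨h₅, fun x hx => ?_⟩
      rcases List.mem_append.1 hx with hx | hx
      · exact h₆ x hx
      · rw [List.mem_singleton.1 hx, h₃]
    · rintro ⟨h₁, h₂⟩
      exact ⟨β, ih.2 ⟨h₁, fun x hx => h₂ x (by simp [hx])⟩, fun _ _ => rfl, h₂ c (by simp),
        h₂ c (by simp)⟩

/-! ### Separation of the counters of amplifiers and simulation. -/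

theorem occurs_thenIncs {x : ℕ} {M : CounterProgram} {l : List ℕ} :
    Occurs x (thenIncs M l) ↔ Occurs x M ∨ x ∈ l := by
  induction l generalizing M with
  | nil => simp [thenIncs]
  | cons c l ih =>
    change Occurs x (thenIncs (seq M (inc c)) l) ↔ _
    rw [ih, List.mem_cons, ← or_assoc]
    rfl

theorem occurs_thenDecs {x : ℕ} {M : CounterProgram} {l : List ℕ} :
    Occurs x (thenDecs M l) ↔ Occurs x M ∨ x ∈ l := by
  induction l generalizing M with
  | nil => simp [thenDecs]
  | cons c l ih =>
    change Occurs x (thenDecs (seq M (dec c)) l) ↔ _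
    rw [ih, List.mem_cons, ← or_assoc]
    rfl

theorem Occurs.of_block {x : ℕ} {neg pos : List ℕ} (h : Occurs x (block neg pos)) :
    x = 0 ∨ x ∈ neg ∨ x ∈ pos := by
  cases neg with
  | nil =>
    rw [block, occurs_thenIncs] at h
    simp only [Occurs] at h
    tauto
  | cons n neg =>
    rw [block, occurs_thenIncs, occurs_thenDecs] at h
    simp only [Occurs] at h
    simp only [List.mem_cons]
    tauto

theorem Occurs.of_drain {x c d y z : ℕ} {neg pos : List ℕ} (h : Occurs x (drain c d neg pos y z)) :
    x = 0 ∨ x ∈ c :: d :: y :: z :: (neg ++ pos) := by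
  rcases h with h | h | h | h
  · have := Occurs.of_block h
    simp only [List.mem_cons, List.mem_append]; tauto
  · have := Occurs.of_block h
    simp only [List.mem_cons, List.mem_append, List.not_mem_nil] at this ⊢; tauto
  · have := Occurs.of_block h
    simp only [List.mem_cons, List.mem_append, List.not_mem_nil] at this ⊢; tauto
  · simp only [List.mem_cons, List.mem_append]
    change x = c at h
    tauto

theorem Occurs.of_weigh {x n : ℕ} {M : CounterProgram} (h : Occurs x (weigh n M)) :
    Occurs x M ∨ Occurs x (addWeight n) ∨ Occurs x (subWeight n) := by
  induction M with
  | inc c => exact h.elim Or.inl fun h => Or.inr (Or.inl h)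
  | dec c => exact h.elim Or.inl fun h => Or.inr (Or.inr h)
  | test c => exact Or.inl h
  | loop M ih => exact ih h
  | seq M N ih₁ ih₂ | choice M N ih₁ ih₂ =>
    rcases h with h | h
    · rcases ih₁ h with h | h
      · exact Or.inl (Or.inl h)
      · exact Or.inr h
    · rcases ih₂ h with h | h
      · exact Or.inl (Or.inr h)
      · exact Or.inr h

theorem Occurs.ne_of_block {x : ℕ} {neg pos : List ℕ} (h : Occurs x (block neg pos))
    (hl : ∀ y ∈ neg ++ pos, y % 8 ≠ 7) : x % 8 ≠ 7 := by
  rcases h.of_block with rfl | h | h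
  · simp
  · exact hl x (by simp [h])
  · exact hl x (by simp [h])

theorem Occurs.ne_of_drain {x c d y z : ℕ} {neg pos : List ℕ}
    (h : Occurs x (drain c d neg pos y z))
    (hl : ∀ u ∈ c :: d :: y :: z :: (neg ++ pos), u % 8 ≠ 7) : x % 8 ≠ 7 := by
  rcases h.of_drain with rfl | h
  · simp
  · exact hl x h

/-- All offsets used at one level lie between `0` and `22` and avoid `7` and `15`, and levels are
shifted by multiples of `8`. So the residue `7` stays free for the simulation. -/
theorem Occurs.ne_of_amplifier {k x : ℕ} (h : Occurs x (amplifier k)) : x % 8 ≠ 7 := by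
  have hw : ∀ k, Occurs x (addWeight (8 * k)) ∨ Occurs x (subWeight (8 * k)) → x % 8 ≠ 7 := by
    rintro k ((h | h) | (h | h)) <;> exact Occurs.ne_of_drain h (by simp)
  induction k with
  | zero =>
    rcases h with h | h | (h | h | h) | h
    · exact Occurs.ne_of_drain h (by simp)
    · exact Occurs.ne_of_drain h (by simp)
    · exact Occurs.ne_of_block h (by simp)
    · exact Occurs.ne_of_drain h (by simp)
    · exact Occurs.ne_of_drain h (by simp)
    · exact Occurs.ne_of_block h (by simp)
  | succ k ih =>
    rcases h with (h | h) | h | (h | h | h | h | h) | (h | h | h) | h | h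
    · exact Occurs.ne_of_drain h (by simp)
    · exact Occurs.ne_of_drain h (by simp)
    · rcases Occurs.of_weigh h with h | h
      · simp only [fillTriple, Occurs] at h
        omega
      · exact hw k h
    · rcases Occurs.of_weigh h with h | h
      · exact ih h
      · exact hw k h
    · exact Occurs.ne_of_block h (by simp)
    · exact Occurs.ne_of_block h (by simp)
    · exact Occurs.ne_of_block h (by simp)
    · exact Occurs.ne_of_block h (by simp)
    · exact Occurs.ne_of_block h (by simp)
    · exact Occurs.ne_of_block h (by simp)
    · change x = _ at h
      omega
    · exact Occurs.ne_of_block h (by simp)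
    · exact Occurs.ne_of_block h (by simp)

/-- The program only changes the counters `slot s`. -/
def OnSlots (M : CounterProgram) : Prop := ∀ α β, M.Step α β → ∀ x, x % 8 ≠ 7 → α x = β x

theorem OnSlots.seq {M N : CounterProgram} (hM : M.OnSlots) (hN : N.OnSlots) :
    (seq M N).OnSlots := by
  rintro α β ⟨γ, h₁, h₂⟩ x hx
  rw [hM α γ h₁ x hx, hN γ β h₂ x hx]

theorem OnSlots.choice {M N : CounterProgram} (hM : M.OnSlots) (hN : N.OnSlots) :
    (choice M N).OnSlots :=
  fun α β h => h.elim (hM α β) (hN α β)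

theorem OnSlots.loop {M : CounterProgram} (hM : M.OnSlots) : (loop M).OnSlots := by
  intro α β h x hx
  change ReflTransGen M.Step α β at h
  induction h with
  | refl => rfl
  | tail _ h ih => rw [ih, hM _ _ h x hx]

theorem OnSlots.choiceList {M : CounterProgram} {l : List CounterProgram} (hM : M.OnSlots)
    (h : ∀ P ∈ l, P.OnSlots) : (choiceList M l).OnSlots := by
  induction l with
  | nil => exact hM
  | cons P l ih => exact (h P (by simp)).choice (ih fun Q hQ => h Q (by simp [hQ]))

theorem onSlots_inc (s : ℕ) : (inc (slot s)).OnSlots := fun α β h x hx =>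
  h.1 x (by rintro rfl; simp [slot] at hx)

theorem onSlots_dec (s : ℕ) : (dec (slot s)).OnSlots := fun α β h x hx =>
  h.1 x (by rintro rfl; simp [slot] at hx)

theorem onSlots_block {neg pos : List ℕ} (h : ∀ x ∈ neg ++ pos, ∃ s, x = slot s) :
    (block neg pos).OnSlots := by
  intro α β hs x hx
  have hx' : x ∉ neg ++ pos := fun hm => by
    obtain ⟨s, rfl⟩ := h x hm
    simp [slot] at hx
  simp only [List.mem_append, not_or] at hx'
  have := (step_block.1 hs x).2
  rw [List.count_eq_zero.2 hx'.1, List.count_eq_zero.2 hx'.2] at this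
  omega

theorem onSlots_zeroTest (c d x y : ℕ) : (zeroTest (slot c) (slot d) (slot x) (slot y)).OnSlots :=
  (onSlots_block (by simp [slot_inj])).loop.seq
    ((onSlots_block (by simp [slot_inj])).loop.seq (onSlots_dec _))

theorem onSlots_drain (c d : ℕ) {neg pos : List ℕ} (x y : ℕ)
    (h : ∀ x ∈ neg ++ pos, ∃ s, x = slot s) :
    (drain (slot c) (slot d) neg pos (slot x) (slot y)).OnSlots :=
  (onSlots_block h).loop.seq (onSlots_zeroTest _ _ _ _)

theorem onSlots_pushCtr (W k a : ℕ) : (pushCtr W k a).OnSlots := by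
  refine (onSlots_drain _ _ _ _ ?_).seq ((onSlots_drain _ _ _ _ ?_).seq (onSlots_block ?_)) <;>
  · intro x hx
    simp only [List.mem_cons, List.mem_append, List.mem_replicate, List.not_mem_nil, or_false] at hx
    rcases hx with h | h <;> first | exact ⟨_, h.2⟩ | (rcases h with h | h <;>
      first | exact ⟨_, h⟩ | exact ⟨_, h.2⟩)

theorem onSlots_popCtr (W k a : ℕ) : (popCtr W k a).OnSlots := by
  refine (onSlots_block ?_).seq ((onSlots_drain _ _ _ _ ?_).seq (onSlots_drain _ _ _ _ ?_)) <;>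
  · intro x hx
    simp only [List.mem_cons, List.mem_append, List.mem_replicate, List.not_mem_nil, or_false] at hx
    rcases hx with h | h <;> first | exact ⟨_, h.2⟩ | (rcases h with h | h <;>
      first | exact ⟨_, h⟩ | exact ⟨_, h.2⟩)

namespace StackCode

variable {K : Type} {Γ : K → Type} {Λ σ : Type} {E : StackCode Γ Λ σ}

theorem onSlots_stmtProg (q : TM2.Stmt Γ Λ σ) : ∀ v, (E.stmtProg q v).OnSlots := by
  induction q with
  | push k f q ih => exact fun v => (onSlots_pushCtr _ _ _).seq (ih v)
  | peek k f q ih =>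
    refine fun v => OnSlots.choiceList ((onSlots_zeroTest _ _ _ _).seq (ih _)) fun P hP => ?_
    obtain ⟨a, -, rfl⟩ := List.mem_map.1 hP
    exact (onSlots_popCtr _ _ _).seq ((onSlots_pushCtr _ _ _).seq (ih _))
  | pop k f q ih =>
    refine fun v => OnSlots.choiceList ((onSlots_zeroTest _ _ _ _).seq (ih _)) fun P hP => ?_
    obtain ⟨a, -, rfl⟩ := List.mem_map.1 hP
    exact (onSlots_popCtr _ _ _).seq (ih _)
  | load f q ih => exact fun v => ih _
  | branch p q₁ q₂ ih₁ ih₂ =>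
    intro v
    rw [stmtProg]
    cases p v
    · exact ih₂ v
    · exact ih₁ v
  | goto f => exact fun _ => onSlots_inc _
  | halt => exact fun _ => onSlots_inc _

theorem mem_partners_slot {x : ℕ} (h : x ∈ slot 1 :: E.partners) : ∃ s, x = slot s := by
  rcases mem_partners.1 h with rfl | rfl | ⟨k, -, rfl⟩ <;> exact ⟨_, rfl⟩

theorem onSlots_loadProg {k : K} : ∀ w : List (Γ k), (E.loadProg k w).OnSlots
  | [] => onSlots_drain _ _ _ _ fun x hx => by
    rcases List.mem_append.1 hx with hx | hx
    · exact ⟨0, List.mem_singleton.1 hx⟩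
    · exact mem_partners_slot hx
  | _ :: w => (onSlots_loadProg w).seq (onSlots_pushCtr _ _ _)

theorem onSlots_stepProg (m : Λ → TM2.Stmt Γ Λ σ) (p : Λ × σ) : (E.stepProg m p).OnSlots :=
  (onSlots_dec _).seq (onSlots_stmtProg _ _)

theorem onSlots_mainProg (m : Λ → TM2.Stmt Γ Λ σ) (l₀ : Λ) (v₀ : σ) (ps : List (Λ × σ)) (k : K)
    (a : Γ k) : (E.mainProg m l₀ v₀ ps k a).OnSlots := by
  refine (onSlots_inc _).seq ((OnSlots.choiceList (onSlots_stepProg m _) fun P hP => ?_).loop.seq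
    ((onSlots_dec _).seq ((onSlots_block fun x hx => ?_).seq
    (OnSlots.choiceList (onSlots_dec _) fun P hP => ?_).loop)))
  · obtain ⟨q, -, rfl⟩ := List.mem_map.1 hP
    exact onSlots_stepProg m q
  · rw [List.append_nil] at hx
    exact ⟨_, List.eq_of_mem_replicate hx⟩
  · obtain ⟨x, hx, rfl⟩ := List.mem_map.1 hP
    obtain ⟨s, rfl⟩ := mem_partners_slot (E := E) (List.mem_cons_of_mem _ hx)
    exact onSlots_dec _

end StackCode

/-! ### Joining the amplifier to the simulation. -/

/-- Fill the triple at `n` with `(3, C, 6 * C)`. -/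
def fillInput (n : ℕ) : CounterProgram :=
  seq (block [] [n, n, n])
    (xfer [] [n + 1, n + 2, n + 2, n + 2, n + 2, n + 2, n + 2])

/-- Move the triple at `n` to the counters of the simulation. -/
def moveTriple (n : ℕ) : CounterProgram :=
  seq (xfer [n] [slot 0]) (seq (xfer [n + 1] [slot 2]) (xfer [n + 2] [slot 3]))

/-- The program `M`, started with the output of the amplifier of level `D`. -/
def amplified (D : ℕ) (M : CounterProgram) : CounterProgram :=
  seq (fillInput (8 * D + 8)) (seq (amplifier D) (seq (moveTriple (8 * D)) M))

theorem step_fillInput {n : ℕ} {β : Config} :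
    (fillInput n).Step 0 β ↔ ∃ C, β = triple n 3 C := by
  have key : ∀ C x, triple n 3 C x = [n, n, n].count x +
      C * [n + 1, n + 2, n + 2, n + 2, n + 2, n + 2, n + 2].count x := by
    intro C x
    simp only [triple, Finsupp.add_apply, Finsupp.single_apply, List.count_cons, List.count_nil,
      beq_iff_eq]
    split_ifs <;> omega
  obtain ⟨γ, hγ⟩ := exists_config_count [n, n, n]
  constructor
  · rintro ⟨γ', h₁, h₂⟩
    obtain ⟨C, hC⟩ := (step_xfer (List.disjoint_nil_left _)).1 h₂
    refine ⟨C, Finsupp.ext fun x => ?_⟩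
    have h₃ := (step_block.1 h₁ x).2
    have h₄ := (hC x).2
    simp only [List.count_nil, mul_zero, add_zero, Finsupp.coe_zero, Pi.zero_apply, zero_add]
      at h₃ h₄
    rw [h₄, h₃, key]
  · rintro ⟨C, rfl⟩
    refine ⟨γ, step_block.2 fun x => ?_, (step_xfer (List.disjoint_nil_left _)).2 ⟨C, fun x => ?_⟩⟩
    · simp [hγ x]
    · simp [key, hγ x]

/-- The configuration in which the simulation starts. -/
noncomputable def simStart (B C : ℕ) : Config :=
  Finsupp.single (slot 0) B + Finsupp.single (slot 2) C + Finsupp.single (slot 3) (2 * B * C)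

theorem disjoint_singleton_slot {n s : ℕ} (hn : n % 8 ≠ 7) : [n].Disjoint [slot s] := by
  simp only [List.singleton_disjoint, List.mem_singleton, slot]
  omega

theorem exists_of_step_moveTriple {n : ℕ} (hn : n % 8 = 0) {α β : Config}
    (h : (moveTriple n).Step α β) : ∃ a b c, ∀ x,
      β x + (if x = n then a else 0) + (if x = n + 1 then b else 0) +
        (if x = n + 2 then c else 0) =
      α x + (if x = slot 0 then a else 0) + (if x = slot 2 then b else 0) +
        (if x = slot 3 then c else 0) := by
  obtain ⟨γ, h₁, δ, h₂, h₃⟩ := h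
  obtain ⟨a, h₁⟩ := (step_xfer (disjoint_singleton_slot (by omega))).1 h₁
  obtain ⟨b, h₂⟩ := (step_xfer (disjoint_singleton_slot (by omega))).1 h₂
  obtain ⟨c, h₃⟩ := (step_xfer (disjoint_singleton_slot (by omega))).1 h₃
  refine ⟨a, b, c, fun x => ?_⟩
  have e₁ := (h₁ x).2
  have e₂ := (h₂ x).2
  have e₃ := (h₃ x).2
  simp only [List.count_singleton, beq_iff_eq, mul_ite, mul_one, mul_zero, eq_comm (b := x)]
    at e₁ e₂ e₃
  omega

theorem moveTriple_of_ne {n x : ℕ} (hn : n % 8 = 0) {α β : Config} (h : (moveTriple n).Step α β)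
    (hx : x % 8 ≠ 7) (h₀ : x ≠ n) (h₁ : x ≠ n + 1) (h₂ : x ≠ n + 2) : α x = β x := by
  obtain ⟨a, b, c, h⟩ := exists_of_step_moveTriple hn h
  have := h x
  rw [if_neg h₀, if_neg h₁, if_neg h₂, if_neg (by rintro rfl; simp [slot] at hx),
    if_neg (by rintro rfl; simp [slot] at hx), if_neg (by rintro rfl; simp [slot] at hx)] at this
  exact this.symm

theorem step_moveTriple {n : ℕ} (hn : n % 8 = 0) {B C : ℕ} :
    (moveTriple n).Step (triple n B C) (simStart B C) := by
  refine ⟨Finsupp.single (slot 0) B + Finsupp.single (n + 1) C + Finsupp.single (n + 2) (2 * B * C),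
    (step_xfer (disjoint_singleton_slot (by omega))).2 ⟨B, fun x => ?_⟩,
    Finsupp.single (slot 0) B + Finsupp.single (slot 2) C + Finsupp.single (n + 2) (2 * B * C),
    (step_xfer (disjoint_singleton_slot (by omega))).2 ⟨C, fun x => ?_⟩,
    (step_xfer (disjoint_singleton_slot (by omega))).2 ⟨2 * B * C, fun x => ?_⟩⟩ <;>
  · simp only [triple, simStart, Finsupp.add_apply, Finsupp.single_apply, List.count_singleton,
      beq_iff_eq, mul_ite, mul_one, mul_zero, slot]
    split_ifs <;> omega

theorem eq_simStart {n : ℕ} (hn : n % 8 = 0) {B C : ℕ} {β : Config}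
    (h : (moveTriple n).Step (triple n B C) β) (hβ : ∀ x, x % 8 ≠ 7 → β x = 0) :
    β = simStart B C := by
  obtain ⟨a, b, c, h⟩ := exists_of_step_moveTriple hn h
  have h₀ := h n
  have h₁ := h (n + 1)
  have h₂ := h (n + 2)
  rw [hβ _ (by omega)] at h₀ h₁ h₂
  have e₀ : n ≠ slot 0 ∧ n ≠ slot 2 ∧ n ≠ slot 3 := by simp only [slot]; omega
  have e₁ : n + 1 ≠ slot 0 ∧ n + 1 ≠ slot 2 ∧ n + 1 ≠ slot 3 := by simp only [slot]; omega
  have e₂ : n + 2 ≠ slot 0 ∧ n + 2 ≠ slot 2 ∧ n + 2 ≠ slot 3 := by simp only [slot]; omega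
  simp [triple, e₀, e₁, e₂] at h₀ h₁ h₂
  subst h₀ h₁ h₂
  ext x
  have hx := h x
  simp only [triple, simStart, Finsupp.add_apply, Finsupp.single_apply, eq_comm (b := x)] at hx ⊢
  omega

/-- The final tests speak about the end of `M`, but amplifier counters are no slots and `M` changes
only slots. They were therefore zero before `M` started, so the triple was moved completely and the
amplifier ended with no leftovers, which is what its soundness requires. -/
theorem amplified_reaches {D : ℕ} {M : CounterProgram} (hM : M.OnSlots) {N : ℕ}
    (hN : 8 * D + 16 ≤ N) : ((amplified D M).thenTests (List.range N)).Reaches ↔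
      ∃ C β, M.Step (simStart (amplify D 3) C) β ∧ ∀ x < N, β x = 0 := by
  have hA := isAmplifier_amplifier D
  constructor
  · rintro ⟨β, h⟩
    obtain ⟨⟨α₁, h₁, α₂, h₂, α₃, h₃, h₄⟩, hβ⟩ := step_thenTests.1 h
    obtain ⟨C, rfl⟩ := step_fillInput.1 h₁
    have hβ' : ∀ x < N, β x = 0 := fun x hx => hβ x (List.mem_range.2 hx)
    -- Slots and counters beyond the tested range do not occur in the amplifier and are zero in the
    -- input triple.
    have hout : ∀ x, x % 8 = 7 ∨ N ≤ x → α₂ x = 0 := by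
      intro x hx
      rw [← Step.apply_eq (x := x) ?_ h₂, triple]
      · simp only [Finsupp.add_apply, Finsupp.single_apply]
        split_ifs <;> omega
      · intro ho
        have := hA.occurs x ho
        have := Occurs.ne_of_amplifier ho
        omega
    have hoff : ∀ x, x % 8 ≠ 7 → N ≤ x ∨ α₃ x = 0 := by
      intro x hx
      by_cases hxN : x < N
      · right; rw [hM _ _ h₄ x hx, hβ' x hxN]
      · left; omega
    have hz : ∀ x, x ≠ 8 * D → x ≠ 8 * D + 1 → x ≠ 8 * D + 2 → α₂ x = 0 := by
      intro x k₀ k₁ k₂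
      by_cases hx : x % 8 = 7
      · exact hout x (Or.inl hx)
      · rcases hoff x hx with h | h
        · exact hout x (Or.inr h)
        · rw [moveTriple_of_ne (by omega) h₃ hx k₀ k₁ k₂, h]
    obtain ⟨C', rfl⟩ := hA.sound _ _ _ h₂ hz
    have := eq_simStart (by omega) h₃ fun x hx => ?_
    · subst this
      exact ⟨C', β, h₄, hβ'⟩
    · rcases hoff x hx with h | h
      · rw [← moveTriple_of_ne (by omega) h₃ hx (by omega) (by omega) (by omega)]
        exact hout x (Or.inr h)
      · exact h
  · rintro ⟨C', β, h, hβ⟩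
    obtain ⟨C, hC⟩ := hA.complete 3 C'
    exact ⟨β, step_thenTests.2 ⟨⟨_, step_fillInput.2 ⟨C, rfl⟩, _, hC, _,
      step_moveTriple (by omega), h⟩, fun x hx => hβ x (List.mem_range.1 hx)⟩⟩

theorem simStart_eq {N B C : ℕ} :
    simStart B C = Finsupp.single (slot 0) B + C • (stackBudget N B).unit := by
  rw [Budget.smul_unit, ← add_assoc]
  rfl

/-! ### The complete simulation of a machine on an input. -/

namespace StackCode

variable {K : Type} [DecidableEq K] {Γ : K → Type} {Λ σ : Type} {E : StackCode Γ Λ σ}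

/-- Load the word `w` on the stack `k₀` and run the machine. -/
def simProg (E : StackCode Γ Λ σ) (m : Λ → TM2.Stmt Γ Λ σ) (l₀ : Λ) (v₀ : σ) (ps : List (Λ × σ))
    {k₀ k₁ : K} (w : List (Γ k₀)) (a : Γ k₁) : CounterProgram :=
  seq (E.loadProg k₀ w) (E.mainProg m l₀ v₀ ps k₁ a)

theorem good_update_nil {k : K} {w : List (Γ k)} (hw : ∀ b ∈ w, b ∈ E.alph k) :
    E.Good (Function.update (fun _ => []) k w) :=
  Good.update (S := fun _ => []) (fun j b hb => by simp at hb) hw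

/-- Three final zeros suffice: the two budget counters give zero slack, and the output counter shows
that the code of the output stack is the single digit of `a`. -/
theorem sound_simProg {m : Λ → TM2.Stmt Γ Λ σ} (hm : ∀ l, E.Allowed (m l)) {l₀ : Λ} {v₀ : σ}
    {ps : List (Λ × σ)} {k₀ k₁ : K} {w : List (Γ k₀)} (hw : ∀ b ∈ w, b ∈ E.alph k₀) {a : Γ k₁}
    (ha : a ∈ E.alph k₁) {B C : ℕ} {β : Config}
    (h : (E.simProg m l₀ v₀ ps w a).Step (simStart B C) β) (h₂ : β (slot 2) = 0)
    (h₃ : β (slot 3) = 0) (hk : β (stackCtr (E.idx k₁)) = 0) :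
    ∃ c, TM2.Reaches m ⟨some l₀, v₀, Function.update (fun _ => []) k₀ w⟩ c ∧ c.l = none ∧
      c.stk k₁ = [a] := by
  rw [simStart_eq (N := E.N)] at h
  obtain ⟨-, -, h⟩ := (sound_loadProg hw).seq' (mono_mainProg m l₀ v₀ ps k₁ a)
    (fun γ _ _ hγ => by
      obtain ⟨hS, rfl⟩ := hγ
      exact sound_mainProg hm (good_update_nil hw) hS) C β h
  obtain ⟨β', C', rfl, -, c, hc, hl, hG, hcode⟩ := h (by simp [Budget.slack, stackBudget, h₂, h₃])
  rw [Finsupp.add_apply] at hk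
  rw [(Nat.add_eq_zero_iff.1 hk).1] at hcode
  -- The quotient is zero, so nothing lies below the top symbol `a`.
  obtain ⟨t, ht, h0⟩ := code_eq (q := 0) (hG k₁) ha (by rw [hcode, mul_zero])
  exact ⟨c, hc, hl, by rw [ht, code_eq_zero h0.symm]⟩

theorem reach_simProg {m : Λ → TM2.Stmt Γ Λ σ} (hm : ∀ l, E.Allowed (m l)) {s : ℕ}
    (hs : ∀ l, pushes (m l) ≤ s) {l₀ : Λ} {v₀ : σ}
    {ps : List (Λ × σ)} (hps : ∀ q, q ∈ ps) {k₀ k₁ : K} {w : List (Γ k₀)}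
    (hw : ∀ b ∈ w, b ∈ E.alph k₀) {a : Γ k₁} {B n : ℕ} (hB : E.W ^ (w.length + n * s) ≤ B)
    (hn : (flip bind (TM2.step m))^[n]
      (some ⟨some l₀, v₀, Function.update (fun _ => []) k₀ w⟩) =
        some ⟨none, v₀, Function.update (fun _ => []) k₁ [a]⟩) :
    ∃ C, (E.simProg m l₀ v₀ ps w a).Step (simStart B C) 0 := by
  have hL : ∀ k, (Function.update (fun j => ([] : List (Γ j))) k₀ w k).length ≤ w.length := by
    intro k
    by_cases hk : k = k₀
    · subst hk; simp
    · simp [Function.update_of_ne hk]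
  obtain ⟨C, hC⟩ := (reach_loadProg (B := B) hw ((Nat.pow_le_pow_right E.W_pos (by omega)).trans
    hB)).seq (testFree_loadProg w) (reach_mainProg (a := a) (k := k₁) hm hs hps
      (good_update_nil hw) hL hB (by simp) (fun j hj => by simp [Function.update_of_ne hj]) hn)
  exact ⟨C, by rw [simStart_eq (N := E.N)]; exact hC⟩

end StackCode

theorem initList_eq (tm : FinTM2) (s : List (tm.Γ tm.k₀)) : initList tm s =
    ⟨some tm.main, tm.initialState, Function.update (fun _ => []) tm.k₀ s⟩ := by
  rw [initList]
  congr 1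
  funext k
  by_cases hk : k = tm.k₀
  · subst hk; simp
  · simp [hk, Function.update_of_ne hk]

theorem haltList_eq (tm : FinTM2) (s : List (tm.Γ tm.k₁)) : haltList tm s =
    ⟨none, tm.initialState, Function.update (fun _ => []) tm.k₁ s⟩ := by
  rw [haltList]
  congr 1
  funext k
  by_cases hk : k = tm.k₁
  · subst hk; simp
  · simp [hk, Function.update_of_ne hk]

/-- A deterministic computation halts in at most one configuration. -/
theorem eq_of_halts {α : Type*} {f : α → Option α} {a b c : α}
    (hb : ReflTransGen (fun x y => y ∈ f x) a b) (hb' : f b = none) {n : ℕ}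
    (hc : (flip bind f)^[n] (some a) = some c) (hc' : f c = none) : b = c := by
  have hnone : ∀ n, (flip bind f)^[n] none = none := fun n =>
    Function.iterate_fixed (by simp [flip]) n
  induction hb using ReflTransGen.head_induction_on generalizing n with
  | refl =>
    cases n with
    | zero => simpa using hc
    | succ n =>
      rw [Function.iterate_succ_apply] at hc
      rw [show flip bind f (some b) = none from hb', hnone] at hc
      exact absurd hc (by simp)
  | head h _ ih =>
    cases n with
    | zero =>
      obtain rfl : _ = c := by simpa using hc
      simp [hc'] at h
    | succ n =>
      rw [Function.iterate_succ_apply] at hc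
      refine ih (n := n) ?_
      rw [← hc]
      simp [flip, Option.mem_def.1 h]

/-- The checking program that simulates a Turing machine on the input `w`. -/
def reduction (tm : FinTM2) (E : StackCode tm.Γ tm.Λ tm.σ) (ps : List (tm.Λ × tm.σ))
    (e : Bool → tm.Γ tm.k₀) (a : tm.Γ tm.k₁) (D N : ℕ) (w : List Bool) : CounterProgram :=
  (amplified D (E.simProg tm.m tm.main tm.initialState ps (w.map e) a)).thenTests (List.range N)

theorem isChecking_reduction {tm : FinTM2} {E : StackCode tm.Γ tm.Λ tm.σ}
    {ps : List (tm.Λ × tm.σ)} {e : Bool → tm.Γ tm.k₀} {a : tm.Γ tm.k₁} {D N : ℕ} {w : List Bool} :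
    (reduction tm E ps e a D N w).IsChecking :=
  ⟨amplified D (E.simProg tm.m tm.main tm.initialState ps (w.map e) a), List.range N,
    ⟨⟨testFree_block _ _, testFree_xfer _ _⟩, (isAmplifier_amplifier D).testFree,
    ⟨testFree_xfer _ _, testFree_xfer _ _, testFree_xfer _ _⟩, StackCode.testFree_loadProg _,
    StackCode.testFree_mainProg _ _ _ _ _ _⟩, rfl⟩

/-- An accurate run yields a halting computation with output `true`; the machine is deterministic,
so this is the computation that outputs `f w`. Conversely, the time bound and `hD` give enough room
to simulate the accepting computation. -/
theorem reaches_reduction_iff {f : List Bool → Bool}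
    (T : TM2ComputableInTime (id : List Bool → List Bool) Computability.encodeBool f)
    {E : StackCode T.tm.Γ T.tm.Λ T.tm.σ} (hE : ∀ l, E.Allowed (T.tm.m l))
    (h₀ : ∀ b, b ∈ E.alph T.tm.k₀)
    (h₁ : T.outputAlphabet.symm true ∈ E.alph T.tm.k₁) {s : ℕ}
    (hs : ∀ l, StackCode.pushes (T.tm.m l) ≤ s) {ps : List (T.tm.Λ × T.tm.σ)} (hps : ∀ q, q ∈ ps)
    {D N : ℕ} {w : List Bool} (hD : E.W ^ (w.length + T.time w.length * s) ≤ amplify D 3)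
    (hN : 8 * D + 16 ≤ N) (hN' : slot 3 < N) (hN'' : stackCtr (E.idx T.tm.k₁) < N) :
    (reduction T.tm E ps T.inputAlphabet.symm (T.outputAlphabet.symm true) D N w).Reaches ↔
      f w = true := by
  have hsim : (E.simProg T.tm.m T.tm.main T.tm.initialState ps (w.map T.inputAlphabet.symm)
      (T.outputAlphabet.symm true)).OnSlots :=
    (StackCode.onSlots_loadProg _).seq (StackCode.onSlots_mainProg _ _ _ _ _ _)
  have hrun := (T.outputsFun w).evals_in_steps
  have hsteps := (T.outputsFun w).steps_le_m
  set n := (T.outputsFun w).steps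
  have hrun' : (flip bind (TM2.step T.tm.m))^[n] (some ⟨some T.tm.main, T.tm.initialState,
      Function.update (fun _ => []) T.tm.k₀ (w.map T.inputAlphabet.symm)⟩) =
      some ⟨none, T.tm.initialState, Function.update (fun _ => []) T.tm.k₁
        [T.outputAlphabet.symm (f w)]⟩ := by
    have h := hrun
    rw [initList_eq, Option.map_some, haltList_eq] at h
    exact h
  rw [reduction, amplified_reaches hsim hN]
  constructor
  · rintro ⟨C, β, hβ, hz⟩
    obtain ⟨c, hc, hl, hk⟩ := StackCode.sound_simProg hE (fun b _ => h₀ b) h₁ hβ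
      (hz _ (by simp only [slot] at *; omega)) (hz _ hN') (hz _ hN'')
    have hc' : TM2.step T.tm.m c = none := by
      obtain ⟨l, v, S⟩ := c
      obtain rfl : l = none := hl
      rfl
    have := eq_of_halts hc hc' hrun' rfl
    rw [this] at hk
    simpa using hk
  · intro hf
    rw [hf] at hrun'
    obtain ⟨C, hC⟩ := StackCode.reach_simProg hE hs (ps := ps) hps (fun b _ => h₀ b)
      (B := amplify D 3) ((Nat.pow_le_pow_right E.W_pos (Nat.add_le_add (by simp)
        (Nat.mul_le_mul_right s hsteps))).trans hD) hrun'
    exact ⟨C, 0, hC, fun _ _ => rfl⟩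

/-! ### Primitive recursiveness of the reduction -/

/-- The program as a list of pairs of a constructor tag and a counter name. -/
def tokens : CounterProgram → List (ℕ × ℕ)
  | inc c => [(0, c)]
  | dec c => [(1, c)]
  | test c => [(2, c)]
  | loop M => (3, 0) :: tokens M
  | seq M N => (4, 0) :: (tokens M ++ tokens N)
  | choice M N => (5, 0) :: (tokens M ++ tokens N)

/-- The encoding of a token. -/
def tokenBits (t : ℕ × ℕ) : List Bool :=
  if t.1 = 0 then [false, false, false] ++ (List.replicate t.2 true ++ [false])
  else if t.1 = 1 then [false, false, true] ++ (List.replicate t.2 true ++ [false])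
  else if t.1 = 2 then [false, true, false] ++ (List.replicate t.2 true ++ [false])
  else if t.1 = 3 then [false, true, true]
  else if t.1 = 4 then [true, false, false]
  else [true, false, true]

/-- Prefix notation makes the encoding a token-wise map, so primitive recursiveness can be checked
on flat lists, where composing programs is concatenation. -/
theorem encode_eq_flatMap (M : CounterProgram) : M.encode = M.tokens.flatMap tokenBits := by
  induction M with
  | inc c | dec c | test c => simp [encode, tokens, tokenBits]
  | loop M ih => simp [encode, tokens, tokenBits, ih]
  | seq M N ih₁ ih₂ | choice M N ih₁ ih₂ => simp [encode, tokens, tokenBits, ih₁, ih₂]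

theorem primrec_replicate {α : Type*} [Primcodable α] (a : α) :
    Primrec fun n : ℕ => List.replicate n a :=
  (Primrec.list_map Primrec.list_range (Primrec.const a).to₂).of_eq fun n => by simp

theorem primrec_tokenBits : Primrec tokenBits := by
  have hu : Primrec fun t : ℕ × ℕ => List.replicate t.2 true ++ [false] :=
    Primrec.list_append.comp ((primrec_replicate true).comp Primrec.snd) (Primrec.const _)
  have ht : ∀ n : ℕ, PrimrecPred fun t : ℕ × ℕ => t.1 = n := fun n =>
    Primrec.eq.comp Primrec.fst (Primrec.const n)
  exact Primrec.ite (ht 0) (Primrec.list_append.comp (Primrec.const _) hu)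
    (Primrec.ite (ht 1) (Primrec.list_append.comp (Primrec.const _) hu)
    (Primrec.ite (ht 2) (Primrec.list_append.comp (Primrec.const _) hu)
    (Primrec.ite (ht 3) (Primrec.const _) (Primrec.ite (ht 4) (Primrec.const _)
    (Primrec.const _)))))

/-- The family of programs has a primitive recursive presentation. -/
def PrimrecFamily {α : Type*} [Primcodable α] (P : α → CounterProgram) : Prop :=
  Primrec fun a => (P a).tokens

namespace PrimrecFamily

variable {α : Type*} [Primcodable α] {P Q : α → CounterProgram} {c : α → ℕ}

theorem encode (h : PrimrecFamily P) : Primrec fun a => (P a).encode :=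
  (Primrec.list_flatMap h (primrec_tokenBits.comp Primrec.snd).to₂).of_eq fun _ =>
    (encode_eq_flatMap _).symm

theorem const (M : CounterProgram) : PrimrecFamily fun _ : α => M := Primrec.const _

theorem comp {β : Type*} [Primcodable β] (h : PrimrecFamily P) {g : β → α} (hg : Primrec g) :
    PrimrecFamily fun b => P (g b) :=
  Primrec.comp (f := fun a => (P a).tokens) h hg

theorem inc (hc : Primrec c) : PrimrecFamily fun a => inc (c a) :=
  Primrec.list_cons.comp (Primrec.pair (Primrec.const 0) hc) (Primrec.const [])

theorem dec (hc : Primrec c) : PrimrecFamily fun a => dec (c a) :=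
  Primrec.list_cons.comp (Primrec.pair (Primrec.const 1) hc) (Primrec.const [])

theorem loop (hP : PrimrecFamily P) : PrimrecFamily fun a => loop (P a) :=
  Primrec.list_cons.comp (Primrec.const (3, 0)) hP

theorem seq (hP : PrimrecFamily P) (hQ : PrimrecFamily Q) :
    PrimrecFamily fun a => seq (P a) (Q a) :=
  Primrec.list_cons.comp (Primrec.const (4, 0)) (Primrec.list_append.comp hP hQ)

theorem thenIncs (hP : PrimrecFamily P) {l : List (α → ℕ)} (hl : ∀ c ∈ l, Primrec c) :
    PrimrecFamily fun a => thenIncs (P a) (l.map fun c => c a) := by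
  induction l generalizing P with
  | nil => exact hP
  | cons c l ih =>
    exact ih (P := fun a => CounterProgram.seq (P a) (CounterProgram.inc (c a)))
      (hP.seq (inc (hl c (by simp)))) fun d hd => hl d (by simp [hd])

theorem thenDecs (hP : PrimrecFamily P) {l : List (α → ℕ)} (hl : ∀ c ∈ l, Primrec c) :
    PrimrecFamily fun a => thenDecs (P a) (l.map fun c => c a) := by
  induction l generalizing P with
  | nil => exact hP
  | cons c l ih =>
    exact ih (P := fun a => CounterProgram.seq (P a) (CounterProgram.dec (c a)))
      (hP.seq (dec (hl c (by simp)))) fun d hd => hl d (by simp [hd])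

theorem block {neg pos : List (α → ℕ)} (hn : ∀ c ∈ neg, Primrec c) (hp : ∀ c ∈ pos, Primrec c) :
    PrimrecFamily fun a => block (neg.map fun c => c a) (pos.map fun c => c a) := by
  cases neg with
  | nil => exact thenIncs (const _) hp
  | cons c neg =>
    exact thenIncs (thenDecs (dec (hn c (by simp))) fun d hd => hn d (by simp [hd])) hp

theorem shiftBlock (neg pos : List ℕ) :
    PrimrecFamily fun n => CounterProgram.block (neg.map (n + ·)) (pos.map (n + ·)) := by
  have h : ∀ l : List ℕ, ∀ c ∈ l.map fun (i n : ℕ) => n + i, Primrec c := by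
    intro l c hc
    obtain ⟨i, -, rfl⟩ := List.mem_map.1 hc
    exact Primrec.nat_add.comp Primrec.id (Primrec.const i)
  have := block (h neg) (h pos)
  simp only [List.map_map] at this
  exact this

theorem shiftXfer (neg pos : List ℕ) :
    PrimrecFamily fun n => xfer (neg.map (n + ·)) (pos.map (n + ·)) :=
  (shiftBlock neg pos).loop

theorem shiftInc (i : ℕ) : PrimrecFamily fun n => CounterProgram.inc (n + i) :=
  inc (Primrec.nat_add.comp Primrec.id (Primrec.const i))

theorem shiftDec (i : ℕ) : PrimrecFamily fun n => CounterProgram.dec (n + i) :=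
  dec (Primrec.nat_add.comp Primrec.id (Primrec.const i))

theorem shiftZeroTest (c d x y : ℕ) :
    PrimrecFamily fun n => zeroTest (n + c) (n + d) (n + x) (n + y) :=
  (shiftXfer [y, d] [x]).seq ((shiftXfer [x, d] [y]).seq (shiftDec c))

theorem shiftDrain (c d : ℕ) (neg pos : List ℕ) (x y : ℕ) : PrimrecFamily fun n =>
    drain (n + c) (n + d) (neg.map (n + ·)) (pos.map (n + ·)) (n + x) (n + y) :=
  (shiftXfer neg pos).seq (shiftZeroTest c d x y)

end PrimrecFamily

/-! ### Primitive recursive presentation of the construction. -/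

open PrimrecFamily

theorem primrecFamily_addWeight : PrimrecFamily addWeight :=
  (shiftDrain 17 18 [20, 16] [21, 19, 22] 20 21).seq (shiftDrain 17 18 [21, 19] [20, 16] 19 16)

theorem primrecFamily_subWeight : PrimrecFamily subWeight :=
  (shiftDrain 17 18 [20, 16, 22] [21, 19] 20 21).seq (shiftDrain 17 18 [21, 19] [20, 16] 19 16)

theorem primrecFamily_carryBack : PrimrecFamily carryBack :=
  (shiftBlock [20] [21]).seq ((shiftXfer [0, 22] [8]).seq
    ((shiftXfer [1, 22] [9]).seq (shiftXfer [2, 22] [10])))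

theorem primrecFamily_fillTriple : PrimrecFamily fillTriple :=
  (shiftInc 8).seq ((shiftInc 9).seq ((shiftInc 10).seq (shiftInc 10))).loop

theorem primrecFamily_iterSetup : PrimrecFamily iterSetup :=
  (shiftDrain 17 18 [16] [19, 20] 16 19).seq (shiftDrain 17 18 [19] [16] 19 16)

theorem primrecFamily_iterClear : PrimrecFamily iterClear :=
  (shiftZeroTest 17 18 20 21).seq ((shiftXfer [16] []).seq (shiftXfer [21] []))

/-- The effect of `weigh` on tokens. -/
def weighToken (n : ℕ) (t : ℕ × ℕ) : List (ℕ × ℕ) :=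
  if t.1 = 0 then (4, 0) :: t :: (addWeight n).tokens
  else if t.1 = 1 then (4, 0) :: t :: (subWeight n).tokens
  else [t]

/-- Weighing replaces leaves of the program by fixed subprograms; in prefix notation this is a
substitution of tokens and needs no recursion on the program. -/
theorem tokens_weigh (n : ℕ) (M : CounterProgram) :
    (weigh n M).tokens = M.tokens.flatMap (weighToken n) := by
  induction M with
  | inc c | dec c | test c => simp [weigh, tokens, weighToken]
  | loop M ih => simp [weigh, tokens, weighToken, ih]
  | seq M N ih₁ ih₂ | choice M N ih₁ ih₂ => simp [weigh, tokens, weighToken, ih₁, ih₂]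

theorem primrec_weighToken : Primrec₂ weighToken := by
  have ht : ∀ i : ℕ, PrimrecPred fun p : ℕ × ℕ × ℕ => p.2.1 = i := fun i =>
    Primrec.eq.comp (Primrec.fst.comp Primrec.snd) (Primrec.const i)
  have hc : ∀ {P : ℕ → CounterProgram}, PrimrecFamily P →
      Primrec fun p : ℕ × ℕ × ℕ => (4, 0) :: p.2 :: (P p.1).tokens := fun hP =>
    Primrec.list_cons.comp (Primrec.const _) (Primrec.list_cons.comp Primrec.snd
      (hP.comp Primrec.fst))
  exact Primrec.ite (ht 0) (hc primrecFamily_addWeight)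
    (Primrec.ite (ht 1) (hc primrecFamily_subWeight)
      (Primrec.list_cons.comp Primrec.snd (Primrec.const [])))

theorem primrecFamily_weigh {α : Type*} [Primcodable α] {P : α → CounterProgram} {n : α → ℕ}
    (hP : PrimrecFamily P) (hn : Primrec n) : PrimrecFamily fun a => weigh (n a) (P a) := by
  have h : Primrec₂ fun (a : α) (t : ℕ × ℕ) => weighToken (n a) t :=
    (primrec_weighToken.comp (hn.comp Primrec.fst) Primrec.snd).to₂
  refine (Primrec.list_flatMap (f := fun a => (P a).tokens) hP h).of_eq fun a => ?_
  rw [tokens_weigh]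

theorem primrecFamily_amplifier : PrimrecFamily amplifier := by
  have h8 : Primrec fun p : ℕ × List (ℕ × ℕ) => 8 * p.1 :=
    Primrec.nat_mul.comp (Primrec.const 8) Primrec.fst
  have hseq : ∀ {f g : ℕ × List (ℕ × ℕ) → List (ℕ × ℕ)}, Primrec f → Primrec g →
      Primrec fun p => (4, 0) :: (f p ++ g p) := fun hf hg =>
    Primrec.list_cons.comp (Primrec.const (4, 0)) (Primrec.list_append.comp hf hg)
  have hfam : ∀ {P : ℕ → CounterProgram}, PrimrecFamily P →
      Primrec fun p : ℕ × List (ℕ × ℕ) => (P (8 * p.1)).tokens := fun hP => hP.comp h8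
  have hw : Primrec fun p : ℕ × List (ℕ × ℕ) => p.2.flatMap (weighToken (8 * p.1)) :=
    Primrec.list_flatMap Primrec.snd
      (primrec_weighToken.comp (h8.comp Primrec.fst) Primrec.snd).to₂
  -- Primitive recursion on the level, with the token list of the previous amplifier as the value
  -- carried along.
  refine (Primrec.nat_rec₁ (amplifier 0).tokens (hseq (hfam primrecFamily_iterSetup)
    (hseq (hfam (primrecFamily_weigh primrecFamily_fillTriple Primrec.id))
      (hseq (Primrec.list_cons.comp (Primrec.const (3, 0))
        (hseq hw (hfam primrecFamily_carryBack))) (hfam primrecFamily_iterClear)))).to₂).of_eq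
    fun k => ?_
  induction k with
  | zero => rfl
  | succ k ih =>
    simp only [ih]
    rw [← tokens_weigh]
    rfl

theorem primrecFamily_fillInput : PrimrecFamily fillInput :=
  (shiftBlock [] [0, 0, 0]).seq (shiftXfer [] [1, 2, 2, 2, 2, 2, 2])

theorem primrecFamily_moveTriple : PrimrecFamily moveTriple := by
  have h : ∀ i s, PrimrecFamily fun n => xfer [n + i] [slot s] := fun i s =>
    (PrimrecFamily.block (α := ℕ) (neg := [(· + i)]) (pos := [fun _ => slot s])
      (by simpa using Primrec.nat_add.comp Primrec.id (Primrec.const i))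
      (by simpa using Primrec.const _)).loop
  exact (h 0 0).seq ((h 1 2).seq (h 2 3))

theorem primrecFamily_amplified {α : Type*} [Primcodable α] {P : α → CounterProgram} {D : α → ℕ}
    (hP : PrimrecFamily P) (hD : Primrec D) : PrimrecFamily fun a => amplified (D a) (P a) := by
  have h8 : Primrec fun a => 8 * D a := Primrec.nat_mul.comp (Primrec.const 8) hD
  exact (primrecFamily_fillInput.comp (Primrec.nat_add.comp h8 (Primrec.const 8))).seq
    ((primrecFamily_amplifier.comp hD).seq ((primrecFamily_moveTriple.comp h8).seq hP))

theorem tokens_thenTests (M : CounterProgram) (cs : List ℕ) : (M.thenTests cs).tokens =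
    List.replicate cs.length (4, 0) ++ (M.tokens ++ cs.map fun c => (2, c)) := by
  induction cs generalizing M with
  | nil => simp [thenTests]
  | cons c cs ih =>
    change (thenTests (CounterProgram.seq M (test c)) cs).tokens = _
    rw [ih]
    simp [tokens, List.replicate_succ']

theorem primrecFamily_thenTests {α : Type*} [Primcodable α] {P : α → CounterProgram} {N : α → ℕ}
    (hP : PrimrecFamily P) (hN : Primrec N) :
    PrimrecFamily fun a => (P a).thenTests (List.range (N a)) := by
  refine (Primrec.list_append.comp ((primrec_replicate (4, 0)).comp hN) (Primrec.list_append.comp hP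
    (Primrec.list_map (Primrec.list_range.comp hN)
      ((Primrec.pair (Primrec.const 2) Primrec.snd).to₂)))).of_eq fun a => ?_
  rw [tokens_thenTests, List.length_range]

theorem primrecFamily_loadProg {K : Type} {Γ : K → Type} {Λ σ : Type} (E : StackCode Γ Λ σ) {k : K}
    (e : Bool → Γ k) : PrimrecFamily fun w : List Bool => E.loadProg k (w.map e) := by
  -- For a fixed machine, only two push programs are needed, one for each input bit, so nothing has
  -- to be known about how digits are computed.
  have hpush : Primrec fun b => (pushCtr E.W (E.idx k) (E.digit k (e b))).tokens :=
    Primrec.dom_finite _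
  refine (Primrec.list_foldr (h := fun _ p => (4, 0) :: (p.2 ++
    (pushCtr E.W (E.idx k) (E.digit k (e p.1))).tokens)) Primrec.id
    (Primrec.const E.setupProg.tokens) (Primrec.list_cons.comp (Primrec.const (4, 0))
      (Primrec.list_append.comp (Primrec.snd.comp Primrec.snd)
        (hpush.comp (Primrec.fst.comp Primrec.snd)))).to₂).of_eq fun w => ?_
  induction w with
  | nil => rfl
  | cons b w ih =>
    rw [id, List.foldr_cons]
    rw [id] at ih
    rw [ih]
    rfl

theorem primrecFamily_reduction {tm : FinTM2} (E : StackCode tm.Γ tm.Λ tm.σ)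
    (ps : List (tm.Λ × tm.σ)) (e : Bool → tm.Γ tm.k₀) (a : tm.Γ tm.k₁) {D N : List Bool → ℕ}
    (hD : Primrec D) (hN : Primrec N) :
    PrimrecFamily fun w => reduction tm E ps e a (D w) (N w) w :=
  primrecFamily_thenTests (primrecFamily_amplified
    ((primrecFamily_loadProg E e).seq (PrimrecFamily.const _)) hD) hN

theorem exists_forall_le {ι : Type*} [Finite ι] (g : ι → ℕ) : ∃ s, ∀ i, g i ≤ s := by
  obtain ⟨s, hs⟩ := (Set.finite_range g).bddAbove
  exact ⟨s, fun i => hs ⟨i, rfl⟩⟩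

theorem fOmegaHard_checkingReachability : FOmegaHard checkingReachability := by
  rintro L ⟨p, hp, f, hf, T, c, hT⟩
  have := T.tm.kFin
  have := T.tm.ΛFin
  have := T.tm.σFin
  have := T.tm.Γk₀Fin
  obtain ⟨E, hE, h₀, h₁⟩ := StackCode.exists_allowed T.tm.m (k₀ := T.tm.k₀)
    (T.outputAlphabet.symm true)
  obtain ⟨s, hs⟩ := exists_forall_le fun l => StackCode.pushes (T.tm.m l)
  obtain ⟨a, ha⟩ := exists_pow_le_amplify E.W s c E.W_pos
  have hlen : Primrec fun w : List Bool => w.length := Primrec.list_length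
  let D : List Bool → ℕ := fun w => a + (6 * p w.length + w.length)
  -- Large enough to cover the amplifier, the budget counters and the output counter; `slot 3 = 31`
  -- already exceeds the `16` needed beyond `8 * D w`.
  let N : List Bool → ℕ := fun w => 8 * D w + (slot 3 + stackCtr (E.idx T.tm.k₁) + 1)
  have hD : Primrec D := Primrec.nat_add.comp (Primrec.const a) (Primrec.nat_add.comp
    (Primrec.nat_mul.comp (Primrec.const 6) ((Primrec.nat_iff.2 hp).comp hlen)) hlen)
  have hN : Primrec N := Primrec.nat_add.comp (Primrec.nat_mul.comp (Primrec.const 8) hD)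
    (Primrec.const _)
  let ps := (Finset.univ : Finset (T.tm.Λ × T.tm.σ)).toList
  let R : List Bool → CounterProgram := fun w =>
    reduction T.tm E ps T.inputAlphabet.symm (T.outputAlphabet.symm true) (D w) (N w) w
  refine ⟨fun w => (R w).encode, (primrecFamily_reduction E ps _ _ hD hN).encode, fun w => ?_⟩
  have hR : (R w).Reaches ↔ f w = true :=
    reaches_reduction_iff T hE h₀ h₁ hs (by simp [ps]) (ha _ _ _ (hT _))
      (by simp only [N, slot]; omega) (by simp only [N]; omega) (by simp only [N]; omega)
  rw [← hf, ← hR]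
  constructor
  · exact fun h => ⟨R w, isChecking_reduction, h, rfl⟩
  · rintro ⟨P, -, h, hP⟩
    rwa [encode_injective hP] at h

end CounterProgram

theorem mainTheorem1 : FOmegaHard CounterProgram.checkingReachability := by
  exact CounterProgram.fOmegaHard_checkingReachability
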